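/- **Theorem.** Let $\mathcal M$ be an $\mathbb N$-graded manifold (a graded-commutative structure sheaf on a finite-dimensional, Hausdorff, second countable smooth manifold $M$, with smooth functions as its degree-$0$ part and locally freely generated over them by finitely many graded-commuting coordinates of positive degrees). Differential forms are polynomial functions on $T[1]\mathcal M$, graded-commutative for the total degree; vector fields $X$ act by contractions $\iota_X$ of total degree $|X|-1$, with $\iota_X\,df = X(f)$, $\iota_{fX}=f\iota_X$ and $\mathcal L_X=\iota_X d+(-1)^{|X|}d\,\iota_X$. Let $n\ge 0$ and let $\alpha$ be a contact $1$-form of degree $n$ on $\mathcal M$: a nowhere-vanishing $1$-form of degree $n$ such that $X\mapsto \iota_X d\alpha$ induces a bijection from $\mathcal D=\ker(\iota_\cdot\alpha)$ to $\mathcal D^*$. Let $Q$ be a homological vector field (degree $1$, $Q^2=0$) that is contact, i.e. $[Q,\Gamma(\mathcal D)]\subseteq\Gamma(\mathcal D)$. Then there is a unique function $\varphi$ of degree $1$ on $\mathcal M$ with $\mathcal L_Q\alpha=-\varphi\alpha$. On $\mathcal M\times\mathbb R$, with $t$ the coordinate on $\mathbb R$, the $2$-form $\tilde\omega=d(e^t\alpha)$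 is a symplectic form of degree $n$: it is closed and $X\mapsto\iota_X\tilde\omega$ is a bijection from vector fields to $1$-forms. The vector field $\tilde Q=Q+\varphi\,\partial_t$ is homological ($\tilde Q$ has degree $1$ and $\tilde Q^2=0$), preserves $\tilde\omega$ ($\mathcal L_{\tilde Q}\tilde\omega=0$), and is Hamiltonian with Hamiltonian function $H=e^t\iota_Q\alpha$, where $X$ is Hamiltonian for $f$ if $df=(-1)^{|X|-1}\iota_X\tilde\omega$ (so $dH=\iota_{\tilde Q}\tilde\omega$). In particular, $(\mathcal M\times\mathbb R,\tilde\omega,\tilde Q)$ is a symplectic $\mathbb NQ$-manifold of degree $n$. -/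

import Mathlib

open scoped Manifold ContDiff
open TopologicalSpace

namespace NGeom

/-! ## Graded-commutative algebras and their Cartan calculus -/

/-- The sign `(-1)^k`. -/
noncomputable def koszul (k : ℤ) : ℝ := (-1 : ℝ) ^ k

theorem koszul_even {k : ℤ} (h : Even k) : koszul k = 1 := h.neg_one_zpow

theorem koszul_odd {k : ℤ} (h : Odd k) : koszul k = -1 := h.neg_one_zpow

theorem koszul_add (a b : ℤ) : koszul (a + b) = koszul a * koszul b :=
  zpow_add₀ (by norm_num) a b

theorem koszul_congr {a b c : ℤ} (h : a = b + 2 * c) : koszul a = koszul b := by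
  rw [h, koszul_add, koszul_even (k := 2 * c) ⟨c, by ring⟩, mul_one]

theorem koszul_congr_neg {a b c : ℤ} (h : a = b + 1 + 2 * c) : koszul a = -koszul b := by
  rw [koszul_congr h, koszul_add, koszul_odd odd_one, mul_neg_one]

/-- `A = ⨁ 𝒜 k` is a `ℤ`-graded, graded-commutative real algebra. -/
class GradedComm {A : Type*} [Ring A] [Algebra ℝ A] (𝒜 : ℤ → Submodule ℝ A) : Prop
    extends SetLike.GradedMonoid 𝒜 where
  isInternal : DirectSum.IsInternal 𝒜
  comm : ∀ {i j : ℤ} {f g : A}, f ∈ 𝒜 i → g ∈ 𝒜 j → f * g = koszul (i * j) • (g * f)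

section Calculus

variable {A : Type*} [Ring A] [Algebra ℝ A] (𝒜 : ℤ → Submodule ℝ A)

/-- Vector fields of degree `k`: graded derivations `X` of degree `k`,
`X (f g) = X f · g + (-1)^{k |f|} f · X g`. -/
def VF (k : ℤ) : Submodule ℝ (A →ₗ[ℝ] A) where
  carrier := {X | (∀ j, ∀ f ∈ 𝒜 j, X f ∈ 𝒜 (j + k)) ∧
    ∀ j, ∀ f ∈ 𝒜 j, ∀ g, X (f * g) = X f * g + koszul (k * j) • (f * X g)}
  zero_mem' := ⟨fun j f _ => by simp, fun j f _ g => by simp⟩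
  add_mem' := by
    rintro X Y ⟨hX, hX'⟩ ⟨hY, hY'⟩
    refine ⟨fun j f hf => add_mem (hX j f hf) (hY j f hf), fun j f hf g => ?_⟩
    simp only [LinearMap.add_apply, hX' j f hf g, hY' j f hf g, add_mul, mul_add, smul_add]
    abel
  smul_mem' := by
    rintro c X ⟨hX, hX'⟩
    refine ⟨fun j f hf => (𝒜 _).smul_mem c (hX j f hf), fun j f hf g => ?_⟩
    simp only [LinearMap.smul_apply, hX' j f hf g, smul_add, smul_mul_assoc, mul_smul_comm]
    rw [smul_comm c]

variable {𝒜}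

theorem mem_degree {j k : ℤ} {f : A} (hf : f ∈ 𝒜 j) (h : j = k) : f ∈ 𝒜 k := h ▸ hf

theorem memVF {k j l : ℤ} (X : VF 𝒜 k) {f : A} (hf : f ∈ 𝒜 j) (h : j + k = l) :
    X.1 f ∈ 𝒜 l := mem_degree (X.2.1 j f hf) h

theorem leibnizVF {k j : ℤ} (X : VF 𝒜 k) {f : A} (hf : f ∈ 𝒜 j) (g : A) :
    X.1 (f * g) = X.1 f * g + koszul (k * j) • (f * X.1 g) := X.2.2 j f hf g

/-- The graded commutator `[X, Y] = X Y - (-1)^{|X||Y|} Y X`. -/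
noncomputable def bracket {k l : ℤ} (X : VF 𝒜 k) (Y : VF 𝒜 l) : VF 𝒜 (k + l) :=
  ⟨X.1 ∘ₗ Y.1 - koszul (k * l) • Y.1 ∘ₗ X.1, by
    constructor
    · intro j f hf
      exact sub_mem (mem_degree (memVF X (memVF Y hf rfl) rfl) (by ring))
        ((𝒜 _).smul_mem _ (mem_degree (memVF Y (memVF X hf rfl) rfl) (by ring)))
    · intro j f hf g
      have e1 : koszul (k * (j + l)) = koszul (k * l) * koszul (k * j) := by
        rw [← koszul_add]; congr 1; ring
      have e2 : koszul (l * (j + k)) = koszul (k * l) * koszul (l * j) := by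
        rw [← koszul_add]; congr 1; ring
      have e3 : koszul (k * l) * koszul (k * l) = 1 := by
        rw [← koszul_add]; exact koszul_even ⟨_, rfl⟩
      have e4 : koszul ((k + l) * j) = koszul (k * j) * koszul (l * j) := by
        rw [← koszul_add]; congr 1; ring
      simp only [LinearMap.sub_apply, LinearMap.smul_apply, LinearMap.comp_apply,
        leibnizVF X hf, leibnizVF Y hf, map_add, map_smul, leibnizVF X (memVF Y hf rfl),
        leibnizVF Y (memVF X hf rfl), e1, e2, e4, sub_mul, mul_sub, smul_mul_assoc, mul_smul_comm]
      simp only [smul_add, smul_sub, smul_smul]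
      rw [show koszul (k * l) * (koszul (k * l) * koszul (l * j)) = koszul (l * j) by
        rw [← mul_assoc, e3, one_mul]]
      module⟩

variable [GradedComm 𝒜]

/-- The product `f X` of a function and a vector field; `m` is its degree `|f| + |X|`. -/
noncomputable def lmulVF {j k m : ℤ} (f : 𝒜 j) (X : VF 𝒜 k) (h : j + k = m) : VF 𝒜 m :=
  ⟨LinearMap.mulLeft ℝ f.1 ∘ₗ X.1, by
    subst h
    constructor
    · intro i g hg
      exact mem_degree (SetLike.mul_mem_graded f.2 (memVF X hg rfl)) (by ring)
    · intro i g hg g'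
      simp only [LinearMap.comp_apply, LinearMap.mulLeft_apply, leibnizVF X hg, mul_add,
        mul_smul_comm, ← mul_assoc]
      rw [GradedComm.comm f.2 hg, smul_mul_assoc, smul_smul, ← koszul_add]
      congr 3; ring⟩

variable (𝒜) in
/-- `1`-forms of (manifold) degree `n`, as graded left-linear maps `X ↦ ι_X α` from vector fields
to functions: `|ι_X α| = |X| + n` and `ι_{f X} α = f ι_X α`. -/
def OneForm (n : ℤ) : Submodule ℝ (∀ k, VF 𝒜 k →ₗ[ℝ] 𝒜 (k + n)) where
  carrier := {α | ∀ (j k : ℤ) (f : 𝒜 j) (X : VF 𝒜 k),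
    (α (j + k) (lmulVF f X rfl) : A) = f * α k X}
  zero_mem' := fun j k f X => by simp
  add_mem' := by
    intro α β hα hβ j k f X
    have h1 := hα j k f X
    have h2 := hβ j k f X
    simp [h1, h2, mul_add]
  smul_mem' := by
    intro c α hα j k f X
    have h1 := hα j k f X
    simp [h1]

instance OneForm.instNeg (n : ℤ) : Neg (OneForm 𝒜 n) := ⟨fun α => (-1 : ℝ) • α⟩

/-- The function `ι_X α`. -/
def app {n k : ℤ} (α : OneForm 𝒜 n) (X : VF 𝒜 k) : 𝒜 (k + n) := α.1 k X

theorem app_congr {n k l : ℤ} (α : OneForm 𝒜 n) {X : VF 𝒜 k} {Y : VF 𝒜 l}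
    (h : k = l) (hXY : X.1 = Y.1) : (app α X : A) = app α Y := by
  subst h
  rw [Subtype.ext hXY]

theorem app_lmul {n j k m : ℤ} (α : OneForm 𝒜 n) (f : 𝒜 j) (X : VF 𝒜 k)
    (h : j + k = m) : (app α (lmulVF f X h) : A) = f * app α X := by
  subst h
  exact α.2 j k f X

theorem app_add {n k : ℤ} (α : OneForm 𝒜 n) (X Y : VF 𝒜 k) :
    (app α (X + Y) : A) = app α X + app α Y := by simp [app]

theorem app_smul {n k : ℤ} (α : OneForm 𝒜 n) (c : ℝ) (X : VF 𝒜 k) :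
    (app α (c • X) : A) = c • (app α X : A) := by simp [app]

/-- The product `f α` of a function and a `1`-form; `m` is its degree `|f| + |α|`.  As `ι_Y` has
total degree `|Y| - 1`, `ι_Y (f α) = (-1)^{(|Y| - 1)|f|} f ι_Y α`. -/
noncomputable def lmulForm {j n m : ℤ} (f : 𝒜 j) (α : OneForm 𝒜 n) (h : j + n = m) :
    OneForm 𝒜 m :=
  ⟨fun l =>
    { toFun := fun Y => ⟨koszul ((l - 1) * j) • ((f : A) * app α Y), (𝒜 _).smul_mem _
        (mem_degree (SetLike.mul_mem_graded f.2 (app α Y).2) (by rw [← h]; ring))⟩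
      map_add' := fun X Y => Subtype.ext (by simp [app_add, mul_add])
      map_smul' := fun c X => Subtype.ext (by
        simp only [app_smul, mul_smul_comm, RingHom.id_apply, SetLike.val_smul]
        rw [smul_comm]) }, by
    intro i k g X
    change koszul ((i + k - 1) * j) • ((f : A) * app α (lmulVF g X rfl)) =
      g * koszul ((k - 1) * j) • ((f : A) * app α X)
    rw [app_lmul, ← mul_assoc, GradedComm.comm f.2 g.2, smul_mul_assoc, smul_smul,
      ← koszul_add, mul_smul_comm, ← mul_assoc]
    congr 1
    exact koszul_congr (c := i * j) (by ring)⟩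

/-- The differential of a function: `ι_Y (d f) = Y f`. -/
noncomputable def dFun {j : ℤ} (f : 𝒜 j) : OneForm 𝒜 j :=
  ⟨fun l =>
    { toFun := fun Y => ⟨Y.1 f, memVF Y f.2 (by ring)⟩
      map_add' := fun X Y => rfl
      map_smul' := fun c X => rfl }, fun _ _ _ _ => rfl⟩

variable (𝒜) in
/-- `2`-forms of (manifold) degree `n`, given by their contractions `X ↦ ι_X σ`, subject to
`ι_X ι_Y σ = (-1)^{(|X| - 1)(|Y| - 1)} ι_Y ι_X σ`.  (Linearity in `X` follows.) -/
structure TwoForm (n : ℤ) where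
  contract : ∀ {k : ℤ}, VF 𝒜 k → OneForm 𝒜 (k + n)
  symm : ∀ {k l : ℤ} (X : VF 𝒜 k) (Y : VF 𝒜 l),
    (app (contract Y) X : A) = koszul ((k - 1) * (l - 1)) • (app (contract X) Y : A)

/-- `ι_Y ι_X dα`.  The Cartan relations `L_X = ι_X d + (-1)^{|X|} d ι_X` and
`ι_{[X,Y]} = L_X ι_Y - (-1)^{|X|(|Y| - 1)} ι_Y L_X` force this value. -/
noncomputable def dOneVal {n k l : ℤ} (α : OneForm 𝒜 n) (X : VF 𝒜 k) (Y : VF 𝒜 l) : A :=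
  koszul (k * (l - 1)) • (X.1 (app α Y) - app α (bracket X Y)) - koszul k • Y.1 (app α X)

/-- The exterior derivative `dα` of a `1`-form. -/
noncomputable def dOne {n : ℤ} (α : OneForm 𝒜 n) : TwoForm 𝒜 n where
  contract {k} X :=
    ⟨fun l =>
      { toFun := fun Y => ⟨dOneVal α X Y, sub_mem ((𝒜 _).smul_mem _ (sub_mem
            (memVF X (app α Y).2 (by ring)) (mem_degree (app α (bracket X Y)).2 (by ring))))
            ((𝒜 _).smul_mem _ (memVF Y (app α X).2 (by ring)))⟩
        map_add' := fun Y Z => Subtype.ext (by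
          have h : bracket X (Y + Z) = bracket X Y + bracket X Z := Subtype.ext (by
            ext g; simp [bracket]; abel)
          simp only [dOneVal, h, app_add, map_add, Submodule.coe_add,
            LinearMap.add_apply]
          module)
        map_smul' := fun c Y => Subtype.ext (by
          have h : bracket X (c • Y) = c • bracket X Y := Subtype.ext (by
            ext g; simp [bracket, smul_sub, smul_comm c])
          simp only [dOneVal, h, app_smul, map_smul, SetLike.val_smul,
            LinearMap.smul_apply, RingHom.id_apply]
          module) }, by
      intro j l f Y
      change dOneVal α X (lmulVF f Y rfl) = f * dOneVal α X Y
      have hX : X.1 (f : A) ∈ 𝒜 (j + k) := memVF X f.2 rfl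
      have hb : (app α (bracket X (lmulVF f Y rfl)) : A) =
          X.1 f * app α Y + koszul (k * j) • ((f : A) * app α (bracket X Y)) := by
        have h1 : (bracket X (lmulVF f Y rfl : VF 𝒜 (j + l))).1 =
            ((lmulVF ⟨X.1 f, hX⟩ Y (by ring) : VF 𝒜 (k + (j + l))) +
              koszul (k * j) • (lmulVF f (bracket X Y) (by ring) : VF 𝒜 (k + (j + l)))).1 := by
          ext g
          have e : koszul (k * (j + l)) = koszul (k * j) * koszul (k * l) := by
            rw [← koszul_add]; congr 1; ring
          simp only [bracket, lmulVF, LinearMap.sub_apply, LinearMap.smul_apply,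
            LinearMap.comp_apply, LinearMap.mulLeft_apply, Submodule.coe_add, SetLike.val_smul,
            LinearMap.add_apply, leibnizVF X f.2, mul_sub, mul_smul_comm, e, smul_sub, smul_smul]
          abel
        rw [app_congr α rfl h1, app_add, app_smul, app_lmul,
          app_lmul]
      have e : koszul (k * (j + l - 1)) * koszul (k * j) = koszul (k * (l - 1)) := by
        rw [← koszul_add]; exact koszul_congr (c := k * j) (by ring)
      simp only [dOneVal, hb, app_lmul, leibnizVF X f.2]
      rw [show X.1 (f : A) * (app α Y : A) + koszul (k * j) • ((f : A) * X.1 (app α Y)) -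
          (X.1 f * app α Y + koszul (k * j) • ((f : A) * app α (bracket X Y))) =
          koszul (k * j) • ((f : A) * (X.1 (app α Y) - app α (bracket X Y))) by
        rw [mul_sub]; module]
      rw [smul_smul, e]
      simp only [mul_sub (f : A), mul_smul_comm, smul_sub]
      rfl⟩
  symm {k l} X Y := by
    change dOneVal α Y X = koszul ((k - 1) * (l - 1)) • dOneVal α X Y
    have hb : (app α (bracket Y X) : A) = -koszul (k * l) • (app α (bracket X Y) : A) := by
      rw [← app_smul]
      refine app_congr α (add_comm _ _) ?_
      have e : koszul (k * l) * koszul (k * l) = 1 := by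
        rw [← koszul_add]; exact koszul_even ⟨_, rfl⟩
      ext g
      simp only [bracket, LinearMap.sub_apply, LinearMap.smul_apply, LinearMap.comp_apply,
        SetLike.val_smul, smul_sub, smul_smul, neg_mul, e, mul_comm l k]
      module
    have e1 : koszul ((k - 1) * (l - 1)) * koszul (k * (l - 1)) = -koszul l := by
      rw [← koszul_add]; exact koszul_congr_neg (c := k * l - k - l) (by ring)
    have e2 : koszul ((k - 1) * (l - 1)) * koszul k = -koszul (l * (k - 1)) := by
      rw [← koszul_add]; exact koszul_congr_neg (c := 0) (by ring)
    have e3 : koszul (l * (k - 1)) * koszul (k * l) = koszul l := by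
      rw [← koszul_add]; exact koszul_congr (c := k * l - l) (by ring)
    simp only [dOneVal, hb, smul_sub, smul_smul, e1, e2, mul_neg, e3]
    module

/-- The Lie derivative `L_X α = ι_X dα + (-1)^{|X|} d ι_X α`. -/
noncomputable def lieOne {n k : ℤ} (X : VF 𝒜 k) (α : OneForm 𝒜 n) : OneForm 𝒜 (k + n) :=
  (dOne α).contract X + koszul k • dFun (app α X)

/-- `ι_Z ι_Y L_X σ`, by the relation `ι_{[X,Y]} = L_X ι_Y - (-1)^{|X|(|Y| - 1)} ι_Y L_X`. -/
noncomputable def lieTwoVal {n k l m : ℤ} (X : VF 𝒜 k) (σ : TwoForm 𝒜 n) (Y : VF 𝒜 l)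
    (Z : VF 𝒜 m) : A :=
  koszul (k * (l - 1)) •
    ((app (lieOne X (σ.contract Y)) Z : A) - app (σ.contract (bracket X Y)) Z)

/-- `ι_Z ι_Y ι_X dσ`, by the relation `ι_X d = L_X - (-1)^{|X|} d ι_X`. -/
noncomputable def dTwoVal {n k l m : ℤ} (σ : TwoForm 𝒜 n) (X : VF 𝒜 k) (Y : VF 𝒜 l)
    (Z : VF 𝒜 m) : A :=
  lieTwoVal X σ Y Z - koszul k • (app ((dOne (σ.contract X)).contract Y) Z : A)

/-- A symplectic form of degree `n`: a closed `2`-form for which `X ↦ ι_X σ` is a bijection from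
vector fields to `1`-forms. -/
structure IsSymplectic {n : ℤ} (σ : TwoForm 𝒜 n) : Prop where
  closed : ∀ {k l m : ℤ} (X : VF 𝒜 k) (Y : VF 𝒜 l) (Z : VF 𝒜 m), dTwoVal σ X Y Z = 0
  nondegenerate : ∀ k : ℤ,
    Function.Bijective (fun X : VF 𝒜 k => (σ.contract X : OneForm 𝒜 (k + n)))

/-- A homological vector field: degree `1` and `Q² = 0`. -/
def IsHomological (Q : VF 𝒜 1) : Prop := ∀ f : A, Q.1 (Q.1 f) = 0

/-- `L_X σ = 0`. -/
def IsSymplecticVF {n k : ℤ} (σ : TwoForm 𝒜 n) (X : VF 𝒜 k) : Prop :=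
  ∀ {l m : ℤ} (Y : VF 𝒜 l) (Z : VF 𝒜 m), lieTwoVal X σ Y Z = 0

/-- `X` is Hamiltonian with Hamiltonian function `f`: `d f = (-1)^{|X| - 1} ι_X σ`, where
`|f| = |X| + n`. -/
def IsHamiltonian {n k : ℤ} (σ : TwoForm 𝒜 n) (X : VF 𝒜 k) (f : A) : Prop :=
  ∃ hf : f ∈ 𝒜 (k + n), dFun (⟨f, hf⟩ : 𝒜 (k + n)) = koszul (k - 1) • σ.contract X

/-- Sections of degree `k` of the distribution `D = ker (ι_· α)`. -/
def ker {n : ℤ} (α : OneForm 𝒜 n) (k : ℤ) : Submodule ℝ (VF 𝒜 k) := LinearMap.ker (α.1 k)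

theorem lmul_mem_ker {n j k : ℤ} (α : OneForm 𝒜 n) (f : 𝒜 j) (X : ker α k) :
    lmulVF f X.1 rfl ∈ ker α (j + k) := by
  have h : app α X.1 = 0 := X.2
  exact Subtype.ext ((app_lmul α f X.1 rfl).trans (by simp [h]))

/-- Sections of degree `m` of the dual `D*` of `D = ker (ι_· α)`: graded left-linear maps from
sections of `D` to functions. -/
def KerDual {n : ℤ} (α : OneForm 𝒜 n) (m : ℤ) :
    Submodule ℝ (∀ k, ker α k →ₗ[ℝ] 𝒜 (k + m)) where
  carrier := {β | ∀ (j k : ℤ) (f : 𝒜 j) (X : ker α k),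
    (β (j + k) ⟨lmulVF f X.1 rfl, lmul_mem_ker α f X⟩ : A) = f * β k X}
  zero_mem' := fun j k f X => by simp
  add_mem' := by
    intro β γ hβ hγ j k f X
    have h1 := hβ j k f X
    have h2 := hγ j k f X
    simp [h1, h2, mul_add]
  smul_mem' := by
    intro c β hβ j k f X
    have h1 := hβ j k f X
    simp [h1]

/-- Restriction of a `1`-form to `D = ker (ι_· α)`. -/
def restrictKer {n m : ℤ} (α : OneForm 𝒜 n) (β : OneForm 𝒜 m) : KerDual α m :=
  ⟨fun k => β.1 k ∘ₗ (ker α k).subtype, fun j k f X => β.2 j k f X.1⟩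

/-- `(dα)^♭` induces a bijection from `D = ker (ι_· α)` to `D*`. -/
def IsNondegenerateOnKer {n : ℤ} (α : OneForm 𝒜 n) : Prop :=
  ∀ k : ℤ, Function.Bijective
    (fun X : ker α k => (restrictKer α ((dOne α).contract X.1) : KerDual α (k + n)))

/-- A contact vector field: `[X, Γ(D)] ⊆ Γ(D)` for `D = ker (ι_· α)`. -/
def IsContactVF {n k : ℤ} (α : OneForm 𝒜 n) (X : VF 𝒜 k) : Prop :=
  ∀ (l : ℤ) (Y : VF 𝒜 l), Y ∈ ker α l → bracket X Y ∈ ker α (k + l)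

end Calculus

/-! ## `ℕ`-graded manifolds -/

section Manifolds

universe u v

variable {E : Type*} [NormedAddCommGroup E] [NormedSpace ℝ E] {H : Type*} [TopologicalSpace H]

/-- Smooth real functions on an open set. -/
abbrev Smooth (I : ModelWithCorners ℝ E H) {M : Type v} [TopologicalSpace M] [ChartedSpace H M]
    (U : Opens M) : Type _ := C^∞⟮I, U; ℝ⟯

/-- Restriction of smooth functions. -/
noncomputable def Smooth.res {I : ModelWithCorners ℝ E H} {M : Type v} [TopologicalSpace M]
    [ChartedSpace H M] {U V : Opens M} (h : U ≤ V) (g : Smooth I V) : Smooth I U :=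
  ⟨g ∘ Set.inclusion h, g.contMDiff.comp (contMDiff_inclusion h)⟩

/-- Exponents of the monomials of degree `k` in graded variables of degrees `deg 0, deg 1, …`;
variables of odd degree occur with exponent at most `1`. -/
abbrev Exponent {r : ℕ} (deg : Fin r → ℕ) (k : ℤ) : Type :=
  {e : Fin r → ℕ // (∀ j, Odd (deg j) → e j ≤ 1) ∧ (∑ j, (e j * deg j : ℕ) : ℤ) = k}

theorem Exponent.finite {r : ℕ} {deg : Fin r → ℕ} (hdeg : ∀ j, 1 ≤ deg j) (k : ℤ) :
    Finite (Exponent deg k) := by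
  refine Set.Finite.subset (Set.finite_Iic (fun _ : Fin r => k.toNat)) ?_
  rintro e ⟨-, he⟩ j
  have h1 : e j * deg j ≤ ∑ j, e j * deg j :=
    Finset.single_le_sum (f := fun j => e j * deg j) (fun _ _ => Nat.zero_le _)
      (Finset.mem_univ j)
  have h2 : e j ≤ e j * deg j := Nat.le_mul_of_pos_right _ (hdeg j)
  have h3 : ((∑ j, e j * deg j : ℕ) : ℤ) = k := by rw [← he]; push_cast; rfl
  change e j ≤ k.toNat
  omega

/-- The monomial `ξ₀^{e₀} ξ₁^{e₁} ⋯`. -/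
def monomial {A : Type*} [Monoid A] {r : ℕ} (ξ : Fin r → A) (e : Fin r → ℕ) : A :=
  (List.ofFn fun j => ξ j ^ e j).prod

/-- An `ℕ`-graded manifold with body `M`: a sheaf of graded-commutative algebras on `M` (a sheaf in
every degree), with smooth functions on `M` as its degree `0` part, that is locally freely
generated over the smooth functions by finitely many graded-commuting coordinates of positive
degrees. -/
structure NManifold (I : ModelWithCorners ℝ E H) (M : Type v) [TopologicalSpace M]
    [ChartedSpace H M] where
  /-- The algebra of functions over an open set. -/
  O : Opens M → Type u
  [ring : ∀ U, Ring (O U)]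
  [algebra : ∀ U, Algebra ℝ (O U)]
  /-- Homogeneous functions of degree `k` over an open set. -/
  grading : ∀ U, ℤ → Submodule ℝ (O U)
  [gradedComm : ∀ U, GradedComm (grading U)]
  nonneg : ∀ U k, k < 0 → grading U k = ⊥
  /-- Restriction maps. -/
  res : ∀ {U V : Opens M}, U ≤ V → O V →ₐ[ℝ] O U
  res_mem : ∀ {U V : Opens M} (h : U ≤ V) {k f}, f ∈ grading V k → res h f ∈ grading U k
  res_self : ∀ {U : Opens M} (f : O U), res le_rfl f = f
  res_res : ∀ {U V W : Opens M} (h : U ≤ V) (h' : V ≤ W) (f : O W),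
    res h (res h' f) = res (h.trans h') f
  /-- Compatible homogeneous functions on an open cover glue uniquely. -/
  glue : ∀ {ι : Type v} (W : Opens M) (U : ι → Opens M) (hU : ∀ i, U i ≤ W)
    (_ : ∀ x ∈ W, ∃ i, x ∈ U i) (k : ℤ) (f : ∀ i, O (U i)) (_ : ∀ i, f i ∈ grading (U i) k)
    (_ : ∀ i j V (hi : V ≤ U i) (hj : V ≤ U j), res hi (f i) = res hj (f j)),
    ∃! g : O W, g ∈ grading W k ∧ ∀ i, res (hU i) g = f i
  /-- The inclusion of smooth functions on the body as the functions of degree `0`. -/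
  smooth : ∀ U, Smooth I U →ₐ[ℝ] O U
  smooth_injective : ∀ U, Function.Injective (smooth U)
  mem_grading_zero : ∀ U (f : O U), f ∈ grading U 0 ↔ ∃ g, smooth U g = f
  res_smooth : ∀ {U V : Opens M} (h : U ≤ V) (g : Smooth I V),
    res h (smooth V g) = smooth U (g.res h)
  /-- The number of graded coordinates of positive degree. -/
  rank : ℕ
  /-- The degrees of the graded coordinates. -/
  deg : Fin rank → ℕ
  deg_pos : ∀ j, 1 ≤ deg j
  /-- Graded coordinates exist near every point: over every smaller open set, a function of degree
  `k` is in a unique way a polynomial in them with smooth coefficients. -/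
  exists_coord : ∀ x : M, ∃ U : Opens M, x ∈ U ∧ ∃ ξ : Fin rank → O U,
    (∀ j, ξ j ∈ grading U (deg j)) ∧
    ∀ (V : Opens M) (hV : V ≤ U) (k : ℤ), ∀ f ∈ grading V k,
      ∃! c : Exponent deg k → Smooth I V,
        f = ∑ᶠ e, smooth V (c e) * res hV (monomial ξ e.1)

namespace NManifold

attribute [instance] NManifold.ring NManifold.algebra NManifold.gradedComm

section Product

variable {I : ModelWithCorners ℝ E H} {M : Type v} [TopologicalSpace M] [ChartedSpace H M]

/-- The slice `{x | (x, t) ∈ W}`. -/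
def slice (W : Opens (M × ℝ)) (t : ℝ) : Opens M :=
  W.comap ⟨fun x => (x, t), by fun_prop⟩

theorem slice_mono {V W : Opens (M × ℝ)} (h : V ≤ W) (t : ℝ) : slice V t ≤ slice W t :=
  fun _ hx => h hx

/-- The restriction of a smooth function on `W ⊆ M × ℝ` to the slice at `t`. -/
noncomputable def sliceFun {W : Opens (M × ℝ)} (t : ℝ) :
    Smooth (I.prod 𝓘(ℝ, ℝ)) W →ₐ[ℝ] Smooth I (slice W t) where
  toFun g := ⟨fun x => g ⟨(x.1, t), x.2⟩, g.contMDiff.comp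
    ((ContMDiff.subtypeVal_comp_iff W _).mp (contMDiff_subtype_val.prodMk contMDiff_const))⟩
  map_one' := rfl
  map_mul' _ _ := rfl
  map_zero' := rfl
  map_add' _ _ := rfl
  commutes' _ := rfl

variable (𝓜 : NManifold.{u} I M)

/-- Families of functions on the slices of `W ⊆ M × ℝ`. -/
abbrev Family (W : Opens (M × ℝ)) : Type u := ∀ t : ℝ, 𝓜.O (slice W t)

/-- Functions of degree `k` on `𝓜 × ℝ` over `W ⊆ M × ℝ`: families `s t` of functions of degree `k`
on the slices of `W` that depend smoothly on `t`, that is, locally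
`s t = ∑ i, g i (·, t) · a i` with `g i` smooth on an open set of `M × ℝ` and `a i` functions of
degree `k` on an open set of `𝓜`. -/
def smoothFamily (W : Opens (M × ℝ)) (k : ℤ) : Submodule ℝ (𝓜.Family W) where
  carrier := {s | (∀ t, s t ∈ 𝓜.grading (slice W t) k) ∧ ∀ p ∈ W,
    ∃ (V : Opens (M × ℝ)) (hV : V ≤ W) (U : Opens M) (hU : ∀ t, slice V t ≤ U) (m : ℕ)
      (g : Fin m → Smooth (I.prod 𝓘(ℝ, ℝ)) V) (a : Fin m → 𝓜.O U),
      p ∈ V ∧ (∀ i, a i ∈ 𝓜.grading U k) ∧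
      ∀ t, 𝓜.res (slice_mono hV t) (s t) =
        ∑ i, 𝓜.smooth (slice V t) (sliceFun t (g i)) * 𝓜.res (hU t) (a i)}
  zero_mem' := by
    refine ⟨fun t => zero_mem _, fun p hp => ⟨W, le_rfl, ⊤, fun _ => le_top, 0, Fin.elim0,
      Fin.elim0, hp, fun i => i.elim0, fun t => by simp⟩⟩
  add_mem' := by
    rintro s s' ⟨hs, hs'⟩ ⟨ks, ks'⟩
    refine ⟨fun t => add_mem (hs t) (ks t), fun p hp => ?_⟩
    obtain ⟨V, hV, U, hU, m, g, a, hp1, ha, h⟩ := hs' p hp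
    obtain ⟨V', hV', U', hU', m', g', a', hp1', ha', h'⟩ := ks' p hp
    refine ⟨V ⊓ V', inf_le_left.trans hV, U ⊓ U', fun t x hx => ⟨hU t hx.1, hU' t hx.2⟩, m + m',
      Fin.append (fun i => (g i).res inf_le_left) (fun i => (g' i).res inf_le_right),
      Fin.append (fun i => 𝓜.res inf_le_left (a i)) (fun i => 𝓜.res inf_le_right (a' i)),
      ⟨hp1, hp1'⟩, fun i => ?_, fun t => ?_⟩
    · refine Fin.addCases (fun i => ?_) (fun i => ?_) i
      · simpa using 𝓜.res_mem _ (ha i)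
      · simpa using 𝓜.res_mem _ (ha' i)
    · have e := congrArg (𝓜.res (slice_mono (inf_le_left : V ⊓ V' ≤ V) t)) (h t)
      have e' := congrArg (𝓜.res (slice_mono (inf_le_right : V ⊓ V' ≤ V') t)) (h' t)
      simp only [map_sum, map_mul, 𝓜.res_res, 𝓜.res_smooth] at e e'
      simp only [Pi.add_apply, map_add, Fin.sum_univ_add, Fin.append_left, Fin.append_right]
      rw [e, e']
      congr 1 <;> refine Finset.sum_congr rfl fun x _ => ?_ <;> erw [𝓜.res_res] <;> rfl
  smul_mem' := by
    rintro c s ⟨hs, hs'⟩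
    refine ⟨fun t => (𝓜.grading _ k).smul_mem c (hs t), fun p hp => ?_⟩
    obtain ⟨V, hV, U, hU, m, g, a, hp1, ha, h⟩ := hs' p hp
    refine ⟨V, hV, U, hU, m, g, fun i => c • a i, hp1,
      fun i => (𝓜.grading _ k).smul_mem c (ha i), fun t => ?_⟩
    simp only [Pi.smul_apply, map_smul, h t, Finset.smul_sum, mul_smul_comm]

variable {𝓜}

theorem smoothFamily_mul {W : Opens (M × ℝ)} {j k : ℤ} {s s' : 𝓜.Family W}
    (hs : s ∈ 𝓜.smoothFamily W j) (hs' : s' ∈ 𝓜.smoothFamily W k) :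
    s * s' ∈ 𝓜.smoothFamily W (j + k) := by
  refine ⟨fun t => SetLike.mul_mem_graded (hs.1 t) (hs'.1 t), fun p hp => ?_⟩
  obtain ⟨V, hV, U, hU, m, g, a, hp1, ha, h⟩ := hs.2 p hp
  obtain ⟨V', hV', U', hU', m', g', a', hp1', ha', h'⟩ := hs'.2 p hp
  refine ⟨V ⊓ V', inf_le_left.trans hV, U ⊓ U', fun t x hx => ⟨hU t hx.1, hU' t hx.2⟩, m * m',
    fun i => (g (finProdFinEquiv.symm i).1).res inf_le_left *
      (g' (finProdFinEquiv.symm i).2).res inf_le_right,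
    fun i => 𝓜.res inf_le_left (a (finProdFinEquiv.symm i).1) *
      𝓜.res inf_le_right (a' (finProdFinEquiv.symm i).2),
    ⟨hp1, hp1'⟩, fun i => SetLike.mul_mem_graded (𝓜.res_mem _ (ha _)) (𝓜.res_mem _ (ha' _)),
    fun t => ?_⟩
  have e := congrArg (𝓜.res (slice_mono (inf_le_left : V ⊓ V' ≤ V) t)) (h t)
  have e' := congrArg (𝓜.res (slice_mono (inf_le_right : V ⊓ V' ≤ V') t)) (h' t)
  simp only [map_sum, map_mul, 𝓜.res_res, 𝓜.res_smooth] at e e'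
  simp only [Pi.mul_apply, map_mul]
  rw [e, e', Finset.sum_mul_sum, ← Finset.sum_product', ← finProdFinEquiv.sum_comp]
  refine Finset.sum_congr rfl fun i _ => ?_
  simp only [Equiv.symm_apply_apply]
  have hc : ∀ (x : Smooth I (slice (V ⊓ V') t)) (y : 𝓜.O (slice (V ⊓ V') t)) {l : ℤ},
      y ∈ 𝓜.grading _ l → y * 𝓜.smooth _ x = 𝓜.smooth _ x * y := by
    intro x y l hy
    rw [GradedComm.comm hy ((𝓜.mem_grading_zero _ _).2 ⟨x, rfl⟩), mul_zero,
      koszul_even ⟨0, by simp⟩, one_smul]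
  rw [mul_assoc, mul_assoc, ← mul_assoc (𝓜.res _ (a _)), hc _ _ (𝓜.res_mem _ (ha i.1)), mul_assoc]
  erw [𝓜.res_res, 𝓜.res_res]
  rfl

theorem smoothFamily_res {V W : Opens (M × ℝ)} (h : V ≤ W) {k : ℤ} {s : 𝓜.Family W}
    (hs : s ∈ 𝓜.smoothFamily W k) :
    (fun t => 𝓜.res (slice_mono h t) (s t)) ∈ 𝓜.smoothFamily V k := by
  refine ⟨fun t => 𝓜.res_mem _ (hs.1 t), fun p hp => ?_⟩
  obtain ⟨V', hV', U, hU, m, g, a, hp', ha, e⟩ := hs.2 p (h hp)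
  refine ⟨V ⊓ V', inf_le_left, U, fun t x hx => hU t hx.2, m,
    fun i => (g i).res inf_le_right, a, ⟨hp, hp'⟩, ha, fun t => ?_⟩
  have e := congrArg (𝓜.res (slice_mono (inf_le_right : V ⊓ V' ≤ V') t)) (e t)
  simp only [map_sum, map_mul, 𝓜.res_res, 𝓜.res_smooth] at e ⊢
  rw [e]
  rfl

theorem smooth_mem_smoothFamily {W : Opens (M × ℝ)} (g : Smooth (I.prod 𝓘(ℝ, ℝ)) W) :
    (fun t => 𝓜.smooth (slice W t) (sliceFun t g)) ∈ 𝓜.smoothFamily W 0 := by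
  refine ⟨fun t => (𝓜.mem_grading_zero _ _).2 ⟨_, rfl⟩, fun p hp => ⟨W, le_rfl, ⊤,
    fun _ => le_top, 1, fun _ => g, fun _ => 1, hp, fun _ => SetLike.one_mem_graded _,
    fun t => ?_⟩⟩
  simp only [𝓜.res_self, map_one, mul_one, Finset.univ_unique, Finset.sum_const,
    Finset.card_singleton, one_smul]

variable (𝓜) in
/-- Functions on `𝓜 × ℝ` over `W ⊆ M × ℝ`: finite sums of homogeneous ones. -/
def prodO (W : Opens (M × ℝ)) : Subalgebra ℝ (𝓜.Family W) :=
  (⨆ k, 𝓜.smoothFamily W k).toSubalgebra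
    (by
      have h := smooth_mem_smoothFamily (𝓜 := 𝓜) (1 : Smooth (I.prod 𝓘(ℝ, ℝ)) W)
      simp only [map_one] at h
      exact Submodule.mem_iSup_of_mem 0 h)
    (by
      intro x y hx hy
      induction hx using Submodule.iSup_induction' with
      | mem j x hx =>
        induction hy using Submodule.iSup_induction' with
        | mem k y hy => exact Submodule.mem_iSup_of_mem (j + k) (smoothFamily_mul hx hy)
        | zero => rw [mul_zero]; exact zero_mem _
        | add y z _ _ h1 h2 => rw [mul_add]; exact add_mem h1 h2
      | zero => rw [zero_mul]; exact zero_mem _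
      | add x z _ _ h1 h2 => rw [add_mul]; exact add_mem h1 h2)

theorem mem_prodO {W : Opens (M × ℝ)} {k : ℤ} {s : 𝓜.Family W}
    (hs : s ∈ 𝓜.smoothFamily W k) : s ∈ 𝓜.prodO W := Submodule.mem_iSup_of_mem k hs

variable (𝓜) in
/-- The homogeneous functions of degree `k` on `𝓜 × ℝ`. -/
def prodGrading (W : Opens (M × ℝ)) (k : ℤ) : Submodule ℝ (𝓜.prodO W) :=
  (𝓜.smoothFamily W k).comap (𝓜.prodO W).val.toLinearMap

theorem prodGrading_gradedComm (W : Opens (M × ℝ)) : GradedComm (𝓜.prodGrading W) where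
  one_mem := by
    have h := smooth_mem_smoothFamily (𝓜 := 𝓜) (1 : Smooth (I.prod 𝓘(ℝ, ℝ)) W)
    simp only [map_one] at h
    exact h
  mul_mem _ _ _ _ hx hy := smoothFamily_mul hx hy
  comm {i j f g} hf hg := Subtype.ext (funext fun t => GradedComm.comm (hf.1 t) (hg.1 t))
  isInternal := by
    refine DirectSum.isInternal_submodule_of_iSupIndep_of_iSup_eq_top ?_ ?_
    · intro k
      rw [Submodule.disjoint_def]
      intro x hx hx'
      refine Subtype.ext (funext fun t => ?_)
      let ev : 𝓜.prodO W →ₗ[ℝ] 𝓜.O (slice W t) :=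
        LinearMap.proj t ∘ₗ (𝓜.prodO W).val.toLinearMap
      have hi := (GradedComm.isInternal (𝒜 := 𝓜.grading (slice W t))).submodule_iSupIndep k
      rw [Submodule.disjoint_def] at hi
      refine hi _ (hx.1 t) ?_
      have h2 : ev x ∈ Submodule.map ev (⨆ j, ⨆ (_ : j ≠ k), 𝓜.prodGrading W j) :=
        Submodule.mem_map_of_mem hx'
      simp only [Submodule.map_iSup] at h2
      have h3 : (⨆ j, ⨆ (_ : j ≠ k), Submodule.map ev (𝓜.prodGrading W j)) ≤
          ⨆ j, ⨆ (_ : j ≠ k), 𝓜.grading (slice W t) j := by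
        refine iSup₂_mono fun j _ => ?_
        rintro _ ⟨y, hy, rfl⟩
        exact hy.1 t
      exact h3 h2
    · rw [eq_top_iff]
      rintro ⟨x, hx⟩ -
      induction hx using Submodule.iSup_induction' with
      | mem j x hx => exact Submodule.mem_iSup_of_mem j hx
      | zero => exact zero_mem _
      | add x y hx hy h1 h2 => exact add_mem h1 h2

variable (𝓜) in
/-- Restriction of functions on `𝓜 × ℝ`. -/
noncomputable def prodRes {V W : Opens (M × ℝ)} (h : V ≤ W) : 𝓜.prodO W →ₐ[ℝ] 𝓜.prodO V :=
  ((AlgHom.pi fun t => (𝓜.res (slice_mono h t)).comp (Pi.evalAlgHom ℝ _ t)).comp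
    (𝓜.prodO W).val).codRestrict (𝓜.prodO V) (by
      rintro ⟨x, hx⟩
      induction hx using Submodule.iSup_induction' with
      | mem j x hx => exact mem_prodO (smoothFamily_res h hx)
      | zero => rw [show (⟨0, _⟩ : 𝓜.prodO W) = 0 from rfl, map_zero]; exact zero_mem _
      | add x y hx hy h1 h2 =>
        rw [show (⟨x + y, _⟩ : 𝓜.prodO W) = ⟨x, hx⟩ + ⟨y, hy⟩ from rfl, map_add]
        exact add_mem h1 h2)

variable (𝓜) in
/-- Smooth functions on `W ⊆ M × ℝ` as functions on `𝓜 × ℝ`. -/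
noncomputable def prodSmooth (W : Opens (M × ℝ)) :
    Smooth (I.prod 𝓘(ℝ, ℝ)) W →ₐ[ℝ] 𝓜.prodO W :=
  (AlgHom.pi fun t => (𝓜.smooth (slice W t)).comp (sliceFun t)).codRestrict (𝓜.prodO W)
    fun g => mem_prodO (smooth_mem_smoothFamily g)

theorem exists_smooth_of_local {W : Opens (M × ℝ)} (c : ∀ t, Smooth I (slice W t))
    (h : ∀ p ∈ W, ∃ (V : Opens (M × ℝ)) (hV : V ≤ W) (g : Smooth (I.prod 𝓘(ℝ, ℝ)) V),
      p ∈ V ∧ ∀ t, (c t).res (slice_mono hV t) = sliceFun t g) :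
    ∃ G : Smooth (I.prod 𝓘(ℝ, ℝ)) W, ∀ t, sliceFun t G = c t := by
  classical
  let F : M × ℝ → ℝ := fun p => if hp : p ∈ W then c p.2 ⟨p.1, hp⟩ else 0
  have hF : ∀ p : W, F p = c p.1.2 ⟨p.1.1, p.2⟩ := fun p => dif_pos p.2
  refine ⟨⟨fun p => F p, fun p => ?_⟩, fun t => ?_⟩
  · rw [contMDiffAt_subtype_iff]
    obtain ⟨V, hV, g, hpV, hg⟩ := h p.1 p.2
    refine (contMDiffAt_subtype_iff (U := V) (x := ⟨p.1, hpV⟩)).1 ?_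
    have e : (fun x : V => F x) = g := by
      funext x
      rw [hF ⟨x.1, hV x.2⟩]
      exact DFunLike.congr_fun (hg x.1.2) ⟨x.1.1, x.2⟩
    rw [e]
    exact g.contMDiff.contMDiffAt
  · ext x
    exact hF ⟨(x.1, t), x.2⟩

variable (𝓜) in
/-- The pullback of a function `f` on `𝓜` to `W ⊆ U × ℝ`. -/
def pullFamily {U : Opens M} {W : Opens (M × ℝ)} (h : ∀ t, slice W t ≤ U) (f : 𝓜.O U) :
    𝓜.Family W := fun t => 𝓜.res (h t) f

theorem pullFamily_mem {U : Opens M} {W : Opens (M × ℝ)} (h : ∀ t, slice W t ≤ U) {k : ℤ}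
    {f : 𝓜.O U} (hf : f ∈ 𝓜.grading U k) : 𝓜.pullFamily h f ∈ 𝓜.smoothFamily W k := by
  refine ⟨fun t => 𝓜.res_mem _ hf, fun p hp => ⟨W, le_rfl, U, h, 1, fun _ => 1, fun _ => f, hp,
    fun _ => hf, fun t => ?_⟩⟩
  simp only [pullFamily, 𝓜.res_self, map_one, one_mul, Finset.univ_unique, Finset.sum_const,
    Finset.card_singleton, one_smul]

variable (𝓜) in
/-- The pullback of functions on `𝓜` along the projection `U × ℝ ⊇ W → U`. -/
noncomputable def pull {U : Opens M} {W : Opens (M × ℝ)} (h : ∀ t, slice W t ≤ U) :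
    𝓜.O U →ₐ[ℝ] 𝓜.prodO W :=
  (AlgHom.pi fun t => 𝓜.res (h t)).codRestrict (𝓜.prodO W) (by
    intro f
    have hf : f ∈ ⨆ k, 𝓜.grading U k := by
      rw [(GradedComm.isInternal (𝒜 := 𝓜.grading U)).submodule_iSup_eq_top]; trivial
    induction hf using Submodule.iSup_induction' with
    | mem j x hx => exact mem_prodO (pullFamily_mem h hx)
    | zero => rw [map_zero]; exact zero_mem _
    | add x y _ _ h1 h2 => rw [map_add]; exact add_mem h1 h2)

theorem pull_mem {U : Opens M} {W : Opens (M × ℝ)} (h : ∀ t, slice W t ≤ U) {k : ℤ}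
    {f : 𝓜.O U} (hf : f ∈ 𝓜.grading U k) : 𝓜.pull h f ∈ 𝓜.prodGrading W k :=
  pullFamily_mem h hf

theorem monomial_mem {A : Type*} [Ring A] [Algebra ℝ A] (𝒜 : ℤ → Submodule ℝ A) [GradedComm 𝒜]
    {r : ℕ} {deg : Fin r → ℕ} {k : ℤ} {ξ : Fin r → A} (hξ : ∀ j, ξ j ∈ 𝒜 (deg j))
    (e : Exponent deg k) : monomial ξ e.1 ∈ 𝒜 k := by
  have h := SetLike.list_prod_ofFn_mem_graded (A := 𝒜) (fun j => e.1 j • (deg j : ℤ))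
    (fun j => ξ j ^ e.1 j) (fun j => SetLike.pow_mem_graded _ (hξ j))
  rw [List.sum_ofFn] at h
  refine mem_degree h ?_
  refine Eq.trans ?_ e.2.2
  simp

theorem map_monomial {A B : Type*} [Monoid A] [Monoid B] (φ : A →* B) {r : ℕ} (ξ : Fin r → A)
    (e : Fin r → ℕ) : φ (monomial ξ e) = monomial (fun j => φ (ξ j)) e := by
  simp [monomial, map_list_prod, List.map_ofFn, Function.comp_def]

/-- The composite of the projection to `M` with a smooth function. -/
noncomputable def _root_.NGeom.Smooth.pull {U : Opens M} {W : Opens (M × ℝ)} (h : ∀ t, slice W t ≤ U)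
    (g : Smooth I U) : Smooth (I.prod 𝓘(ℝ, ℝ)) W :=
  ⟨fun p => g ⟨p.1.1, h p.1.2 p.2⟩, g.contMDiff.comp
    ((ContMDiff.subtypeVal_comp_iff U _).mp (contMDiff_fst.comp contMDiff_subtype_val))⟩

variable (𝓜) in
/-- Restriction of a function on `𝓜 × ℝ` to the slice at `t`. -/
def ev {W : Opens (M × ℝ)} (t : ℝ) : 𝓜.prodO W →ₐ[ℝ] 𝓜.O (slice W t) :=
  (Pi.evalAlgHom ℝ _ t).comp (𝓜.prodO W).val

/-- The cylinder `U × ℝ`. -/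
def cylinder (U : Opens M) : Opens (M × ℝ) := U.comap ⟨Prod.fst, by fun_prop⟩

theorem slice_cylinder_le (U : Opens M) (t : ℝ) : slice (cylinder U) t ≤ U := fun _ hx => hx

theorem prod_exists_coord (p : M × ℝ) : ∃ U : Opens (M × ℝ), p ∈ U ∧
    ∃ ξ : Fin 𝓜.rank → 𝓜.prodO U, (∀ j, ξ j ∈ 𝓜.prodGrading U (𝓜.deg j)) ∧
    ∀ (V : Opens (M × ℝ)) (hV : V ≤ U) (k : ℤ), ∀ f ∈ 𝓜.prodGrading V k,
      ∃! c : Exponent 𝓜.deg k → Smooth (I.prod 𝓘(ℝ, ℝ)) V,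
        f = ∑ᶠ e, 𝓜.prodSmooth V (c e) * 𝓜.prodRes hV (monomial ξ e.1) := by
  obtain ⟨U, hxU, ξ, hξ, hU⟩ := 𝓜.exists_coord p.1
  refine ⟨cylinder U, hxU, fun j => 𝓜.pull (slice_cylinder_le U) (ξ j),
    fun j => pull_mem _ (hξ j), fun V hV k f hf => ?_⟩
  have hVU : ∀ t, slice V t ≤ U := fun t x hx => hV hx
  have := Exponent.finite 𝓜.deg_pos k
  let _ := Fintype.ofFinite (Exponent 𝓜.deg k)
  replace hU := fun (V : Opens M) (hV : V ≤ U) => hU V hV k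
  simp only [finsum_eq_sum_of_fintype] at hU ⊢
  have hev : ∀ (t : ℝ) (c : Exponent 𝓜.deg k → Smooth (I.prod 𝓘(ℝ, ℝ)) V),
      𝓜.ev t (∑ e, 𝓜.prodSmooth V (c e) *
        𝓜.prodRes hV (monomial (fun j => 𝓜.pull (slice_cylinder_le U) (ξ j)) e.1)) =
      ∑ e, 𝓜.smooth (slice V t) (sliceFun t (c e)) * 𝓜.res (hVU t) (monomial ξ e.1) := by
    intro t c
    rw [map_sum]
    refine Finset.sum_congr rfl fun e _ => ?_
    rw [map_mul]
    congr 1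
    have h1 := map_monomial ((𝓜.ev t).comp (𝓜.prodRes hV)).toMonoidHom
      (fun j => 𝓜.pull (slice_cylinder_le U) (ξ j)) e.1
    have h2 := map_monomial (𝓜.res (hVU t)).toMonoidHom ξ e.1
    refine h1.trans (Eq.trans ?_ h2.symm)
    congr 1
    funext j
    exact 𝓜.res_res _ _ _
  choose c hc hc' using fun t => hU (slice V t) (hVU t) (f.1 t) (hf.1 t)
  have hsm : ∀ e, ∃ G : Smooth (I.prod 𝓘(ℝ, ℝ)) V, ∀ t, sliceFun t G = c t e := by
    intro e
    refine exists_smooth_of_local (fun t => c t e) fun q hq => ?_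
    obtain ⟨V', hV', U', hU', m, g, a, hq', ha, h⟩ := hf.2 q hq
    have hVU' : ∀ t, slice V' t ≤ U ⊓ U' := fun t x hx => ⟨hV (hV' hx), hU' t hx⟩
    choose b hb _ using fun i => hU (U ⊓ U') inf_le_left (𝓜.res inf_le_right (a i))
      (𝓜.res_mem _ (ha i))
    refine ⟨V', hV', ∑ i, g i * (b i e).pull hVU', hq', fun t => ?_⟩
    have key : (fun e => (c t e).res (slice_mono hV' t)) =
        fun e => sliceFun t (∑ i, g i * (b i e).pull hVU') := by
      refine (hU (slice V' t) ((slice_mono hV' t).trans (hVU t))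
        (𝓜.res (slice_mono hV' t) (f.1 t)) (𝓜.res_mem _ (hf.1 t))).unique ?_ ?_
      · change _ = ∑ e, 𝓜.smooth _ ((c t e).res _) * _
        have h1 := congrArg (𝓜.res (slice_mono hV' t)) (hc t)
        simp only [map_sum, map_mul, 𝓜.res_res, 𝓜.res_smooth] at h1
        exact h1
      · change _ = ∑ e, 𝓜.smooth _ (sliceFun t (∑ i, g i * (b i e).pull hVU')) * _
        simp only [map_sum, map_mul, Finset.sum_mul]
        refine (h t).trans ?_
        rw [Finset.sum_comm]
        refine Finset.sum_congr rfl fun i _ => ?_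
        have h2 := congrArg (𝓜.res (hVU' t)) (hb i)
        simp only [map_sum, map_mul, 𝓜.res_res, 𝓜.res_smooth] at h2
        rw [h2, Finset.mul_sum]
        refine Finset.sum_congr rfl fun e _ => ?_
        rw [← mul_assoc]
        rfl
    exact congrFun key e
  choose C hC using hsm
  refine ⟨C, Subtype.ext (funext fun t => ?_), fun C' hC' => ?_⟩
  · refine Eq.trans ?_ (hev t C).symm
    simp only [hC]
    exact hc t
  · funext e
    have h1 : ∀ t, sliceFun t (C' e) = sliceFun t (C e) := by
      intro t
      rw [hC]
      refine congrFun (hc' t (fun e => sliceFun t (C' e)) ?_) e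
      change 𝓜.ev t f = _
      rw [hC', hev]
    ext q
    exact DFunLike.congr_fun (h1 q.1.2) ⟨q.1.1, q.2⟩

variable (𝓜) in
/-- The `ℕ`-graded manifold `𝓜 × ℝ`. -/
noncomputable def prodReal : NManifold.{u} (I.prod 𝓘(ℝ, ℝ)) (M × ℝ) where
  O W := 𝓜.prodO W
  grading W := 𝓜.prodGrading W
  gradedComm W := prodGrading_gradedComm W
  nonneg W k hk := by
    rw [eq_bot_iff]
    intro s hs
    refine (Submodule.mem_bot ℝ).2 (Subtype.ext (funext fun t => ?_))
    have h := hs.1 t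
    rw [𝓜.nonneg _ k hk] at h
    exact (Submodule.mem_bot ℝ).1 h
  res h := 𝓜.prodRes h
  res_mem h _ _ hf := smoothFamily_res h hf
  res_self f := Subtype.ext (funext fun t => 𝓜.res_self _)
  res_res h h' f := Subtype.ext (funext fun t => 𝓜.res_res _ _ _)
  glue {ι} W U hU hcov k f hf hcomp := by
    have hloc := fun t => 𝓜.glue (slice W t) (fun i => slice (U i) t)
      (fun i => slice_mono (hU i) t) (fun x hx => hcov (x, t) hx) k (fun i => (f i).1 t)
      (fun i => (hf i).1 t) (fun i j V hi hj => by
        have h := congrFun (congrArg Subtype.val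
          (hcomp i j (U i ⊓ U j) inf_le_left inf_le_right)) t
        have h' := congrArg (𝓜.res (show V ≤ slice (U i ⊓ U j) t from
          fun x hx => ⟨hi hx, hj hx⟩)) h
        exact (𝓜.res_res _ _ _).symm.trans (h'.trans (𝓜.res_res _ _ _)))
    choose g hg hg' using hloc
    have hgm : g ∈ 𝓜.smoothFamily W k := by
      refine ⟨fun t => (hg t).1, fun p hp => ?_⟩
      obtain ⟨i, hi⟩ := hcov p hp
      obtain ⟨V, hV, U', hU', m, c, a, hpV, ha, h⟩ := (hf i).2 p hi
      refine ⟨V, hV.trans (hU i), U', hU', m, c, a, hpV, ha, fun t => ?_⟩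
      rw [← h t]
      change _ = 𝓜.res _ ((f i).1 t)
      rw [← (hg t).2 i, 𝓜.res_res]
    refine ⟨⟨g, mem_prodO hgm⟩, ⟨hgm, fun i => Subtype.ext (funext fun t => (hg t).2 i)⟩, ?_⟩
    rintro g' ⟨h1, h2⟩
    refine Subtype.ext (funext fun t => hg' t _ ⟨h1.1 t, fun i => ?_⟩)
    exact congrFun (congrArg Subtype.val (h2 i)) t
  smooth W := 𝓜.prodSmooth W
  smooth_injective W g g' h := by
    ext p
    have h1 := 𝓜.smooth_injective _ (congrFun (congrArg Subtype.val h) p.1.2)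
    exact DFunLike.congr_fun h1 ⟨p.1.1, p.2⟩
  mem_grading_zero W f := by
    constructor
    · intro hf
      choose c hc using fun t => (𝓜.mem_grading_zero _ (f.1 t)).1 (hf.1 t)
      obtain ⟨G, hG⟩ := exists_smooth_of_local c (fun p hp => by
        obtain ⟨V, hV, U, hU, m, g, a, hpV, ha, h⟩ := hf.2 p hp
        choose b hb using fun i => (𝓜.mem_grading_zero _ (a i)).1 (ha i)
        refine ⟨V, hV, ∑ i, g i * (b i).pull hU, hpV, fun t => 𝓜.smooth_injective _ ?_⟩
        rw [← 𝓜.res_smooth, hc t]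
        refine (h t).trans ?_
        rw [map_sum, map_sum]
        refine Finset.sum_congr rfl fun i _ => ?_
        rw [map_mul, map_mul, ← hb i, 𝓜.res_smooth]
        rfl)
      refine ⟨G, Subtype.ext (funext fun t => ?_)⟩
      change 𝓜.smooth _ (sliceFun t G) = _
      rw [hG, hc]
    · rintro ⟨g, rfl⟩
      exact smooth_mem_smoothFamily g
  res_smooth h g := Subtype.ext (funext fun t => 𝓜.res_smooth _ _)
  rank := 𝓜.rank
  deg := 𝓜.deg
  deg_pos := 𝓜.deg_pos
  exists_coord p := prod_exists_coord p


variable (𝓜) in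
/-- The pullback `p^*` of global functions along the projection `p : 𝓜 × ℝ → 𝓜`. -/
noncomputable def proj : 𝓜.O ⊤ →ₐ[ℝ] 𝓜.prodReal.O ⊤ :=
  (𝓜.pull (W := ⊤) fun _ => le_top : 𝓜.O ⊤ →ₐ[ℝ] 𝓜.prodO ⊤)

variable (𝓜) in
/-- Restriction of global functions on `𝓜 × ℝ` to `𝓜 × {t}`. -/
noncomputable def evalAt (t : ℝ) : 𝓜.prodReal.O ⊤ →ₐ[ℝ] 𝓜.O ⊤ :=
  (𝓜.res (fun _ _ => trivial : (⊤ : Opens M) ≤ slice ⊤ t)).comp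
    (𝓜.ev t : 𝓜.prodO ⊤ →ₐ[ℝ] 𝓜.O (slice ⊤ t))

theorem proj_mem {k : ℤ} {f : 𝓜.O ⊤} (hf : f ∈ 𝓜.grading ⊤ k) :
    𝓜.proj f ∈ 𝓜.prodReal.grading ⊤ k := pull_mem _ hf

theorem evalAt_mem (t : ℝ) {k : ℤ} {s : 𝓜.prodReal.O ⊤} (hs : s ∈ 𝓜.prodReal.grading ⊤ k) :
    𝓜.evalAt t s ∈ 𝓜.grading ⊤ k :=
  𝓜.res_mem _ ((show _ ∈ 𝓜.smoothFamily ⊤ k from hs).1 t)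

theorem evalAt_proj (t : ℝ) (f : 𝓜.O ⊤) : 𝓜.evalAt t (𝓜.proj f) = f :=
  (𝓜.res_res _ _ _).trans (𝓜.res_self f)

variable (𝓜) in
/-- The function of degree `0` on `𝓜 × ℝ` given by a smooth function of the coordinate `t`. -/
noncomputable def funOfT (g : ℝ → ℝ) (hg : ContDiff ℝ ∞ g) : 𝓜.prodReal.grading ⊤ 0 :=
  ⟨𝓜.prodReal.smooth ⊤ ⟨fun p => g p.1.2,
    hg.contMDiff.comp (contMDiff_snd.comp contMDiff_subtype_val)⟩,
    (𝓜.prodReal.mem_grading_zero _ _).2 ⟨_, rfl⟩⟩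

variable (𝓜) in
/-- The coordinate function `t` on `𝓜 × ℝ`. -/
noncomputable def coordT : 𝓜.prodReal.grading ⊤ 0 := 𝓜.funOfT (fun t => t) contDiff_id

variable (𝓜) in
/-- The function `e^t` on `𝓜 × ℝ`. -/
noncomputable def expT : 𝓜.prodReal.grading ⊤ 0 := 𝓜.funOfT Real.exp Real.contDiff_exp

/-- The projection to `𝓜` of a vector field on `𝓜 × ℝ` along the slice `𝓜 × {t}`:
`f ↦ X (p^* f)` restricted to `𝓜 × {t}`. -/
noncomputable def projVF {k : ℤ} (X : VF (𝓜.prodReal.grading ⊤) k) (t : ℝ) :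
    VF (𝓜.grading ⊤) k :=
  ⟨(𝓜.evalAt t).toLinearMap ∘ₗ X.1 ∘ₗ 𝓜.proj.toLinearMap, by
    constructor
    · intro j f hf
      exact evalAt_mem t (memVF X (proj_mem hf) rfl)
    · intro j f hf g
      simp only [LinearMap.comp_apply, AlgHom.toLinearMap_apply, map_mul,
        leibnizVF X (proj_mem hf), map_add, map_smul, evalAt_proj]⟩

/-- `β` is the pullback `p^* α` of the `1`-form `α` along the projection `p : 𝓜 × ℝ → 𝓜`:
over `𝓜 × {t}`, the function `ι_X β` is `ι_Y α` for the projection `Y` of `X` along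
`𝓜 × {t}`. -/
def IsPullback {n : ℤ} (α : OneForm (𝓜.grading ⊤) n) (β : OneForm (𝓜.prodReal.grading ⊤) n) :
    Prop :=
  ∀ (k : ℤ) (X : VF (𝓜.prodReal.grading ⊤) k) (t : ℝ),
    𝓜.evalAt t (app β X) = app α (projVF X t)

/-- `Y` is the lift to `𝓜 × ℝ` of the vector field `X` on `𝓜`: it is related to `X` by the
projection and kills `t`. -/
def IsLift {k : ℤ} (X : VF (𝓜.grading ⊤) k) (Y : VF (𝓜.prodReal.grading ⊤) k) : Prop :=
  (∀ f, Y.1 (𝓜.proj f) = 𝓜.proj (X.1 f)) ∧ Y.1 𝓜.coordT = 0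

variable (𝓜) in
/-- `T` is the coordinate vector field `∂_t` on `𝓜 × ℝ`. -/
def IsPartialT (T : VF (𝓜.prodReal.grading ⊤) 0) : Prop :=
  (∀ f, T.1 (𝓜.proj f) = 0) ∧ T.1 𝓜.coordT = 1

variable (𝓜) in
/-- The pullback of a homogeneous function along the projection `𝓜 × ℝ → 𝓜`. -/
noncomputable def projHom {k : ℤ} (f : 𝓜.grading ⊤ k) : 𝓜.prodReal.grading ⊤ k :=
  ⟨𝓜.proj f, proj_mem f.2⟩

/-- A contact `1`-form of degree `n`: it vanishes at no point of the body, that is, near every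
point it is nonzero on some vector field of degree `-n`, and `dα` is nondegenerate on its
kernel. -/
structure IsContactForm {n : ℤ} (α : OneForm (𝓜.grading ⊤) n) : Prop where
  nowhere_vanishing : ∀ x : M, ∃ (X : VF (𝓜.grading ⊤) (-n)) (g : Smooth I (⊤ : Opens M)),
    𝓜.smooth ⊤ g = app α X ∧ g ⟨x, trivial⟩ ≠ 0
  nondegenerate : IsNondegenerateOnKer α

end Product
end NManifold
end Manifolds
end NGeom

open NGeom

/-! Everything reduces to one linear problem on `𝓜`. Nondegeneracy of `dα` on the kernel `D` of `α`,
together with a field `R` with `ι_R α = 1`, makes the system `ι_X α = a`, `h α + ι_X dα = γ`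
uniquely solvable for a vector field `X` and a function `h` (`contact_solve_unique`,
`exists_contact_solve`). The kernel component of `X` is found from the values on `D`; what remains
vanishes on `D`, so it is a multiple of `α`.

The field `R` exists globally (`IsContactForm.exists_reeb`). Locally, a field on which `α` is
invertible is rescaled and then corrected inside `D` so that `ι_R dα` vanishes on `D`. This
normalization makes the local choices unique, so they glue.

Since `Q` is contact, `L_Q α` vanishes on `D`, hence `L_Q α = -φ α` with `φ` read off at `R`.
Equivalently `α([Q, Y]) = Q(α(Y)) + φ α(Y)`. Applying this twice to `R`, with `[Q, [Q, R]] = 0` and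
`φ² = 0`, gives `Qφ = 0`.

On `𝓜 × ℝ` a vector field `X` amounts to the family of its projections `X_t` along the slices
together with the function `h = X(t)` (`prod_VF_ext`, `exists_prod_VF`). Up to signs and the factor
`e^t`, the contraction of `d(e^t α)` with `X` is `h α + ι_{X_t} dα` on lifts and `ι_{X_t} α` on
`∂_t`. So nondegeneracy is the contact system solved slice by slice. Smoothness in `t` holds because
the solution is linear over functions: in a local frame it is a combination of finitely many
solutions independent of `t`, with coefficients smooth in `t`. Closedness is `d² = 0`, which comes
from the Jacobi identity.

Cartan's formula turns `L_Q α = -φ α` into `dH = ι_X σ` for `σ = d(e^t α)` and `X = Q + φ ∂_t`; then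
`L_X σ = 0` since `dσ = 0` and `ddH = 0`. Finally `[X, X] = 2X²` is a derivation, and it kills
pullbacks because `Q² = 0` and kills `t` because `Qφ = 0`.

Vector fields and forms here are algebraic objects over global functions. The supporting work is
therefore to show that they are local (bump functions), that a vector field is determined by its
values on coordinates (Hadamard's lemma), and that these values can be prescribed freely (the
universal property of graded coordinates). -/

namespace NGeom

/-! ### Graded derivations, forms and the identity `d² = 0` -/

section GradedAlgebra

variable {A : Type*} [Ring A] [Algebra ℝ A] {𝒜 : ℤ → Submodule ℝ A}

theorem koszul_eq_ite (k : ℤ) : koszul k = if Even k then 1 else -1 := by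
  split_ifs with h
  · exact koszul_even h
  · exact koszul_odd (Int.not_even_iff_odd.1 h)

theorem koszul_mul_self (k : ℤ) : koszul k * koszul k = 1 := by
  rw [← koszul_add]; exact koszul_even ⟨_, rfl⟩

theorem koszul_zero : koszul 0 = 1 := koszul_even ⟨0, by simp⟩

theorem koszul_ne_zero (k : ℤ) : koszul k ≠ 0 := fun h => by simpa [h] using koszul_mul_self k

variable [GradedComm 𝒜]

variable (𝒜) in
theorem graded_induction {P : A → Prop} (hom : ∀ j, ∀ f ∈ 𝒜 j, P f)
    (add : ∀ f g, P f → P g → P (f + g)) (f : A) : P f := by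
  have hf : f ∈ ⨆ k, 𝒜 k := by
    rw [(GradedComm.isInternal (𝒜 := 𝒜)).submodule_iSup_eq_top]; trivial
  induction hf using Submodule.iSup_induction' with
  | mem j x hx => exact hom j x hx
  | zero => exact hom 0 0 (zero_mem _)
  | add x y _ _ h1 h2 => exact add x y h1 h2

theorem exists_linearMap_of_graded {C : Type*} [AddCommGroup C] [Module ℝ C]
    (F : ∀ j, 𝒜 j →ₗ[ℝ] C) : ∃ X : A →ₗ[ℝ] C, ∀ j (f : 𝒜 j), X f = F j f := by
  let e := LinearEquiv.ofBijective (DirectSum.coeLinearMap 𝒜) (GradedComm.isInternal (𝒜 := 𝒜))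
  refine ⟨DirectSum.toModule ℝ ℤ C F ∘ₗ e.symm.toLinearMap, fun j f => ?_⟩
  have h : e (DirectSum.lof ℝ ℤ (fun i => 𝒜 i) j f) = f := DirectSum.coeLinearMap_lof 𝒜 j f
  rw [LinearMap.comp_apply, ← h]
  simp

theorem mul_comm_of_degree_zero {f : A} (hf : f ∈ 𝒜 0) (g : A) : f * g = g * f := by
  induction g using graded_induction 𝒜 with
  | hom j g hg => rw [GradedComm.comm hf hg, zero_mul, koszul_zero, one_smul]
  | add g h h1 h2 => rw [mul_add, add_mul, h1, h2]

theorem VF.ext_of_graded {k : ℤ} {X Y : VF 𝒜 k} (h : ∀ j, ∀ f ∈ 𝒜 j, X.1 f = Y.1 f) : X = Y := by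
  refine Subtype.ext (LinearMap.ext fun f => ?_)
  induction f using graded_induction 𝒜 with
  | hom j f hf => exact h j f hf
  | add f g h1 h2 => rw [map_add, map_add, h1, h2]

/-- The gluing axiom only produces homogeneous sections, so derivations are built one degree at a
time. The Leibniz rule for inhomogeneous `g` follows by additivity. -/
theorem exists_VF_of_graded {k : ℤ} (F : ∀ j, 𝒜 j →ₗ[ℝ] A) (h1 : ∀ j f, F j f ∈ 𝒜 (j + k))
    (h2 : ∀ i j (f : 𝒜 i) (g : 𝒜 j) (h : (f * g : A) ∈ 𝒜 (i + j)),
      F (i + j) ⟨f * g, h⟩ = F i f * g + koszul (k * i) • ((f : A) * F j g)) :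
    ∃ X : VF 𝒜 k, ∀ j (f : 𝒜 j), X.1 f = F j f := by
  obtain ⟨X, hX⟩ := exists_linearMap_of_graded F
  refine ⟨⟨X, fun j f hf => ?_, fun i f hf g => ?_⟩, hX⟩
  · exact hX j ⟨f, hf⟩ ▸ h1 j ⟨f, hf⟩
  · induction g using graded_induction 𝒜 with
    | hom j g hg =>
      have := h2 i j ⟨f, hf⟩ ⟨g, hg⟩ (SetLike.mul_mem_graded hf hg)
      rwa [← hX, ← hX, ← hX] at this
    | add g g' h h' =>
      rw [mul_add, map_add, h, h', map_add, mul_add, mul_add, smul_add]; abel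

theorem VF_map_one {k : ℤ} (X : VF 𝒜 k) : X.1 1 = 0 := by
  have h := leibnizVF X (SetLike.one_mem_graded 𝒜) 1
  simpa [koszul_zero] using h

theorem leibnizVF_zero {k : ℤ} (X : VF 𝒜 k) {f : A} (hf : f ∈ 𝒜 0) (g : A) :
    X.1 (f * g) = X.1 f * g + f * X.1 g := by
  rw [leibnizVF X hf, mul_zero, koszul_zero, one_smul]

@[ext] theorem OneForm.ext' {n : ℤ} {α β : OneForm 𝒜 n}
    (h : ∀ k (X : VF 𝒜 k), (app α X : A) = app β X) : α = β :=
  Subtype.ext (funext fun k => LinearMap.ext fun X => Subtype.ext (h k X))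

theorem app_sub {n k : ℤ} (α : OneForm 𝒜 n) (X Y : VF 𝒜 k) :
    (app α (X - Y) : A) = app α X - app α Y := by
  rw [show X - Y = X + (-1 : ℝ) • Y by module, app_add, app_smul]; module

theorem app_zero {n k : ℤ} (α : OneForm 𝒜 n) : (app α (0 : VF 𝒜 k) : A) = 0 := by simp [app]

theorem app_sum {n k : ℤ} (α : OneForm 𝒜 n) {ι : Type*} (s : Finset ι) (X : ι → VF 𝒜 k) :
    (app α (∑ i ∈ s, X i) : A) = ∑ i ∈ s, (app α (X i) : A) := by simp [app]

theorem app_neg_form {n k : ℤ} (α : OneForm 𝒜 n) (X : VF 𝒜 k) :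
    (app (-α) X : A) = -app α X := by
  change (((-1 : ℝ) • (app α X : A))) = _
  rw [neg_one_smul]

theorem app_add_form {n k : ℤ} (α β : OneForm 𝒜 n) (X : VF 𝒜 k) :
    (app (α + β) X : A) = app α X + app β X := rfl

theorem app_lmulForm {j n m k : ℤ} (f : 𝒜 j) (α : OneForm 𝒜 n) (h : j + n = m) (X : VF 𝒜 k) :
    (app (lmulForm f α h) X : A) = koszul ((k - 1) * j) • ((f : A) * app α X) := rfl

theorem app_dFun {j k : ℤ} (f : 𝒜 j) (X : VF 𝒜 k) : (app (dFun f) X : A) = X.1 f := rfl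

theorem app_dOne {n k l : ℤ} (α : OneForm 𝒜 n) (X : VF 𝒜 k) (Y : VF 𝒜 l) :
    (app ((dOne α).contract X) Y : A) = dOneVal α X Y := rfl

theorem app_lieOne {n k l : ℤ} (X : VF 𝒜 k) (α : OneForm 𝒜 n) (Y : VF 𝒜 l) :
    (app (lieOne X α) Y : A) =
      koszul (k * (l - 1)) • (X.1 (app α Y) - app α (bracket X Y)) := by
  change dOneVal α X Y + koszul k • Y.1 (app α X) = _
  simp [dOneVal]

theorem lmulVF_apply {j k m : ℤ} (f : 𝒜 j) (X : VF 𝒜 k) (h : j + k = m) (g : A) :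
    (lmulVF f X h).1 g = f * X.1 g := rfl

theorem bracket_apply {k l : ℤ} (X : VF 𝒜 k) (Y : VF 𝒜 l) (g : A) :
    (bracket X Y).1 g = X.1 (Y.1 g) - koszul (k * l) • Y.1 (X.1 g) := rfl

/-- A `2`-form is assumed linear only in its second slot; the symmetry relation, used twice,
transfers linearity to the first. -/
theorem app_contract_lmul {n j k m l : ℤ} (σ : TwoForm 𝒜 n) (f : 𝒜 j) (X : VF 𝒜 k)
    (h : j + k = m) (Y : VF 𝒜 l) : (app (σ.contract (lmulVF f X h)) Y : A) =
      koszul ((l - 1) * j) • ((f : A) * app (σ.contract X) Y) := by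
  subst h
  rw [σ.symm Y, app_lmul, σ.symm X Y, mul_smul_comm, smul_smul, ← koszul_add]
  congr 1
  exact koszul_congr (c := (l - 1) * (k - 1)) (by ring)

theorem app_contract_add {n k l : ℤ} (σ : TwoForm 𝒜 n) (X X' : VF 𝒜 k) (Y : VF 𝒜 l) :
    (app (σ.contract (X + X')) Y : A) = app (σ.contract X) Y + app (σ.contract X') Y := by
  rw [σ.symm Y, app_add, σ.symm X Y, σ.symm X' Y, smul_add, smul_smul, smul_smul, ← koszul_add,
    koszul_even ⟨(l - 1) * (k - 1), by ring⟩, one_smul, one_smul]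

theorem app_contract_sum {n k l : ℤ} (σ : TwoForm 𝒜 n) {ι : Type*} (s : Finset ι)
    (X : ι → VF 𝒜 k) (Y : VF 𝒜 l) :
    (app (σ.contract (∑ i ∈ s, X i)) Y : A) = ∑ i ∈ s, (app (σ.contract (X i)) Y : A) := by
  simp only [σ.symm Y, app_sum, Finset.smul_sum]

theorem app_contract_smul {n k l : ℤ} (σ : TwoForm 𝒜 n) (c : ℝ) (X : VF 𝒜 k) (Y : VF 𝒜 l) :
    (app (σ.contract (c • X)) Y : A) = c • (app (σ.contract X) Y : A) := by
  rw [σ.symm Y, app_smul, σ.symm X Y, smul_smul, smul_smul, mul_right_comm,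
    ← koszul_add, koszul_even ⟨(l - 1) * (k - 1), by ring⟩, one_mul]

theorem app_contract_sub {n k l : ℤ} (σ : TwoForm 𝒜 n) (X X' : VF 𝒜 k) (Y : VF 𝒜 l) :
    (app (σ.contract (X - X')) Y : A) = app (σ.contract X) Y - app (σ.contract X') Y := by
  rw [show X - X' = X + (-1 : ℝ) • X' by module, app_contract_add, app_contract_smul]; module

theorem app_dOne_dFun {j k l : ℤ} (f : 𝒜 j) (X : VF 𝒜 k) (Y : VF 𝒜 l) :
    (app ((dOne (dFun f)).contract X) Y : A) = 0 := by
  rw [app_dOne, dOneVal]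
  simp only [app_dFun, bracket_apply, sub_sub_cancel, smul_smul, ← koszul_add]
  rw [koszul_congr (a := k * (l - 1) + k * l) (b := k) (c := k * l - k) (by ring), sub_self]

/-- Expanded by the Cartan relations, `ddθ` is a sum of iterated derivatives of `θ`, which cancel
formally, and of double brackets, which cancel by the graded Jacobi identity. The signs depend only
on the parities of the three degrees. -/
theorem dTwoVal_dOne {n k l m : ℤ} (θ : OneForm 𝒜 n) (X : VF 𝒜 k) (Y : VF 𝒜 l) (Z : VF 𝒜 m) :
    dTwoVal (dOne θ) X Y Z = 0 := by
  have hj : (app θ (bracket X (bracket Y Z)) : A) = app θ (bracket (bracket X Y) Z) +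
      koszul (k * l) • (app θ (bracket Y (bracket X Z)) : A) := by
    -- The Jacobi identity, with `[Y, [X, Z]]` recast from degree `l + (k + m)` to `k + l + m` so
    -- that the sum is defined.
    have h1 : (app θ (bracket X (bracket Y Z)) : A) = app θ (bracket (bracket X Y) Z +
        koszul (k * l) • (⟨(bracket Y (bracket X Z)).1, by
          rw [show k + l + m = l + (k + m) by ring]; exact (bracket Y (bracket X Z)).2⟩ : VF 𝒜 (k + l + m))) := by
      refine app_congr θ (by ring) ?_
      ext g
      simp only [Submodule.coe_add, SetLike.val_smul, LinearMap.add_apply, LinearMap.smul_apply,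
        bracket_apply, map_sub, map_smul, smul_sub, smul_smul, ← koszul_add]
      by_cases hk : Even k <;> by_cases hl : Even l <;> by_cases hm : Even m <;>
      simp only [koszul_eq_ite, Int.even_add, Int.even_mul, hk, hl, hm, or_true, or_false,
        iff_true, iff_false, not_true, if_true, if_false] <;> module
    rw [h1, app_add, app_smul]
    congr 2
    exact app_congr θ (by ring) rfl
  have hs : (app θ (bracket (bracket X Y) Z) : A) =
      app θ (bracket X (bracket Y Z)) - koszul (k * l) • (app θ (bracket Y (bracket X Z)) : A) := by
    rw [hj]; abel
  simp only [dTwoVal, lieTwoVal, app_lieOne, app_dOne, dOneVal, hs, bracket_apply, map_sub, map_smul,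
    smul_sub, smul_smul, ← koszul_add]
  by_cases hk : Even k <;> by_cases hl : Even l <;> by_cases hm : Even m <;>
  simp only [koszul_eq_ite, Int.even_add, Int.even_sub, Int.even_mul, hk, hl, hm, or_true, or_false,
    iff_true, iff_false, not_true, if_true, if_false, Int.not_even_one] <;> module

/-! ### Contact forms -/

section Contact

variable {n : ℤ} {α : OneForm 𝒜 n} {R : VF 𝒜 (-n)}

theorem sub_lmul_mem_ker (hR : (app α R : A) = 1) {l : ℤ} (Y : VF 𝒜 l) :
    Y - lmulVF (app α Y) R (by ring) ∈ ker α l := by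
  refine Subtype.ext ((app_sub α _ _).trans ?_)
  rw [app_lmul, hR, mul_one, sub_self]; rfl

/-- `Y - α(Y) R` lies in the kernel of `α`, so a form vanishing on that kernel only sees the
`R`-component of `Y`. -/
theorem app_of_forall_ker (hR : (app α R : A) = 1) {m : ℤ} {δ : OneForm 𝒜 m}
    (hδ : ∀ l, ∀ Y ∈ ker α l, (app δ Y : A) = 0) {l : ℤ} (Y : VF 𝒜 l) :
    (app δ Y : A) = app α Y * app δ R := by
  have h := hδ l _ (sub_lmul_mem_ker hR Y)
  rw [app_sub, app_lmul, sub_eq_zero] at h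
  exact h

/-- On the kernel of `α` the term with `h` disappears, so nondegeneracy gives `X = 0`; evaluating
what is left at `R` gives `h = 0`. -/
theorem contact_solve_unique (hα : IsNondegenerateOnKer α) (hR : (app α R : A) = 1) {k : ℤ}
    {X : VF 𝒜 k} {h : 𝒜 k} (hX : (app α X : A) = 0)
    (hc : ∀ l (Y : VF 𝒜 l), koszul ((l - 1) * k) • ((h : A) * app α Y) +
      app ((dOne α).contract X) Y = 0) : X = 0 ∧ h = 0 := by
  have hXk : X ∈ ker α k := Subtype.ext hX
  have h1 : X = 0 := by
    have := (hα k).1 (a₁ := ⟨X, hXk⟩) (a₂ := 0) (Subtype.ext (funext fun l => LinearMap.ext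
      fun Y => Subtype.ext ?_))
    · exact congrArg Subtype.val this
    · change (app ((dOne α).contract X) Y.1 : A) = app ((dOne α).contract (0 : VF 𝒜 k)) Y.1
      have hY : (app α Y.1 : A) = 0 := congrArg Subtype.val Y.2
      have h2 := hc l Y.1
      rw [hY, mul_zero, smul_zero, zero_add] at h2
      rw [h2, ← zero_smul ℝ (0 : VF 𝒜 k), app_contract_smul, zero_smul]
  refine ⟨h1, Subtype.ext ?_⟩
  have h2 := hc _ R
  rw [h1, hR, mul_one, ← zero_smul ℝ (0 : VF 𝒜 k), app_contract_smul, zero_smul, add_zero] at h2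
  exact (smul_eq_zero.1 h2).resolve_left (koszul_ne_zero _)

/-- Take `X = Z + aR`: the term `aR` realizes `ι_X α = a`, and `Z` in the kernel is chosen so that
the second equation holds on the kernel. The defect `δ` is then a multiple of `α`. -/
theorem exists_contact_solve (hα : IsNondegenerateOnKer α) (hR : (app α R : A) = 1) {k : ℤ}
    (a : 𝒜 (k + n)) (γ : OneForm 𝒜 (k + n)) : ∃ (X : VF 𝒜 k) (h : 𝒜 k), (app α X : A) = a ∧
      ∀ l (Y : VF 𝒜 l), koszul ((l - 1) * k) • ((h : A) * app α Y) +
        app ((dOne α).contract X) Y = app γ Y := by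
  let aR : VF 𝒜 k := lmulVF a R (by ring)
  obtain ⟨Z, hZ⟩ := (hα k).2 (restrictKer α (γ + -(dOne α).contract aR))
  have hZα : (app α Z.1 : A) = 0 := congrArg Subtype.val Z.2
  let δ : OneForm 𝒜 (k + n) := γ + -(dOne α).contract (Z.1 + aR)
  have hδ : ∀ l, ∀ Y ∈ ker α l, (app δ Y : A) = 0 := by
    intro l Y hY
    have h1 : (app ((dOne α).contract Z.1) Y : A) = app (γ + -(dOne α).contract aR) Y :=
      congrArg (fun β : KerDual α (k + n) => ((β.1 l ⟨Y, hY⟩ : 𝒜 _) : A)) hZ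
    rw [app_add_form, app_neg_form] at h1 ⊢
    rw [app_contract_add, h1]; abel
  have hdeg : (app δ R : A) ∈ 𝒜 k := mem_degree (app δ R).2 (by ring)
  -- The sign in `h` compares moving `δ(R)` past `α(Y)`, with exponent `(l + n) k`, to the sign `(l
  -- - 1) k` in the equation.
  refine ⟨Z.1 + aR, ⟨koszul ((n + 1) * k) • (app δ R : A), (𝒜 k).smul_mem _ hdeg⟩, ?_,
    fun l Y => ?_⟩
  · rw [app_add, hZα, zero_add, app_lmul, hR, mul_one]
  · have h1 := app_of_forall_ker hR hδ Y
    rw [GradedComm.comm (app α Y).2 hdeg] at h1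
    rw [smul_mul_assoc, smul_smul, ← koszul_add,
      koszul_congr (b := (l + n) * k) (c := 0) (by ring), ← h1, app_add_form, app_neg_form]
    abel

theorem app_bracket_of_lieOne {Q : VF 𝒜 1} {φ : 𝒜 1} (hφ : lieOne Q α = -lmulForm φ α rfl)
    {l : ℤ} (Y : VF 𝒜 l) : (app α (bracket Q Y) : A) = Q.1 (app α Y) + φ * app α Y := by
  have h : (app (lieOne Q α) Y : A) = app (-lmulForm φ α rfl) Y := by rw [hφ]
  rw [app_lieOne, app_neg_form, app_lmulForm, one_mul, mul_one, ← smul_neg] at h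
  have h2 := smul_right_injective A (koszul_ne_zero (l - 1)) h
  rw [sub_eq_iff_eq_add] at h2
  rw [h2]; abel

/-- For `Y` in the kernel of `α` both `α(Y)` and `α([Q, Y])` vanish, so `L_Q α` is a multiple of
`α`; contraction with `R` determines the factor. -/
theorem exists_unique_lieOne (hR : (app α R : A) = 1) {Q : VF 𝒜 1} (hQ : IsContactVF α Q) :
    ∃ φ : 𝒜 1, ∀ ψ : 𝒜 1, lieOne Q α = -lmulForm ψ α rfl ↔ ψ = φ := by
  have hδ : ∀ l, ∀ Y ∈ ker α l, (app (lieOne Q α) Y : A) = 0 := by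
    intro l Y hY
    have h1 : (app α Y : A) = 0 := congrArg Subtype.val hY
    have h2 : (app α (bracket Q Y) : A) = 0 := congrArg Subtype.val (hQ l Y hY)
    rw [app_lieOne, h1, h2, map_zero, sub_zero, smul_zero]
  have hdeg : (app (lieOne Q α) R : A) ∈ 𝒜 1 := mem_degree (app _ R).2 (by ring)
  refine ⟨⟨koszul n • (app (lieOne Q α) R : A), (𝒜 1).smul_mem _ hdeg⟩, fun ψ => ⟨fun h => ?_, ?_⟩⟩
  · refine Subtype.ext ?_
    change (ψ : A) = koszul n • (app (lieOne Q α) R : A)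
    rw [h, app_neg_form, app_lmulForm, hR, mul_one, ← smul_neg, smul_smul, ← koszul_add,
      koszul_congr_neg (b := 0) (c := -1) (by ring), koszul_zero]
    simp
  · rintro rfl
    ext l Y
    rw [app_of_forall_ker hR hδ Y, GradedComm.comm (app α Y).2 hdeg, app_neg_form, app_lmulForm,
      smul_mul_assoc, smul_smul, ← koszul_add, ← neg_smul,
      koszul_congr_neg (a := (l + n) * 1) (b := (l - 1) * 1 + n) (c := 0) (by ring)]

/-- The identity `α([Q, Y]) = Q(α(Y)) + φ α(Y)` gives `α([Q, R]) = φ`, and applied once more `0 =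
α([Q, [Q, R]]) = Qφ + φ²`. -/
theorem map_eq_zero_of_lieOne (hR : (app α R : A) = 1) {Q : VF 𝒜 1} (hQ : IsHomological Q)
    {φ : 𝒜 1} (hφ : lieOne Q α = -lmulForm φ α rfl) : Q.1 φ = 0 := by
  have h1 : (app α (bracket Q (bracket Q R)) : A) = 0 := by
    have : bracket Q (bracket Q R) = 0 := by
      refine Subtype.ext (LinearMap.ext fun g => ?_)
      simp only [bracket_apply, map_sub, map_smul, hQ (R.1 g), hQ g, map_zero, smul_zero,
        sub_zero, zero_sub]
      rw [koszul_congr_neg (a := 1 * (1 + -n)) (b := 1 * -n) (c := 0) (by ring), neg_smul]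
      simp
    rw [this, app_zero]
  -- A function of odd degree anticommutes with itself.
  have h2 : (φ : A) * φ = 0 := by
    have := GradedComm.comm φ.2 φ.2
    rw [one_mul, koszul_odd odd_one, neg_one_smul] at this
    have h3 : (2 : ℝ) • ((φ : A) * φ) = 0 := by rw [two_smul]; nth_rw 1 [this]; abel
    exact (smul_eq_zero.1 h3).resolve_left two_ne_zero
  rw [app_bracket_of_lieOne hφ, app_bracket_of_lieOne hφ, hR, VF_map_one Q, zero_add, mul_one, h2,
    add_zero] at h1
  exact h1

end Contact

end GradedAlgebra

end NGeom

namespace NGeom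

/-! ### Parametric integrals and Hadamard's lemma -/

section Analysis

variable {E : Type*} [NormedAddCommGroup E] [NormedSpace ℝ E] [FiniteDimensional ℝ E]

open Set Filter Topology MeasureTheory in
-- Differentiation under the integral sign; the dominating constant bounds the derivative on the
-- compact set given by the closed unit ball around `x₀` times `[0, 1]`.
theorem hasFDerivAt_parametric_integral {f : E × ℝ → ℝ} (hf : ContDiff ℝ 1 f) (x₀ : E) :
    HasFDerivAt (fun x => ∫ s in (0 : ℝ)..1, f (x, s))
      (∫ s in (0 : ℝ)..1, (fderiv ℝ f (x₀, s)).comp (ContinuousLinearMap.inl ℝ E ℝ)) x₀ := by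
  have hc : Continuous fun p : E × ℝ =>
      (fderiv ℝ f p).comp (ContinuousLinearMap.inl ℝ E ℝ) :=
    (hf.continuous_fderiv one_ne_zero).clm_comp continuous_const
  obtain ⟨C, hC⟩ := ((isCompact_closedBall x₀ 1).prod (isCompact_Icc (a := (0 : ℝ)) (b := 1)))
    |>.exists_bound_of_continuousOn hc.continuousOn
  refine intervalIntegral.hasFDerivAt_integral_of_dominated_of_fderiv_le
    (F := fun x s => f (x, s))
    (F' := fun x s => (fderiv ℝ f (x, s)).comp (ContinuousLinearMap.inl ℝ E ℝ))
    (bound := fun _ => C) (Metric.closedBall_mem_nhds x₀ one_pos) ?_ ?_ ?_ ?_ ?_ ?_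
  · exact Eventually.of_forall fun x =>
      (hf.continuous.comp (by fun_prop : Continuous fun s : ℝ => (x, s))).aestronglyMeasurable
  · exact (hf.continuous.comp
      (by fun_prop : Continuous fun s : ℝ => (x₀, s))).intervalIntegrable _ _
  · exact (hc.comp (by fun_prop : Continuous fun s : ℝ => (x₀, s))).aestronglyMeasurable
  · refine Eventually.of_forall fun t ht x hx => hC (x, t) ⟨hx, ?_⟩
    rw [uIoc_of_le zero_le_one] at ht
    exact ⟨ht.1.le, ht.2⟩
  · exact intervalIntegrable_const
  · refine Eventually.of_forall fun t _ x _ => ?_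
    exact ((hf.differentiable one_ne_zero (x, t)).hasFDerivAt).comp x (hasFDerivAt_prodMk_left x t)

/-- Each directional derivative is again a parametric integral of a smooth integrand, so induction
on the order works once `f` is allowed to vary. -/
theorem contDiff_parametric_integral {f : E × ℝ → ℝ} (hf : ContDiff ℝ ∞ f) :
    ContDiff ℝ ∞ fun x => ∫ s in (0 : ℝ)..1, f (x, s) := by
  rw [contDiff_infty]
  intro n
  induction n generalizing f with
  | zero =>
    exact contDiff_zero.2 (continuous_iff_continuousAt.2 fun x =>
      (hasFDerivAt_parametric_integral (hf.of_le (by simp)) x).continuousAt)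
  | succ n ih =>
    have h1 : ContDiff ℝ 1 f := hf.of_le (by simp)
    have hd := hasFDerivAt_parametric_integral h1
    rw [show ((n + 1 : ℕ) : WithTop ℕ∞) = n + 1 by norm_cast, contDiff_succ_iff_fderiv_apply]
    refine ⟨fun x => (hd x).differentiableAt, fun h => absurd h (by simp), fun v => ?_⟩
    have e : (fun x => fderiv ℝ (fun x => ∫ s in (0 : ℝ)..1, f (x, s)) x v) =
        fun x => ∫ s in (0 : ℝ)..1, fderiv ℝ f (x, s) (v, 0) := by
      funext x
      rw [(hd x).fderiv, ContinuousLinearMap.intervalIntegral_apply]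
      · rfl
      · have : Continuous fun s : ℝ =>
            (fderiv ℝ f (x, s)).comp (ContinuousLinearMap.inl ℝ E ℝ) :=
          ((h1.continuous_fderiv one_ne_zero).comp
            (by fun_prop : Continuous fun s : ℝ => (x, s))).clm_comp continuous_const
        exact this.intervalIntegrable _ _
    rw [e]
    exact ih (f := fun p => fderiv ℝ f p (v, 0))
      ((hf.fderiv_right (m := ∞) (by simp)).clm_apply contDiff_const)

/-- Hadamard's lemma. -/
theorem exists_hadamard {κ : Type*} [Fintype κ] (b : Module.Basis κ ℝ E) {f : E → ℝ}
    (hf : ContDiff ℝ ∞ f) (x₀ : E) :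
    ∃ g : κ → E → ℝ, (∀ a, ContDiff ℝ ∞ (g a)) ∧
      (∀ x, f x = f x₀ + ∑ a, (b.coord a x - b.coord a x₀) * g a x) ∧
      ∀ a, g a x₀ = fderiv ℝ f x₀ (b a) := by
  have hs : ContDiff ℝ ∞ fun p : E × ℝ => x₀ + p.2 • (p.1 - x₀) := by fun_prop
  -- The coefficients come from integrating the derivative of `s ↦ f (x₀ + s (x - x₀))` over `[0,
  -- 1]`.
  refine ⟨fun a x => ∫ s in (0 : ℝ)..1, fderiv ℝ f (x₀ + s • (x - x₀)) (b a), fun a => ?_,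
    fun x => ?_, fun a => by simp⟩
  · exact contDiff_parametric_integral
      (f := fun p : E × ℝ => fderiv ℝ f (x₀ + p.2 • (p.1 - x₀)) (b a))
      (((hf.fderiv_right (m := ∞) (by simp)).comp hs).clm_apply contDiff_const)
  · have hcont : Continuous fun s : ℝ => fderiv ℝ f (x₀ + s • (x - x₀)) :=
      (hf.continuous_fderiv (by simp)).comp (by fun_prop)
    have h1 : ∫ s in (0 : ℝ)..1, fderiv ℝ f (x₀ + s • (x - x₀)) (x - x₀) = f x - f x₀ := by
      have := intervalIntegral.integral_eq_sub_of_hasDerivAt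
        (f := fun s : ℝ => f (x₀ + s • (x - x₀)))
        (f' := fun s => fderiv ℝ f (x₀ + s • (x - x₀)) (x - x₀)) (a := 0) (b := 1)
        (fun s _ => ?_) (Continuous.intervalIntegrable (by fun_prop) _ _)
      · simpa using this
      · have h2 : HasDerivAt (fun s : ℝ => x₀ + s • (x - x₀)) (x - x₀) s := by
          simpa using ((hasDerivAt_id s).smul_const (x - x₀)).const_add x₀
        exact ((hf.differentiable (by simp) _).hasFDerivAt).comp_hasDerivAt s h2
    have h3 : ∀ s : ℝ, fderiv ℝ f (x₀ + s • (x - x₀)) (x - x₀) =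
        ∑ a, (b.coord a x - b.coord a x₀) * fderiv ℝ f (x₀ + s • (x - x₀)) (b a) := by
      intro s
      refine (congrArg (fderiv ℝ f (x₀ + s • (x - x₀))) (b.sum_repr (x - x₀)).symm).trans ?_
      simp only [map_sum, map_smul, smul_eq_mul, map_sub, Finsupp.coe_sub, Pi.sub_apply,
        Module.Basis.coord_apply]
    simp only [h3] at h1
    rw [intervalIntegral.integral_finsetSum fun a _ =>
      Continuous.intervalIntegrable (by fun_prop) _ _] at h1
    simp only [intervalIntegral.integral_const_mul] at h1
    rw [h1]; ring

end Analysis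

/-! ### Chart derivatives and cutoffs of smooth functions -/

section SmoothFunctions

universe v

variable {E : Type*} [NormedAddCommGroup E] [NormedSpace ℝ E] {H : Type*} [TopologicalSpace H]
  {I : ModelWithCorners ℝ E H} {M : Type v} [TopologicalSpace M] [ChartedSpace H M]

/-- Extension of a smooth function on `U` to `M` by zero. -/
noncomputable def Smooth.extend {U : Opens M} (c : Smooth I U) : M → ℝ :=
  open Classical in fun y => if h : y ∈ U then c ⟨y, h⟩ else 0

theorem Smooth.extend_of_mem {U : Opens M} (c : Smooth I U) {y : M} (h : y ∈ U) :
    c.extend y = c ⟨y, h⟩ := dif_pos h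

theorem Smooth.extend_contMDiffAt {U : Opens M} (c : Smooth I U) {y : M} (h : y ∈ U) :
    ContMDiffAt I 𝓘(ℝ, ℝ) ∞ c.extend y := by
  refine (contMDiffAt_subtype_iff (U := U) (x := ⟨y, h⟩)).1 ?_
  have e : (fun x : U => c.extend x) = c := funext fun x => c.extend_of_mem x.2
  rw [e]
  exact c.contMDiff.contMDiffAt

/-- A smooth function on `U` from a function on `M` that is smooth at the points of `U`. -/
def Smooth.mk' {U : Opens M} (f : M → ℝ) (h : ∀ y ∈ U, ContMDiffAt I 𝓘(ℝ, ℝ) ∞ f y) :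
    Smooth I U :=
  ⟨fun y => f y, fun y => contMDiffAt_subtype_iff.2 (h y y.2)⟩

@[simp] theorem Smooth.mk'_apply {U : Opens M} (f : M → ℝ)
    (h : ∀ y ∈ U, ContMDiffAt I 𝓘(ℝ, ℝ) ∞ f y) (y : U) : Smooth.mk' f h y = f y := rfl

theorem eventually_extChartAt_symm {x y : M} {P : M → Prop} (hy : y ∈ (chartAt H x).source)
    (h : ∀ᶠ z in nhds y, P z) :
    ∀ᶠ z in nhds (extChartAt I x y), P ((extChartAt I x).symm z) := by
  have hy' : y ∈ (extChartAt I x).source := by rwa [extChartAt_source]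
  have := continuousAt_extChartAt_symm' (I := I) hy'
  refine this.eventually ?_
  rwa [(extChartAt I x).left_inv hy']

variable [IsManifold I ∞ M]

/-- A linear coordinate of the chart at `x`. -/
noncomputable def chartCoord (x : M) {U : Opens M} (hU : ∀ y ∈ U, y ∈ (chartAt H x).source)
    (l : E →L[ℝ] ℝ) : Smooth I U :=
  Smooth.mk' (fun y => l (extChartAt I x y)) fun y hy =>
    l.contDiff.contMDiff.contMDiffAt.comp y (contMDiffAt_extChartAt' (hU y hy))

variable [I.Boundaryless]

theorem contDiffAt_comp_extChartAt_symm {x y : M} {f : M → ℝ} (hy : y ∈ (chartAt H x).source)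
    (hf : ContMDiffAt I 𝓘(ℝ, ℝ) ∞ f y) :
    ContDiffAt ℝ ∞ (f ∘ (extChartAt I x).symm) (extChartAt I x y) := by
  have hy' : y ∈ (extChartAt I x).source := by rwa [extChartAt_source]
  rw [← contMDiffAt_iff_contDiffAt]
  refine ContMDiffAt.comp (I' := I) _ ?_ ?_
  · rwa [(extChartAt I x).left_inv hy']
  · exact (contMDiffOn_extChartAt_symm x).contMDiffAt
      (extChartAt_target_mem_nhds' ((extChartAt I x).map_source hy'))

/-- The derivative of a smooth function in the direction `w` of the chart at `x`. -/
noncomputable def chartDeriv (x : M) {U : Opens M} (hU : ∀ y ∈ U, y ∈ (chartAt H x).source)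
    (w : E) (c : Smooth I U) : Smooth I U :=
  Smooth.mk' (fun y => fderiv ℝ (c.extend ∘ (extChartAt I x).symm) (extChartAt I x y) w)
    fun y hy => by
      have h1 := contDiffAt_comp_extChartAt_symm (hU y hy) (c.extend_contMDiffAt hy)
      have h2 : ContDiffAt ℝ ∞ (fun z => fderiv ℝ (c.extend ∘ (extChartAt I x).symm) z w)
          (extChartAt I x y) :=
        (h1.fderiv_right (m := ∞) (by simp)).clm_apply contDiffAt_const
      exact h2.contMDiffAt.comp y (contMDiffAt_extChartAt' (hU y hy))

variable {x : M} {U : Opens M} (hU : ∀ y ∈ U, y ∈ (chartAt H x).source)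

/-- The derivative at `y` only sees the germ, so the extension by zero may be replaced by any
convenient function that agrees with it near `y`. -/
theorem chartDeriv_eq_fderiv (w : E) (c : Smooth I U) {f : M → ℝ} {y : M} (hy : y ∈ U)
    (h : ∀ᶠ z in nhds y, f z = c.extend z) :
    chartDeriv x hU w c ⟨y, hy⟩ =
      fderiv ℝ (f ∘ (extChartAt I x).symm) (extChartAt I x y) w := by
  have := eventually_extChartAt_symm (I := I) (hU y hy) h
  exact congrArg (fun L : E →L[ℝ] ℝ => L w) (Filter.EventuallyEq.fderiv_eq this).symm

theorem chartDeriv_add (w : E) (c c' : Smooth I U) :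
    chartDeriv x hU w (c + c') = chartDeriv x hU w c + chartDeriv x hU w c' := by
  ext ⟨y, hy⟩
  have h := contDiffAt_comp_extChartAt_symm (hU y hy) (c.extend_contMDiffAt hy)
  have h' := contDiffAt_comp_extChartAt_symm (hU y hy) (c'.extend_contMDiffAt hy)
  rw [chartDeriv_eq_fderiv hU w (c + c') (f := c.extend + c'.extend) hy]
  · rw [ContMDiffMap.coe_add, Pi.add_apply]
    change fderiv ℝ ((c.extend ∘ (extChartAt I x).symm) + (c'.extend ∘ (extChartAt I x).symm))
      _ w = _
    rw [fderiv_add (h.differentiableAt (by simp)) (h'.differentiableAt (by simp))]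
    rfl
  · filter_upwards [U.isOpen.mem_nhds hy] with z hz
    simp [Smooth.extend_of_mem _ hz]

theorem chartDeriv_smul (w : E) (r : ℝ) (c : Smooth I U) :
    chartDeriv x hU w (r • c) = r • chartDeriv x hU w c := by
  ext ⟨y, hy⟩
  have h := contDiffAt_comp_extChartAt_symm (hU y hy) (c.extend_contMDiffAt hy)
  rw [chartDeriv_eq_fderiv hU w (r • c) (f := r • c.extend) hy]
  · change fderiv ℝ (r • (c.extend ∘ (extChartAt I x).symm)) _ w = _
    rw [fderiv_const_smul (h.differentiableAt (by simp))]
    rfl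
  · filter_upwards [U.isOpen.mem_nhds hy] with z hz
    simp [Smooth.extend_of_mem _ hz]

theorem chartDeriv_mul (w : E) (c c' : Smooth I U) :
    chartDeriv x hU w (c * c') = c * chartDeriv x hU w c' + chartDeriv x hU w c * c' := by
  ext ⟨y, hy⟩
  have h := contDiffAt_comp_extChartAt_symm (hU y hy) (c.extend_contMDiffAt hy)
  have h' := contDiffAt_comp_extChartAt_symm (hU y hy) (c'.extend_contMDiffAt hy)
  have hy' : y ∈ (extChartAt I x).source := by rw [extChartAt_source]; exact hU y hy
  rw [chartDeriv_eq_fderiv hU w (c * c') (f := c.extend * c'.extend) hy]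
  · change fderiv ℝ ((c.extend ∘ (extChartAt I x).symm) * (c'.extend ∘ (extChartAt I x).symm))
      _ w = c ⟨y, hy⟩ * chartDeriv x hU w c' ⟨y, hy⟩ + chartDeriv x hU w c ⟨y, hy⟩ * c' ⟨y, hy⟩
    rw [fderiv_mul (h.differentiableAt (by simp)) (h'.differentiableAt (by simp))]
    simp only [Function.comp_apply, (extChartAt I x).left_inv hy', Smooth.extend_of_mem _ hy]
    change _ * _ + c' ⟨y, hy⟩ * _ = _
    rw [mul_comm (c' ⟨y, hy⟩)]
    rfl
  · filter_upwards [U.isOpen.mem_nhds hy] with z hz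
    simp [Smooth.extend_of_mem _ hz]

theorem chartDeriv_of_eq (w : E) (c : Smooth I U) (l : E →L[ℝ] ℝ) {y : M} (hy : y ∈ U) (r : ℝ)
    (h : ∀ᶠ z in nhds y, c.extend z = l (extChartAt I x z) + r) :
    chartDeriv x hU w c ⟨y, hy⟩ = l w := by
  have hy' : y ∈ (extChartAt I x).source := by rw [extChartAt_source]; exact hU y hy
  have h1 : (c.extend ∘ (extChartAt I x).symm) =ᶠ[nhds (extChartAt I x y)] fun z => l z + r := by
    filter_upwards [eventually_extChartAt_symm (I := I) (hU y hy) h,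
      extChartAt_target_mem_nhds' ((extChartAt I x).map_source hy')] with z hz hz'
    rw [Function.comp_apply, hz, (extChartAt I x).right_inv hz']
  change fderiv ℝ _ _ w = _
  rw [h1.fderiv_eq, fderiv_add_const, l.fderiv]

variable [FiniteDimensional ℝ E] [T2Space M]

/-- The form used for all localizations: `V` and `K`, the complement of the support of the bump,
cover `M`, so an identity multiplied by `ρ` has to be checked only on `V`, and it gives back the
original identity on `V'`. -/
theorem exists_bump (x : M) (V : Opens M) (hx : x ∈ V) :
    ∃ (ρ : Smooth I (⊤ : Opens M)) (V' K : Opens M), x ∈ V' ∧ V' ≤ V ∧ (∀ y, y ∈ V ∨ y ∈ K) ∧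
      (∀ y ∈ V', ρ ⟨y, trivial⟩ = 1) ∧ ∀ y ∈ K, ρ ⟨y, trivial⟩ = 0 := by
  obtain ⟨f, hf, -⟩ := (SmoothBumpFunction.nhds_basis_support (I := I)
    (V.isOpen.mem_nhds hx)).mem_iff.1 (V.isOpen.mem_nhds hx)
  obtain ⟨W, hW, hWo, hxW⟩ := eventually_nhds_iff.1 f.eventuallyEq_one
  refine ⟨Smooth.mk' f fun y _ => f.contMDiffAt, ⟨W, hWo⟩ ⊓ V, ⟨(tsupport f)ᶜ,
    (isClosed_tsupport f).isOpen_compl⟩, ⟨hxW, hx⟩, inf_le_right, fun y => ?_,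
    fun y hy => hW y hy.1, fun y hy => image_eq_zero_of_notMem_tsupport (f := f) hy⟩
  by_cases hy : y ∈ tsupport f
  · exact Or.inl (hf hy)
  · exact Or.inr hy

/-- Two cutoffs are needed: `ψ` on the model space makes `c` read in the chart globally smooth, so
that Hadamard's lemma applies, and `χ` on `M` makes the resulting coefficients global functions.
Both equal `1` near the base point. -/
theorem exists_chart_hadamard {κ : Type*} [Fintype κ] (b : Module.Basis κ ℝ E) (x : M)
    (c : Smooth I (⊤ : Opens M)) (x₀ : M) (hx₀ : x₀ ∈ (chartAt H x).source) :
    ∃ (W : Opens M) (g : κ → Smooth I (⊤ : Opens M)), x₀ ∈ W ∧ ∀ y ∈ W,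
      c ⟨y, trivial⟩ = c ⟨x₀, trivial⟩ + ∑ a, (b.coord a (extChartAt I x y) -
        b.coord a (extChartAt I x x₀)) * g a ⟨y, trivial⟩ := by
  have hx₀' : x₀ ∈ (extChartAt I x).source := by rwa [extChartAt_source]
  obtain ⟨ψ, V, K, hV, -, hK, hψ1, hψ0⟩ := exists_bump (I := 𝓘(ℝ, E)) (extChartAt I x x₀)
    ⟨(extChartAt I x).target, isOpen_extChartAt_target x⟩ ((extChartAt I x).map_source hx₀')
  obtain ⟨χ, V', K', hV', hVs, hK', hχ1, hχ0⟩ := exists_bump (I := I) x₀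
    ⟨(chartAt H x).source, (chartAt H x).open_source⟩ hx₀
  have hf : ContDiff ℝ ∞ fun z => ψ.extend z * c.extend ((extChartAt I x).symm z) := by
    rw [contDiff_iff_contDiffAt]
    intro z
    rcases hK z with hz | hz
    · refine (ψ.extend_contMDiffAt (y := z) trivial).contDiffAt.mul ?_
      have h := contDiffAt_comp_extChartAt_symm (I := I) (x := x)
        (y := (extChartAt I x).symm z) (f := c.extend) ?_ (c.extend_contMDiffAt trivial)
      · rwa [(extChartAt I x).right_inv hz] at h
      · have := (extChartAt I x).map_target hz
        rwa [extChartAt_source] at this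
    · refine (contDiffAt_const (c := (0 : ℝ))).congr_of_eventuallyEq ?_
      filter_upwards [K.isOpen.mem_nhds hz] with w hw
      rw [ψ.extend_of_mem trivial, hψ0 w hw, zero_mul]
  obtain ⟨g, hg, hg1, -⟩ := exists_hadamard b hf (extChartAt I x x₀)
  let W : Opens M := ⟨(extChartAt I x).source ∩ extChartAt I x ⁻¹' V,
    isOpen_extChartAt_preimage' x V.isOpen⟩
  have hval : ∀ y ∈ W, ψ.extend (extChartAt I x y) *
      c.extend ((extChartAt I x).symm (extChartAt I x y)) = c ⟨y, trivial⟩ := by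
    intro y hy
    rw [ψ.extend_of_mem trivial, hψ1 _ hy.2, one_mul, (extChartAt I x).left_inv hy.1,
      c.extend_of_mem trivial]
  refine ⟨W ⊓ V', fun a => Smooth.mk' (fun y => χ.extend y * g a (extChartAt I x y))
    fun y _ => ?_, ⟨⟨hx₀', hV⟩, hV'⟩, fun y hy => ?_⟩
  · rcases hK' y with hy | hy
    · exact ContMDiffAt.mul (χ.extend_contMDiffAt trivial)
        ((hg a).contMDiff.contMDiffAt.comp y (contMDiffAt_extChartAt' hy))
    · refine (contMDiffAt_const (c := (0 : ℝ))).congr_of_eventuallyEq ?_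
      filter_upwards [K'.isOpen.mem_nhds hy] with w hw
      rw [χ.extend_of_mem trivial, hχ0 w hw, zero_mul]
  · have h := hg1 (extChartAt I x y)
    rw [hval y hy.1, hval x₀ ⟨hx₀', hV⟩] at h
    rw [h]
    congr 1
    refine Finset.sum_congr rfl fun a _ => ?_
    rw [Smooth.mk'_apply, χ.extend_of_mem trivial, hχ1 y hy.2, one_mul]

end SmoothFunctions

end NGeom

namespace NGeom

namespace NManifold

/-! ### Locality of functions, vector fields and forms -/

section Local

universe u v

variable {E : Type*} [NormedAddCommGroup E] [NormedSpace ℝ E] {H : Type*} [TopologicalSpace H]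
  {I : ModelWithCorners ℝ E H} {M : Type v} [TopologicalSpace M] [ChartedSpace H M]
  {𝓜 : NManifold.{u} I M}

theorem _root_.NGeom.Smooth.sum_apply {U : Opens M} {ι : Type*} (s : Finset ι)
    (g : ι → Smooth I U) (y : U) : (∑ i ∈ s, g i) y = ∑ i ∈ s, g i y := by
  classical
  induction s using Finset.induction_on with
  | empty => rfl
  | insert a s ha ih => rw [Finset.sum_insert ha, Finset.sum_insert ha, ← ih]; rfl

theorem eq_of_cover {ι : Type v} {W : Opens M} (V : ι → Opens M) (hV : ∀ i, V i ≤ W)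
    (hc : ∀ x ∈ W, ∃ i, x ∈ V i) {k : ℤ} {f g : 𝓜.O W} (hf : f ∈ 𝓜.grading W k)
    (hg : g ∈ 𝓜.grading W k) (h : ∀ i, 𝓜.res (hV i) f = 𝓜.res (hV i) g) : f = g :=
  (𝓜.glue W V hV hc k (fun i => 𝓜.res (hV i) g) (fun i => 𝓜.res_mem _ hg)
    (fun i j V' hi hj => by rw [𝓜.res_res, 𝓜.res_res])).unique ⟨hf, h⟩ ⟨hg, fun _ => rfl⟩

/-- Both functions must have the same degree because the sheaf axiom is available in each degree
separately. -/
theorem eq_of_local {W : Opens M} {k : ℤ} {f g : 𝓜.O W} (hf : f ∈ 𝓜.grading W k)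
    (hg : g ∈ 𝓜.grading W k)
    (h : ∀ x ∈ W, ∃ (V : Opens M) (hV : V ≤ W), x ∈ V ∧ 𝓜.res hV f = 𝓜.res hV g) : f = g := by
  choose V hV hx h' using fun x : W => h x x.2
  exact eq_of_cover V hV (fun x hx' => ⟨⟨x, hx'⟩, hx _⟩) hf hg h'

theorem eq_zero_of_local {W : Opens M} {k : ℤ} {f : 𝓜.O W} (hf : f ∈ 𝓜.grading W k)
    (h : ∀ x ∈ W, ∃ (V : Opens M) (hV : V ≤ W), x ∈ V ∧ 𝓜.res hV f = 0) : f = 0 :=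
  eq_of_local hf (zero_mem _) fun x hx => by simpa only [map_zero] using h x hx

theorem smooth_mem (U : Opens M) (g : Smooth I U) : 𝓜.smooth U g ∈ 𝓜.grading U 0 :=
  (𝓜.mem_grading_zero _ _).2 ⟨g, rfl⟩

theorem smooth_mul_comm {U : Opens M} (g : Smooth I U) (f : 𝓜.O U) :
    𝓜.smooth U g * f = f * 𝓜.smooth U g :=
  mul_comm_of_degree_zero (smooth_mem U g) f

theorem smooth_mul_mem {U : Opens M} (g : Smooth I U) {k : ℤ} {f : 𝓜.O U}
    (hf : f ∈ 𝓜.grading U k) : 𝓜.smooth U g * f ∈ 𝓜.grading U k :=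
  mem_degree (SetLike.mul_mem_graded (smooth_mem U g) hf) (zero_add k)

theorem res_smooth_eq_one {U V : Opens M} (h : U ≤ V) {ρ : Smooth I V}
    (hρ : ∀ y (hy : y ∈ U), ρ ⟨y, h hy⟩ = 1) : 𝓜.res h (𝓜.smooth V ρ) = 1 := by
  rw [𝓜.res_smooth, ← map_one (𝓜.smooth U)]
  congr 1
  ext y
  exact hρ y y.2

theorem res_smooth_eq_zero {U V : Opens M} (h : U ≤ V) {ρ : Smooth I V}
    (hρ : ∀ y (hy : y ∈ U), ρ ⟨y, h hy⟩ = 0) : 𝓜.res h (𝓜.smooth V ρ) = 0 := by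
  rw [𝓜.res_smooth, ← map_zero (𝓜.smooth U)]
  congr 1
  ext y
  exact hρ y y.2

/-- Extension of `ρ a` by zero for a section `a` over `U` and a smooth function `ρ` that vanishes
on an open set `K` with `U ∪ K = M`. -/
theorem exists_extension_mul {U K : Opens M} (hc : ∀ y, y ∈ U ∨ y ∈ K)
    {ρ : Smooth I (⊤ : Opens M)} (hρ : ∀ y ∈ K, ρ ⟨y, trivial⟩ = 0) {k : ℤ} {a : 𝓜.O U}
    (ha : a ∈ 𝓜.grading U k) : ∃ F ∈ 𝓜.grading ⊤ k,
      𝓜.res le_top F = 𝓜.res le_top (𝓜.smooth ⊤ ρ) * a ∧ 𝓜.res (le_top : K ≤ ⊤) F = 0 := by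
  -- The cover by `U` and `K` is indexed by a lifted `Bool` to match the universe of the gluing
  -- axiom.
  let V : ULift.{v} Bool → Opens M := fun i => bif i.down then U else K
  let f : ∀ i, 𝓜.O (V i) := fun i => match i with
    | ⟨true⟩ => 𝓜.res le_top (𝓜.smooth ⊤ ρ) * a
    | ⟨false⟩ => 0
  have hz : ∀ (V' : Opens M) (hU : V' ≤ U) (_ : V' ≤ K),
      𝓜.res hU (𝓜.res le_top (𝓜.smooth ⊤ ρ) * a) = 0 := by
    intro V' hU hK
    rw [map_mul, 𝓜.res_res, res_smooth_eq_zero _ (fun y hy => hρ y (hK hy)), zero_mul]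
  obtain ⟨F, ⟨hF, hF'⟩, -⟩ := 𝓜.glue ⊤ V (fun _ => le_top) (fun y _ => by
      rcases hc y with h | h
      · exact ⟨⟨true⟩, h⟩
      · exact ⟨⟨false⟩, h⟩) k f (by
      rintro ⟨_ | _⟩
      · exact zero_mem _
      · exact mem_degree (SetLike.mul_mem_graded (𝓜.res_mem _ (smooth_mem _ ρ)) ha) (zero_add k))
    (by
      rintro ⟨_ | _⟩ ⟨_ | _⟩ V' h1 h2
      · rfl
      · exact (map_zero _).trans (hz V' h2 h1).symm
      · exact (hz V' h1 h2).trans (map_zero _).symm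
      · rfl)
  exact ⟨F, hF, hF' ⟨true⟩, hF' ⟨false⟩⟩

/-- A family of linear maps from global functions to functions on the members of an open cover
that are compatible graded derivations comes from a vector field. -/
theorem exists_VF_of_local {ι : Type v} (V : ι → Opens M) (hc : ∀ x, ∃ i, x ∈ V i) {k : ℤ}
    (L : ∀ i, 𝓜.O ⊤ →ₗ[ℝ] 𝓜.O (V i))
    (hL : ∀ i j, ∀ f ∈ 𝓜.grading ⊤ j, L i f ∈ 𝓜.grading (V i) (j + k))
    (hLm : ∀ i j l, ∀ f ∈ 𝓜.grading ⊤ j, ∀ g ∈ 𝓜.grading ⊤ l, L i (f * g) =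
      L i f * 𝓜.res le_top g + koszul (k * j) • (𝓜.res le_top f * L i g))
    (hLc : ∀ i i' j, ∀ f ∈ 𝓜.grading ⊤ j, ∀ (W : Opens M) (h : W ≤ V i) (h' : W ≤ V i'),
      𝓜.res h (L i f) = 𝓜.res h' (L i' f)) :
    ∃ X : VF (𝓜.grading ⊤) k, ∀ i j, ∀ f ∈ 𝓜.grading ⊤ j, 𝓜.res le_top (X.1 f) = L i f := by
  choose G hG _ using fun j (f : 𝓜.grading ⊤ j) => 𝓜.glue ⊤ V (fun _ => le_top) (fun x _ => hc x)
    (j + k) (fun i => L i f) (fun i => hL i j f f.2) (fun i i' W h h' => hLc i i' j f f.2 W h h')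
  obtain ⟨X, hX⟩ := exists_VF_of_graded (𝒜 := 𝓜.grading ⊤) (k := k) (fun j =>
    { toFun := G j
      map_add' := fun f g => eq_of_cover V (fun _ => le_top) (fun x _ => hc x) (hG j _).1
        (add_mem (hG j f).1 (hG j g).1) fun i => by
          rw [map_add, (hG j _).2, (hG j _).2, (hG j _).2, Submodule.coe_add, map_add]
      map_smul' := fun c f => eq_of_cover V (fun _ => le_top) (fun x _ => hc x) (hG j _).1
        (Submodule.smul_mem _ _ (hG j f).1) fun i => by
          rw [map_smul, (hG j _).2, (hG j _).2, SetLike.val_smul, map_smul]; rfl })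
    (fun j f => (hG j f).1) (fun i j f g h => by
      refine eq_of_cover V (fun _ => le_top) (fun x _ => hc x) (hG _ _).1 (add_mem
        (mem_degree (SetLike.mul_mem_graded (hG i f).1 g.2) (by ring)) (Submodule.smul_mem _ _
        (mem_degree (SetLike.mul_mem_graded f.2 (hG j g).1) (by ring)))) fun l => ?_
      change 𝓜.res _ (G _ _) = 𝓜.res _ (G i f * (g : 𝓜.O ⊤) + koszul (k * i) • ((f : 𝓜.O ⊤) * G j g))
      refine ((hG _ _).2 l).trans ((hLm l i j f f.2 g g.2).trans ?_)
      rw [map_add, map_smul, map_mul, map_mul, (hG i f).2, (hG j g).2])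
  exact ⟨X, fun i j f hf => by rw [hX j ⟨f, hf⟩]; exact (hG j ⟨f, hf⟩).2 i⟩

variable (𝓜) in
/-- Graded coordinates over `U`. -/
def IsCoord (U : Opens M) (ξ : Fin 𝓜.rank → 𝓜.O U) : Prop :=
  (∀ j, ξ j ∈ 𝓜.grading U (𝓜.deg j)) ∧
  ∀ (V : Opens M) (hV : V ≤ U) (k : ℤ), ∀ f ∈ 𝓜.grading V k,
    ∃! c : Exponent 𝓜.deg k → Smooth I V,
      f = ∑ᶠ e, 𝓜.smooth V (c e) * 𝓜.res hV (monomial ξ e.1)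

noncomputable instance (k : ℤ) : Fintype (Exponent 𝓜.deg k) :=
  have := Exponent.finite 𝓜.deg_pos k
  Fintype.ofFinite _

theorem IsCoord.existsUnique {U : Opens M} {ξ : Fin 𝓜.rank → 𝓜.O U} (h : 𝓜.IsCoord U ξ)
    {V : Opens M} (hV : V ≤ U) {k : ℤ} {f : 𝓜.O V} (hf : f ∈ 𝓜.grading V k) :
    ∃! c : Exponent 𝓜.deg k → Smooth I V,
      f = ∑ e, 𝓜.smooth V (c e) * monomial (fun j => 𝓜.res hV (ξ j)) e.1 := by
  have h1 := h.2 V hV k f hf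
  simp only [finsum_eq_sum_of_fintype] at h1
  convert h1 using 6 with c e
  exact (map_monomial (𝓜.res hV).toMonoidHom ξ _).symm

theorem IsCoord.res {U : Opens M} {ξ : Fin 𝓜.rank → 𝓜.O U} (h : 𝓜.IsCoord U ξ)
    {V : Opens M} (hV : V ≤ U) : 𝓜.IsCoord V fun j => 𝓜.res hV (ξ j) := by
  refine ⟨fun j => 𝓜.res_mem _ (h.1 j), fun W hW k f hf => ?_⟩
  convert h.2 W (hW.trans hV) k f hf using 6 with c e
  rw [← 𝓜.res_res hW hV]
  exact congrArg (𝓜.res hW) (map_monomial (𝓜.res hV).toMonoidHom ξ _).symm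

/-- By uniqueness of coefficients, those of `f` near `x` are combinations of the `g i`, so they
vanish at `x`. This converts Hadamard expansions around varying base points into vanishing of a
section. -/
theorem IsCoord.eq_zero_of_vanishing {U : Opens M} {ξ : Fin 𝓜.rank → 𝓜.O U} (h : 𝓜.IsCoord U ξ)
    {V : Opens M} (hV : V ≤ U) {k : ℤ} {f : 𝓜.O V} (hf : f ∈ 𝓜.grading V k)
    {ι : Type*} [Fintype ι]
    (hv : ∀ x (_ : x ∈ V), ∃ (W : Opens M) (hW : W ≤ V) (hx : x ∈ W)
      (g : ι → Smooth I W) (a : ι → 𝓜.O W), (∀ i, a i ∈ 𝓜.grading W k) ∧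
      (∀ i, g i ⟨x, hx⟩ = 0) ∧ 𝓜.res hW f = ∑ i, 𝓜.smooth W (g i) * a i) : f = 0 := by
  obtain ⟨c, hc, -⟩ := h.existsUnique hV hf
  have hc0 : ∀ e, c e = 0 := by
    intro e
    ext ⟨x, hx⟩
    obtain ⟨W, hW, hxW, g, a, ha, hg, hfa⟩ := hv x hx
    choose b hb _ using fun i => h.existsUnique (hW.trans hV) (ha i)
    have key := (h.existsUnique (hW.trans hV) (𝓜.res_mem hW hf)).unique
      (y₁ := fun e => (c e).res hW) (y₂ := fun e => ∑ i, g i * b i e) (by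
        rw [hc, map_sum]
        refine Finset.sum_congr rfl fun e _ => ?_
        rw [map_mul, 𝓜.res_smooth]
        congr 1
        refine (map_monomial (𝓜.res hW).toMonoidHom _ _).trans ?_
        congr 1
        funext j
        exact 𝓜.res_res _ _ _) (by
        simp only [hfa, map_sum, map_mul, Finset.sum_mul]
        rw [Finset.sum_comm]
        refine Finset.sum_congr rfl fun i _ => ?_
        conv_lhs => rw [hb i]
        rw [Finset.mul_sum]
        refine Finset.sum_congr rfl fun e _ => ?_
        rw [mul_assoc])
    have := DFunLike.congr_fun (congrFun key e) ⟨x, hxW⟩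
    refine Eq.trans this ?_
    rw [Smooth.sum_apply]
    exact Finset.sum_eq_zero fun i _ => by simp [hg i]
  rw [hc]
  exact Finset.sum_eq_zero fun e _ => by rw [hc0, map_zero, zero_mul]

variable [FiniteDimensional ℝ E] [T2Space M] [IsManifold I ∞ M] [I.Boundaryless]

/-- Multiplying by a bump extends sections to all of `M` while keeping them unchanged near `x`. The
same `V` serves for all sections and degrees. -/
theorem exists_extension {x : M} {U : Opens M} (hx : x ∈ U) : ∃ (V : Opens M) (hV : V ≤ U),
    x ∈ V ∧ ∀ k, ∀ a ∈ 𝓜.grading U k, ∃ F ∈ 𝓜.grading ⊤ k, 𝓜.res le_top F = 𝓜.res hV a := by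
  obtain ⟨ρ, V, K, hxV, hV, hc, h1, h0⟩ := exists_bump (I := I) x U hx
  refine ⟨V, hV, hxV, fun k a ha => ?_⟩
  obtain ⟨F, hF, hF', -⟩ := exists_extension_mul hc h0 ha
  refine ⟨F, hF, ?_⟩
  rw [← 𝓜.res_res hV le_top, hF', map_mul, 𝓜.res_res, res_smooth_eq_one _ (fun y hy => h1 y hy),
    one_mul]

/-- Vector fields are local. -/
theorem res_VF_eq_zero {k j : ℤ} (Z : VF (𝓜.grading ⊤) k) {f : 𝓜.O ⊤} (hf : f ∈ 𝓜.grading ⊤ j)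
    {V : Opens M} (h : 𝓜.res (le_top : V ≤ ⊤) f = 0) :
    𝓜.res (le_top : V ≤ ⊤) (Z.1 f) = 0 := by
  refine eq_zero_of_local (𝓜.res_mem _ (memVF Z hf rfl)) fun x hx => ?_
  obtain ⟨ρ, V', K, hxV, hV, hc, h1, h0⟩ := exists_bump (I := I) x V hx
  refine ⟨V', hV, hxV, ?_⟩
  -- The product vanishes on `V` through `f` and on `K` through `ρ`; by the Leibniz rule `Z f` then
  -- vanishes where `ρ = 1` and `f = 0`.
  have h2 : 𝓜.smooth ⊤ ρ * f = 0 := by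
    refine eq_zero_of_local (smooth_mul_mem ρ hf) fun y _ => ?_
    rcases hc y with hy | hy
    · exact ⟨V, le_top, hy, by rw [map_mul, h, mul_zero]⟩
    · exact ⟨K, le_top, hy, by rw [map_mul, res_smooth_eq_zero _ (fun y hy => h0 y hy), zero_mul]⟩
  have h3 := congrArg (𝓜.res (le_top : V' ≤ ⊤)) (leibnizVF_zero Z (smooth_mem ⊤ ρ) f)
  have h4 : 𝓜.res (le_top : V' ≤ ⊤) f = 0 := by rw [← 𝓜.res_res hV le_top, h, map_zero]
  rw [h2, map_zero, map_zero, map_add, map_mul, map_mul, h4,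
    res_smooth_eq_one _ (fun y hy => h1 y hy), mul_zero, zero_add, one_mul] at h3
  rw [𝓜.res_res, ← h3]

theorem res_VF_congr {k j : ℤ} (Z : VF (𝓜.grading ⊤) k) {f g : 𝓜.O ⊤} (hf : f ∈ 𝓜.grading ⊤ j)
    (hg : g ∈ 𝓜.grading ⊤ j) {V : Opens M}
    (h : 𝓜.res (le_top : V ≤ ⊤) f = 𝓜.res (le_top : V ≤ ⊤) g) :
    𝓜.res (le_top : V ≤ ⊤) (Z.1 f) = 𝓜.res (le_top : V ≤ ⊤) (Z.1 g) := by
  have := res_VF_eq_zero Z (sub_mem hf hg) (V := V) (by rw [map_sub, h, sub_self])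
  rwa [map_sub, map_sub, sub_eq_zero] at this

/-- `1`-forms are local. -/
theorem res_app_eq_zero {n k : ℤ} (α : OneForm (𝓜.grading ⊤) n) (X : VF (𝓜.grading ⊤) k)
    {V : Opens M} (h : ∀ j, ∀ f ∈ 𝓜.grading ⊤ j, 𝓜.res (le_top : V ≤ ⊤) (X.1 f) = 0) :
    𝓜.res (le_top : V ≤ ⊤) (app α X : 𝓜.O ⊤) = 0 := by
  refine eq_zero_of_local (𝓜.res_mem _ (app α X).2) fun x hx => ?_
  obtain ⟨ρ, V', K, hxV, hV, hc, h1, h0⟩ := exists_bump (I := I) x V hx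
  refine ⟨V', hV, hxV, ?_⟩
  have h2 : lmulVF (⟨𝓜.smooth ⊤ ρ, smooth_mem ⊤ ρ⟩ : 𝓜.grading ⊤ 0) X (zero_add k) = 0 := by
    refine VF.ext_of_graded fun j f hf => ?_
    refine eq_zero_of_local (k := j + k) (smooth_mul_mem ρ (memVF X hf rfl)) fun y _ => ?_
    rcases hc y with hy | hy
    · exact ⟨V, le_top, hy, by rw [lmulVF_apply, map_mul,
        h j f hf, mul_zero]⟩
    · exact ⟨K, le_top, hy, by rw [lmulVF_apply, map_mul,
        res_smooth_eq_zero _ (fun y hy => h0 y hy), zero_mul]⟩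
  have h3 := app_lmul α (⟨𝓜.smooth ⊤ ρ, smooth_mem ⊤ ρ⟩ : 𝓜.grading ⊤ 0) X (zero_add k)
  rw [h2, app_zero] at h3
  have h4 := congrArg (𝓜.res (le_top : V' ≤ ⊤)) h3
  rw [map_zero, map_mul, res_smooth_eq_one _ (fun y hy => h1 y hy), one_mul] at h4
  rw [𝓜.res_res, ← h4]

/-- A vector field that kills coordinates over `V` vanishes on `V`. -/
theorem IsCoord.res_VF_eq_zero {U : Opens M} {ξ : Fin 𝓜.rank → 𝓜.O U} (h : 𝓜.IsCoord U ξ)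
    {x : M} (hU : ∀ y ∈ U, y ∈ (chartAt H x).source) {V : Opens M} (hV : V ≤ U) {k : ℤ}
    (Z : VF (𝓜.grading ⊤) k)
    (hx : ∀ l : E →L[ℝ] ℝ, ∃ c : Smooth I (⊤ : Opens M),
      (∀ y ∈ V, c ⟨y, trivial⟩ = l (extChartAt I x y)) ∧
      𝓜.res (le_top : V ≤ ⊤) (Z.1 (𝓜.smooth ⊤ c)) = 0)
    (hξ : ∀ j, ∃ F ∈ 𝓜.grading ⊤ (𝓜.deg j), 𝓜.res (le_top : V ≤ ⊤) F = 𝓜.res hV (ξ j) ∧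
      𝓜.res (le_top : V ≤ ⊤) (Z.1 F) = 0) {j : ℤ} {f : 𝓜.O ⊤} (hf : f ∈ 𝓜.grading ⊤ j) :
    𝓜.res (le_top : V ≤ ⊤) (Z.1 f) = 0 := by
  -- Hadamard's lemma at `x₀` writes `c` as a constant plus a sum of terms `(x^a - x^a(x₀)) g_a`. As
  -- `Z` kills `x^a`, the function `Z c` is a combination of the `Z g_a` with coefficients vanishing
  -- at `x₀`.
  have h0 : ∀ c : Smooth I (⊤ : Opens M), 𝓜.res (le_top : V ≤ ⊤) (Z.1 (𝓜.smooth ⊤ c)) = 0 := by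
    intro c
    let b := Module.finBasis ℝ E
    refine h.eq_zero_of_vanishing hV (𝓜.res_mem _ (memVF Z (smooth_mem ⊤ c) (zero_add k)))
      (ι := Fin (Module.finrank ℝ E)) fun x₀ hx₀ => ?_
    obtain ⟨W, g, hxW, hg⟩ := exists_chart_hadamard (I := I) b x c x₀ (hU x₀ (hV hx₀))
    choose C hC hC' using fun a => hx (b.coord a).toContinuousLinearMap
    have e : 𝓜.res (le_top : W ⊓ V ≤ ⊤) (𝓜.smooth ⊤ c) = 𝓜.res (le_top : W ⊓ V ≤ ⊤)
        (𝓜.smooth ⊤ (algebraMap ℝ _ (c ⟨x₀, trivial⟩) +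
          ∑ a, (C a - algebraMap ℝ _ (C a ⟨x₀, trivial⟩)) * g a)) := by
      rw [𝓜.res_smooth, 𝓜.res_smooth]
      congr 1
      ext ⟨y, hy⟩
      change c ⟨y, trivial⟩ = (algebraMap ℝ _ (c ⟨x₀, trivial⟩) +
        ∑ a, (C a - algebraMap ℝ _ (C a ⟨x₀, trivial⟩)) * g a : Smooth I (⊤ : Opens M)) ⟨y, trivial⟩
      rw [hg y hy.1, ContMDiffMap.coe_add, Pi.add_apply, Smooth.sum_apply]
      congr 1
      refine Finset.sum_congr rfl fun a _ => ?_
      change _ = (C a ⟨y, trivial⟩ - C a ⟨x₀, trivial⟩) * g a ⟨y, trivial⟩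
      rw [hC a y hy.2, hC a x₀ hx₀]
      rfl
    refine ⟨W ⊓ V, inf_le_right, ⟨hxW, hx₀⟩,
      fun a => (C a - algebraMap ℝ _ (C a ⟨x₀, trivial⟩)).res le_top,
      fun a => 𝓜.res le_top (Z.1 (𝓜.smooth ⊤ (g a))),
      fun a => 𝓜.res_mem _ (memVF Z (smooth_mem ⊤ _) (zero_add k)), fun a => ?_, ?_⟩
    · change C a ⟨x₀, trivial⟩ - C a ⟨x₀, trivial⟩ = 0
      rw [sub_self]
    · have hconst : ∀ r : ℝ, Z.1 (algebraMap ℝ (𝓜.O ⊤) r) = 0 := fun r => by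
        rw [Algebra.algebraMap_eq_smul_one, map_smul, VF_map_one, smul_zero]
      rw [𝓜.res_res, res_VF_congr Z (smooth_mem ⊤ _) (smooth_mem ⊤ _) e, map_add, map_add,
        AlgHom.commutes, hconst, zero_add, map_sum, map_sum, map_sum]
      refine Finset.sum_congr rfl fun a _ => ?_
      have hCa : 𝓜.res (le_top : W ⊓ V ≤ ⊤) (Z.1 (𝓜.smooth ⊤ (C a))) = 0 := by
        rw [← 𝓜.res_res (inf_le_right : W ⊓ V ≤ V) le_top, hC', map_zero]
      rw [map_mul, leibnizVF_zero Z (smooth_mem ⊤ _), map_add, map_mul, map_mul, map_sub, map_sub,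
        AlgHom.commutes, hconst, sub_zero, hCa, zero_mul, zero_add, ← 𝓜.res_smooth]
      simp only [map_sub, AlgHom.commutes]
  choose F hF hFξ hZF using hξ
  -- By the Leibniz rule the homogeneous functions killed by `Z` over `V` are closed under products,
  -- so all monomials in the coordinates are among them.
  let S : Submonoid (𝓜.O ⊤) :=
    { carrier := {g | ∃ j, g ∈ 𝓜.grading ⊤ j ∧ 𝓜.res (le_top : V ≤ ⊤) (Z.1 g) = 0}
      one_mem' := ⟨0, SetLike.one_mem_graded _, by rw [VF_map_one, map_zero]⟩
      mul_mem' := by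
        rintro a b ⟨i, ha, ha'⟩ ⟨i', hb, hb'⟩
        exact ⟨i + i', SetLike.mul_mem_graded ha hb, by
          rw [leibnizVF Z ha, map_add, map_smul, map_mul, map_mul, ha', hb', zero_mul, mul_zero,
            smul_zero, add_zero]⟩ }
  have hS : ∀ e : Fin 𝓜.rank → ℕ, monomial F e ∈ S := fun e =>
    Submonoid.list_prod_mem S fun a ha => by
      obtain ⟨i, rfl⟩ := List.mem_ofFn.1 ha
      exact pow_mem (show F i ∈ S from ⟨_, hF i, hZF i⟩) _
  refine eq_zero_of_local (𝓜.res_mem _ (memVF Z hf rfl)) fun y hy => ?_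
  obtain ⟨V', hV', hyV', hext⟩ := exists_extension (𝓜 := 𝓜) hy
  obtain ⟨c, hc, -⟩ := h.existsUnique hV (𝓜.res_mem le_top hf)
  -- `Z` acts on global functions only, so the coefficients of the local expansion are first
  -- extended to `M`.
  choose C hC hC' using fun e => hext 0 _ (smooth_mem V (c e))
  have hm : ∀ e : Exponent 𝓜.deg j, C e * monomial F e.1 ∈ 𝓜.grading ⊤ j := fun e =>
    mem_degree (SetLike.mul_mem_graded (hC e) (monomial_mem _ hF e)) (zero_add j)
  refine ⟨V', hV', hyV', ?_⟩
  have key : 𝓜.res (le_top : V' ≤ ⊤) f =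
      𝓜.res (le_top : V' ≤ ⊤) (∑ e, C e * monomial F e.1) := by
    rw [← 𝓜.res_res hV' le_top, hc, map_sum, map_sum]
    refine Finset.sum_congr rfl fun e _ => ?_
    rw [map_mul, map_mul, hC' e]
    congr 1
    have e1 := map_monomial (𝓜.res hV').toMonoidHom (fun j => 𝓜.res hV (ξ j)) e.1
    have e2 := map_monomial (𝓜.res (le_top : V' ≤ ⊤)).toMonoidHom F e.1
    refine e1.trans (Eq.trans ?_ e2.symm)
    congr 1
    funext i
    change 𝓜.res hV' (𝓜.res hV (ξ i)) = 𝓜.res le_top (F i)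
    rw [← hFξ, 𝓜.res_res]
  rw [𝓜.res_res, res_VF_congr Z hf (sum_mem fun e _ => hm e) key, map_sum, map_sum]
  refine Finset.sum_eq_zero fun e _ => ?_
  obtain ⟨g, hg⟩ := (𝓜.mem_grading_zero _ _).1 (hC e)
  obtain ⟨-, -, hz⟩ := hS e.1
  rw [leibnizVF_zero Z (hC e), ← hg, ← 𝓜.res_res hV' le_top, map_add, map_mul, map_mul, h0, hz,
    zero_mul, mul_zero, add_zero, map_zero]

end Local

end NManifold

end NGeom

namespace NGeom

/-! ### Ordered monomials in graded-commuting variables -/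

section Monomials

universe u

theorem monomial_succ {A : Type*} [Monoid A] {r : ℕ} (η : Fin (r + 1) → A) (e : Fin (r + 1) → ℕ) :
    monomial η e = η 0 ^ e 0 * monomial (fun j => η j.succ) fun j => e j.succ := by
  simp [monomial, List.ofFn_succ]

theorem monomial_zero {A : Type*} [Monoid A] {r : ℕ} (η : Fin r → A) :
    monomial η (fun _ => 0) = 1 := by
  simp [monomial, List.prod_replicate]

theorem monomial_single {A : Type*} [Monoid A] {r : ℕ} (η : Fin r → A) (i : Fin r) :
    monomial η (Pi.single i 1) = η i := by
  induction r with
  | zero => exact i.elim0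
  | succ r ih =>
    rw [monomial_succ]
    refine Fin.cases ?_ (fun i => ?_) i
    · rw [Pi.single_eq_same, pow_one]
      simp [monomial_zero]
    · have h : (fun j : Fin r => (Pi.single i.succ 1 : Fin (r + 1) → ℕ) j.succ) =
          Pi.single i 1 := by
        funext j; simp [Pi.single_apply]
      rw [h, ih]
      simp [(Fin.succ_ne_zero i).symm]

/-- The sign from sorting a new factor into the monomial depends only on the degrees and exponents.
It is chosen before the ring, so the same sign appears in two rings being compared. -/
theorem exists_mul_monomial {r : ℕ} (deg : Fin r → ℕ) (i : Fin r) (e : Fin r → ℕ) :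
    ∃ s : ℝ, ∀ {C : Type u} [Ring C] [Algebra ℝ C] (η : Fin r → C),
      (∀ i j, η i * η j = koszul (deg i * deg j) • (η j * η i)) →
      η i * monomial η e = s • monomial η (e + Pi.single i 1) := by
  induction r with
  | zero => exact i.elim0
  | succ r ih =>
    refine Fin.cases ⟨1, fun η _ => ?_⟩ (fun i => ?_) i
    · have e1 : (e + Pi.single 0 1 : Fin (r + 1) → ℕ) 0 = e 0 + 1 := by simp
      have e2 : (fun j : Fin r => (e + Pi.single 0 1 : Fin (r + 1) → ℕ) j.succ) =
          fun j => e j.succ := by funext j; simp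
      rw [monomial_succ, monomial_succ, one_smul, ← mul_assoc, e1, e2, pow_succ']
    · obtain ⟨s, hs⟩ := ih (fun j => deg j.succ) i (fun j => e j.succ)
      refine ⟨koszul (deg i.succ * deg 0) ^ e 0 * s, fun η hη => ?_⟩
      have hp : ∀ m : ℕ, η i.succ * η 0 ^ m =
          koszul (deg i.succ * deg 0) ^ m • (η 0 ^ m * η i.succ) := by
        intro m
        induction m with
        | zero => simp
        | succ m ihm =>
          rw [pow_succ, ← mul_assoc, ihm, smul_mul_assoc, mul_assoc, hη i.succ 0, mul_smul_comm,
            smul_smul, ← pow_succ, mul_assoc]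
      have e1 : (e + Pi.single i.succ 1 : Fin (r + 1) → ℕ) 0 = e 0 := by
        simp [(Fin.succ_ne_zero i).symm]
      have e2 : (fun j : Fin r => (e + Pi.single i.succ 1 : Fin (r + 1) → ℕ) j.succ) =
          (fun j => e j.succ) + Pi.single i 1 := by funext j; simp [Pi.single_apply]
      rw [monomial_succ, monomial_succ, ← mul_assoc, hp, smul_mul_assoc, mul_assoc,
        hs (fun j => η j.succ) fun i j => hη _ _, mul_smul_comm, smul_smul, e1, e2]

theorem mul_self_eq_zero_of_odd {C : Type*} [Ring C] [Algebra ℝ C] {d : ℕ} (hd : Odd d) {x : C}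
    (h : x * x = koszul (d * d) • (x * x)) : x * x = 0 := by
  rw [koszul_odd ((Int.odd_mul).2 ⟨by exact_mod_cast hd, by exact_mod_cast hd⟩)] at h
  have h3 : (2 : ℝ) • (x * x) = 0 := by rw [two_smul]; nth_rw 1 [h]; module
  exact (smul_eq_zero.1 h3).resolve_left two_ne_zero

theorem monomial_eq_zero {C : Type*} [Ring C] {r : ℕ} {η : Fin r → C} {e : Fin r → ℕ} {i : Fin r}
    (h : η i * η i = 0) (he : 2 ≤ e i) : monomial η e = 0 := by
  refine List.prod_eq_zero (List.mem_ofFn.2 ⟨i, ?_⟩)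
  change η i ^ e i = 0
  rw [← Nat.add_sub_cancel' he, pow_add, pow_two, h, zero_mul]

end Monomials

namespace NManifold

/-! ### Vector fields with prescribed values on local coordinates -/

section LocalFrames

universe u v

variable {E : Type*} [NormedAddCommGroup E] [NormedSpace ℝ E] {H : Type*} [TopologicalSpace H]
  {I : ModelWithCorners ℝ E H} {M : Type v} [TopologicalSpace M] [ChartedSpace H M]
  {𝓜 : NManifold.{u} I M}

theorem IsCoord.mem_of_eq_sum {U : Opens M} {ξ : Fin 𝓜.rank → 𝓜.O U} (h : 𝓜.IsCoord U ξ) {k : ℤ}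
    {f : 𝓜.O U} (hf : f ∈ 𝓜.grading U k) : ∃ c : Exponent 𝓜.deg k → Smooth I U,
      f = ∑ e, 𝓜.smooth U (c e) * monomial ξ e.1 := by
  obtain ⟨c, hc, -⟩ := h.existsUnique le_rfl hf
  simp only [𝓜.res_self] at hc
  exact ⟨c, hc⟩

/-- The predicate carries the degree; working in a submonoid of pairs (degree, function) lets the
degree of a monomial be tracked along with its value. -/
theorem IsCoord.induction {U : Opens M} {ξ : Fin 𝓜.rank → 𝓜.O U} (h : 𝓜.IsCoord U ξ)
    {P : ℤ → 𝓜.O U → Prop} (zero : ∀ k, P k 0) (smooth : ∀ c, P 0 (𝓜.smooth U c))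
    (coord : ∀ i, P (𝓜.deg i) (ξ i)) (mul : ∀ j k f g, P j f → P k g → P (j + k) (f * g))
    (add : ∀ k f g, P k f → P k g → P k (f + g)) {k : ℤ} {f : 𝓜.O U}
    (hf : f ∈ 𝓜.grading U k) : P k f := by
  let S : Submonoid (Multiplicative ℤ × 𝓜.O U) :=
    { carrier := {p | P p.1.toAdd p.2}
      one_mem' := by simpa using smooth 1
      mul_mem' := fun {a b} ha hb => mul _ _ _ _ ha hb }
  let p : Fin 𝓜.rank → Multiplicative ℤ × 𝓜.O U := fun i => (Multiplicative.ofAdd (𝓜.deg i : ℤ), ξ i)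
  have hS : ∀ e, monomial p e ∈ S := fun e => Submonoid.list_prod_mem S fun a ha => by
    obtain ⟨i, rfl⟩ := List.mem_ofFn.1 ha
    exact pow_mem (show p i ∈ S from coord i) _
  obtain ⟨c, rfl⟩ := h.mem_of_eq_sum hf
  refine Finset.sum_induction _ (P k) (add k) (zero k) fun e _ => ?_
  have h1 := hS e.1
  have h2 : (monomial p e.1).2 = monomial ξ e.1 := map_monomial (MonoidHom.snd _ _) p e.1
  have h3 : (monomial p e.1).1.toAdd = k := by
    have : (monomial p e.1).1 = monomial (fun i => (p i).1) e.1 :=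
      map_monomial (MonoidHom.fst _ _) p e.1
    rw [this, monomial, List.prod_ofFn]
    refine Eq.trans ?_ e.2.2
    simp [p, toAdd_prod]
  change P (monomial p e.1).1.toAdd (monomial p e.1).2 at h1
  rw [h2, h3] at h1
  simpa using mul 0 k _ _ (smooth (c e)) h1

theorem IsCoord.comm {U : Opens M} {ξ : Fin 𝓜.rank → 𝓜.O U} (h : 𝓜.IsCoord U ξ)
    (i j : Fin 𝓜.rank) : ξ i * ξ j = koszul (𝓜.deg i * 𝓜.deg j) • (ξ j * ξ i) :=
  GradedComm.comm (h.1 i) (h.1 j)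

/-- The universal property of graded coordinates. -/
theorem IsCoord.exists_hom {U : Opens M} {ξ : Fin 𝓜.rank → 𝓜.O U} (h : 𝓜.IsCoord U ξ)
    {C : Type u} [Ring C] [Algebra ℝ C] (ψ : Smooth I U →ₐ[ℝ] C) (η : Fin 𝓜.rank → C)
    (hη : ∀ i j, η i * η j = koszul (𝓜.deg i * 𝓜.deg j) • (η j * η i))
    (hψ : ∀ c i, ψ c * η i = η i * ψ c) :
    ∃ Φ : 𝓜.O U →ₗ[ℝ] C, (∀ f g, Φ (f * g) = Φ f * Φ g) ∧ (∀ c, Φ (𝓜.smooth U c) = ψ c) ∧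
      ∀ i, Φ (ξ i) = η i := by
  classical
  -- In each degree, coefficient families correspond bijectively to functions, so `Φ` can be defined
  -- by substituting `ψ` and `η` in the expansion.
  let T : ∀ k, (Exponent 𝓜.deg k → Smooth I U) →ₗ[ℝ] 𝓜.grading U k := fun k =>
    { toFun := fun c => ⟨∑ e, 𝓜.smooth U (c e) * monomial ξ e.1,
        sum_mem fun e _ => smooth_mul_mem _ (monomial_mem _ h.1 e)⟩
      map_add' := fun c c' => Subtype.ext (by simp [add_mul, Finset.sum_add_distrib])
      map_smul' := fun r c => Subtype.ext (by simp [Finset.smul_sum]) }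
  have hT : ∀ k, Function.Bijective (T k) := by
    intro k
    have hu : ∀ f ∈ 𝓜.grading U k, ∃! c : Exponent 𝓜.deg k → Smooth I U,
        f = ∑ e, 𝓜.smooth U (c e) * monomial ξ e.1 := fun f hf => by
      have := h.existsUnique le_rfl hf
      simpa only [𝓜.res_self] using this
    refine ⟨fun c c' hc => (hu _ (T k c).2).unique rfl (congrArg Subtype.val hc), fun f => ?_⟩
    obtain ⟨c, hc, -⟩ := hu f f.2
    exact ⟨c, Subtype.ext hc.symm⟩
  let G : ∀ k, (Exponent 𝓜.deg k → Smooth I U) →ₗ[ℝ] C := fun k =>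
    { toFun := fun c => ∑ e, ψ (c e) * monomial η e.1
      map_add' := fun c c' => by simp [add_mul, Finset.sum_add_distrib]
      map_smul' := fun r c => by simp [Finset.smul_sum] }
  obtain ⟨Φ, hΦ⟩ := exists_linearMap_of_graded (𝒜 := 𝓜.grading U)
    fun k => G k ∘ₗ (LinearEquiv.ofBijective (T k) (hT k)).symm.toLinearMap
  have h1 : ∀ k (c : Exponent 𝓜.deg k → Smooth I U),
      Φ (∑ e, 𝓜.smooth U (c e) * monomial ξ e.1) = ∑ e, ψ (c e) * monomial η e.1 := by
    intro k c
    have h2 := hΦ k (T k c)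
    have h3 : (LinearEquiv.ofBijective (T k) (hT k)).symm (T k c) = c :=
      (LinearEquiv.ofBijective (T k) (hT k)).symm_apply_apply c
    rw [LinearMap.comp_apply, LinearEquiv.coe_coe, h3] at h2
    exact h2
  have h2 : ∀ c (e : Fin 𝓜.rank → ℕ), Φ (𝓜.smooth U c * monomial ξ e) = ψ c * monomial η e := by
    intro c e
    -- The formula is needed for arbitrary exponents. If an odd variable occurs with exponent at
    -- least `2`, both monomials vanish.
    by_cases he : ∀ j, Odd (𝓜.deg j) → e j ≤ 1
    · let e' : Exponent 𝓜.deg (∑ j, (e j * 𝓜.deg j : ℕ) : ℤ) := ⟨e, he, rfl⟩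
      have h3 := h1 _ (Pi.single e' c)
      rw [Finset.sum_eq_single e', Finset.sum_eq_single e', Pi.single_eq_same] at h3
      · exact h3
      · intro e'' _ hne
        rw [Pi.single_eq_of_ne hne, map_zero, zero_mul]
      · simp
      · intro e'' _ hne
        rw [Pi.single_eq_of_ne hne, map_zero, zero_mul]
      · simp
    · push Not at he
      obtain ⟨j, hj, hej⟩ := he
      rw [monomial_eq_zero (mul_self_eq_zero_of_odd hj (h.comm j j)) hej,
        monomial_eq_zero (mul_self_eq_zero_of_odd hj (hη j j)) hej, mul_zero, mul_zero, map_zero]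
  have hs : ∀ c, Φ (𝓜.smooth U c) = ψ c := fun c => by
    simpa [monomial_zero] using h2 c fun _ => 0
  have hξ : ∀ i, Φ (ξ i) = η i := fun i => by
    simpa [monomial_single] using h2 1 (Pi.single i 1)
  refine ⟨Φ, fun f => ?_, hs, hξ⟩
  -- Multiplicativity for a fixed left factor needs to be tested only on a single term in the right
  -- factor; the left factor is then built up from generators.
  have hgen : ∀ (f : 𝓜.O U) (y : C), (∀ c (e : Fin 𝓜.rank → ℕ),
      Φ (f * (𝓜.smooth U c * monomial ξ e)) = y * (ψ c * monomial η e)) →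
      ∀ g, Φ (f * g) = y * Φ g := by
    intro f y hf g
    induction g using graded_induction (𝓜.grading U) with
    | hom j g hg =>
      obtain ⟨c, rfl⟩ := h.mem_of_eq_sum hg
      simp only [Finset.mul_sum, map_sum, h2, hf]
    | add g g' hg hg' => rw [mul_add, map_add, hg, hg', map_add, mul_add]
  induction f using graded_induction (𝓜.grading U) with
  | hom k f hf =>
    refine h.induction (P := fun _ f => ∀ g, Φ (f * g) = Φ f * Φ g) ?_ ?_ ?_ ?_ ?_ hf
    · simp
    · intro c
      refine hgen _ _ fun c' e => ?_
      rw [← mul_assoc, ← map_mul, h2, map_mul, hs, mul_assoc]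
    · intro i
      refine hgen _ _ fun c e => ?_
      obtain ⟨s, hs⟩ := exists_mul_monomial.{u} 𝓜.deg i e
      rw [← mul_assoc, ← smooth_mul_comm, mul_assoc, hs ξ h.comm, mul_smul_comm, map_smul, h2, hξ,
        ← mul_assoc, ← hψ, mul_assoc, hs η hη, mul_smul_comm]
    · intro j k f g hf hg g'
      rw [mul_assoc, hf, hg, hf, mul_assoc]
    · intro k f g hf hg g'
      rw [add_mul, map_add, hf, hg, map_add, add_mul]
  | add f f' hf hf' => intro g; rw [add_mul, map_add, hf, hf', map_add, add_mul]

/-- Vector fields over a coordinate domain are determined freely by their values on smooth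
functions and coordinates. -/
theorem IsCoord.exists_VF {U : Opens M} {ξ : Fin 𝓜.rank → 𝓜.O U} (h : 𝓜.IsCoord U ξ)
    {k : ℤ} (D : Smooth I U →ₗ[ℝ] 𝓜.O U) (hD : ∀ c, D c ∈ 𝓜.grading U k)
    (hDm : ∀ c c', D (c * c') = 𝓜.smooth U c * D c' + D c * 𝓜.smooth U c')
    (y : Fin 𝓜.rank → 𝓜.O U) (hy : ∀ i, y i ∈ 𝓜.grading U (𝓜.deg i + k)) :
    ∃ X : VF (𝓜.grading U) k, (∀ c, X.1 (𝓜.smooth U c) = D c) ∧ ∀ i, X.1 (ξ i) = y i := by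
  have hD1 : D 1 = 0 := by simpa using hDm 1 1
  -- A derivation `X` of degree `k` is encoded by the map sending `f` to the upper triangular matrix
  -- with diagonal `(-1)^{k|f|} f`, `f` and corner `X f`. Multiplicativity of this map is exactly
  -- the graded Leibniz rule, so the universal property yields `X`.
  let ψ : Smooth I U →ₐ[ℝ] Matrix (Fin 2) (Fin 2) (𝓜.O U) := AlgHom.ofLinearMap
    { toFun := fun c => !![𝓜.smooth U c, D c; 0, 𝓜.smooth U c]
      map_add' := fun c c' => by ext i j; fin_cases i <;> fin_cases j <;> simp
      map_smul' := fun r c => by ext i j; fin_cases i <;> fin_cases j <;> simp }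
    (by ext i j; fin_cases i <;> fin_cases j <;> simp [hD1])
    (fun c c' => by
      ext i j; fin_cases i <;> fin_cases j <;> simp [Matrix.mul_apply, Fin.sum_univ_two, hDm])
  let η : Fin 𝓜.rank → Matrix (Fin 2) (Fin 2) (𝓜.O U) := fun i =>
    !![koszul (k * 𝓜.deg i) • ξ i, y i; 0, ξ i]
  obtain ⟨Φ, hΦm, hΦs, hΦξ⟩ := h.exists_hom ψ η (fun i j => by
    have e1 : y i * ξ j = koszul ((𝓜.deg i + k) * 𝓜.deg j) • (ξ j * y i) :=
      GradedComm.comm (hy i) (h.1 j)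
    have e2 : ξ i * y j = koszul (𝓜.deg i * (𝓜.deg j + k)) • (y j * ξ i) :=
      GradedComm.comm (h.1 i) (hy j)
    have e3 := h.comm i j
    have e4 : (koszul (k * 𝓜.deg i) • ξ i) * y j + y i * ξ j = koszul (𝓜.deg i * 𝓜.deg j) •
        ((koszul (k * 𝓜.deg j) • ξ j) * y i + y j * ξ i) := by
      rw [smul_mul_assoc, e1, e2, smul_mul_assoc, smul_add, smul_smul, smul_smul, ← koszul_add,
        ← koszul_add, add_comm]
      congr 2
      · congr 1; ring
      · exact koszul_congr (c := k * 𝓜.deg i) (by ring)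
    ext a b; fin_cases a <;> fin_cases b <;> simp [η, Matrix.mul_apply, Fin.sum_univ_two]
    · rw [e3]
      simp only [smul_smul]
      congr 1; ring
    · simpa [smul_mul_assoc] using e4
    · exact e3) (fun c i => by
    have e1 : D c * ξ i = koszul (k * 𝓜.deg i) • (ξ i * D c) := GradedComm.comm (hD c) (h.1 i)
    ext a b; fin_cases a <;> fin_cases b <;>
      simp [ψ, η, Matrix.mul_apply, Fin.sum_univ_two, smooth_mul_comm, e1, add_comm])
  -- The universal property only gives a multiplicative map into matrices; that its values have the
  -- expected triangular shape is checked on generators.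
  have hshape : ∀ j, ∀ f ∈ 𝓜.grading U j, f ∈ 𝓜.grading U j ∧ Φ f 0 0 = koszul (k * j) • f ∧
      Φ f 0 1 ∈ 𝓜.grading U (j + k) ∧ Φ f 1 0 = 0 ∧ Φ f 1 1 = f := by
    intro j f hf
    refine h.induction (P := fun j f => f ∈ 𝓜.grading U j ∧ Φ f 0 0 = koszul (k * j) • f ∧
      Φ f 0 1 ∈ 𝓜.grading U (j + k) ∧ Φ f 1 0 = 0 ∧ Φ f 1 1 = f) ?_ ?_ ?_ ?_ ?_ hf
    · intro k; simp
    · intro c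
      rw [hΦs]
      exact ⟨smooth_mem U c, by simp [ψ, koszul_zero], by simpa [ψ] using hD c, by simp [ψ],
        by simp [ψ]⟩
    · intro i
      rw [hΦξ]
      exact ⟨h.1 i, by simp [η], by simpa [η] using hy i, by simp [η], by simp [η]⟩
    · rintro i j f g ⟨hf, f0, f1, f2, f3⟩ ⟨hg, g0, g1, g2, g3⟩
      simp only [hΦm, Matrix.mul_apply, Fin.sum_univ_two, f0, f2, f3, g0, g2, g3, mul_zero,
        zero_mul, smul_zero, add_zero, zero_add, smul_mul_assoc, mul_smul_comm, smul_smul, ← koszul_add]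
      refine ⟨SetLike.mul_mem_graded hf hg, by congr 2; ring, add_mem (Submodule.smul_mem _ _
        (mem_degree (SetLike.mul_mem_graded hf g1) (by ring)))
        (mem_degree (SetLike.mul_mem_graded f1 hg) (by ring)), trivial, trivial⟩
    · rintro j f g ⟨hf, f0, f1, f2, f3⟩ ⟨hg, g0, g1, g2, g3⟩
      simp only [map_add, Matrix.add_apply, f0, f2, f3, g0, g2, g3, smul_add, add_zero]
      exact ⟨add_mem hf hg, trivial, add_mem f1 g1, trivial, trivial⟩
  have h11 : ∀ f, Φ f 1 1 = f := by
    intro f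
    induction f using graded_induction (𝓜.grading U) with
    | hom j f hf => exact (hshape j f hf).2.2.2.2
    | add f g hf hg => rw [map_add, Matrix.add_apply, hf, hg]
  refine ⟨⟨Matrix.entryLinearMap ℝ (𝓜.O U) 0 1 ∘ₗ Φ, fun j f hf => (hshape j f hf).2.2.1,
    fun j f hf g => ?_⟩, fun c => ?_, fun i => ?_⟩
  · change Φ (f * g) 0 1 = Φ f 0 1 * g + koszul (k * j) • (f * Φ g 0 1)
    rw [hΦm, Matrix.mul_apply, Fin.sum_univ_two, h11, (hshape j f hf).2.1, smul_mul_assoc, add_comm]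
  · change Φ (𝓜.smooth U c) 0 1 = D c
    rw [hΦs]; rfl
  · change Φ (ξ i) 0 1 = y i
    rw [hΦξ]; rfl

end LocalFrames

end NManifold

end NGeom

namespace NGeom

namespace NManifold

/-! ### Global vector fields and frames near a point -/

section GlobalFrames

universe u v

variable {E : Type*} [NormedAddCommGroup E] [NormedSpace ℝ E] {H : Type*} [TopologicalSpace H]
  {I : ModelWithCorners ℝ E H} {M : Type v} [TopologicalSpace M] [ChartedSpace H M]
  {𝓜 : NManifold.{u} I M}

variable (𝓜) in
/-- Near every point there are graded coordinates on a part of the domain of a chart. -/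
theorem exists_isCoord (x : M) : ∃ (U : Opens M) (ξ : Fin 𝓜.rank → 𝓜.O U), x ∈ U ∧
    (∀ y ∈ U, y ∈ (chartAt H x).source) ∧ 𝓜.IsCoord U ξ := by
  obtain ⟨U, hxU, ξ, h1, h2⟩ := 𝓜.exists_coord x
  exact ⟨U ⊓ ⟨(chartAt H x).source, (chartAt H x).open_source⟩, fun j => 𝓜.res inf_le_left (ξ j),
    ⟨hxU, mem_chart_source H x⟩, fun y hy => hy.2,
    IsCoord.res (𝓜 := 𝓜) (U := U) (ξ := ξ) ⟨h1, h2⟩ inf_le_left⟩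

variable [FiniteDimensional ℝ E] [T2Space M] [IsManifold I ∞ M] [I.Boundaryless]

/-- Vector fields can only be applied to global functions, so body and graded coordinates are
replaced by global functions agreeing with them near `x`. -/
theorem IsCoord.exists_global {U : Opens M} {ξ : Fin 𝓜.rank → 𝓜.O U} (h : 𝓜.IsCoord U ξ) {x : M}
    (hU : ∀ y ∈ U, y ∈ (chartAt H x).source) (hx : x ∈ U) :
    ∃ (V : Opens M) (hV : V ≤ U) (c : (E →L[ℝ] ℝ) → Smooth I (⊤ : Opens M))
      (F : Fin 𝓜.rank → 𝓜.O ⊤), x ∈ V ∧ (∀ l, ∀ y ∈ V, c l ⟨y, trivial⟩ = l (extChartAt I x y)) ∧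
      (∀ j, F j ∈ 𝓜.grading ⊤ (𝓜.deg j)) ∧ ∀ j, 𝓜.res le_top (F j) = 𝓜.res hV (ξ j) := by
  obtain ⟨V, hV, hxV, hext⟩ := exists_extension (𝓜 := 𝓜) hx
  choose F hF hF' using fun j => hext _ _ (h.1 j)
  choose G hG hG' using fun l => hext _ _ (smooth_mem U (chartCoord (I := I) x hU l))
  choose c hc using fun l => (𝓜.mem_grading_zero _ _).1 (hG l)
  refine ⟨V, hV, c, F, hxV, fun l y hy => ?_, hF, hF'⟩
  have h1 := hG' l
  rw [← hc, 𝓜.res_smooth, 𝓜.res_smooth] at h1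
  exact DFunLike.congr_fun (𝓜.smooth_injective _ h1) ⟨y, hy⟩

/-- Global vector fields with prescribed values on coordinates near a point. -/
theorem IsCoord.exists_global_VF {U : Opens M} {ξ : Fin 𝓜.rank → 𝓜.O U} (h : 𝓜.IsCoord U ξ)
    {x : M} (hU : ∀ y ∈ U, y ∈ (chartAt H x).source) (hx : x ∈ U) {κ : Type*} [Fintype κ]
    (b : κ → E) : ∃ (V : Opens M) (hV : V ≤ U), x ∈ V ∧
      ∀ (k : ℤ) (w : κ → 𝓜.O ⊤) (_ : ∀ a, w a ∈ 𝓜.grading ⊤ k) (y : Fin 𝓜.rank → 𝓜.O ⊤)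
      (_ : ∀ j, y j ∈ 𝓜.grading ⊤ (𝓜.deg j + k)), ∃ X : VF (𝓜.grading ⊤) k,
        (∀ c : Smooth I (⊤ : Opens M), 𝓜.res (le_top : V ≤ ⊤) (X.1 (𝓜.smooth ⊤ c)) =
          ∑ a, 𝓜.res le_top (w a) *
            𝓜.smooth V ((chartDeriv x hU (b a) (c.res le_top)).res hV)) ∧
        ∀ j, ∀ F ∈ 𝓜.grading ⊤ (𝓜.deg j), ∀ (V' : Opens M) (hV' : V' ≤ V),
          𝓜.res le_top F = 𝓜.res (hV'.trans hV) (ξ j) →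
          𝓜.res (le_top : V' ≤ ⊤) (X.1 F) = 𝓜.res le_top (y j) := by
  obtain ⟨U', hU', c, F, hxU', -, hF, hF'⟩ := h.exists_global hU hx
  obtain ⟨ρ, V, K, hxV, hV, hc, h1, h0⟩ := exists_bump (I := I) x U' hxU'
  refine ⟨V, hV.trans hU', hxV, fun k w hw y hy => ?_⟩
  have hU'c : ∀ y ∈ U', y ∈ (chartAt H x).source := fun y hy => hU y (hU' hy)
  obtain ⟨X, hXs, hXξ⟩ := (h.res hU').exists_VF (k := k)
    { toFun := fun c => ∑ a, 𝓜.res le_top (w a) * 𝓜.smooth U' (chartDeriv x hU'c (b a) c)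
      map_add' := fun c c' => by simp [chartDeriv_add, mul_add, Finset.sum_add_distrib]
      map_smul' := fun r c => by simp [chartDeriv_smul, Finset.smul_sum] }
    (fun c => sum_mem fun a _ => mem_degree (SetLike.mul_mem_graded (𝓜.res_mem _ (hw a))
      (smooth_mem _ _)) (add_zero k))
    (fun c c' => by
      simp only [LinearMap.coe_mk, AddHom.coe_mk, chartDeriv_mul, map_add, map_mul, mul_add,
        Finset.sum_add_distrib, Finset.mul_sum, Finset.sum_mul]
      congr 1
      · refine Finset.sum_congr rfl fun a _ => ?_
        rw [← mul_assoc, ← mul_assoc, smooth_mul_comm]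
      · refine Finset.sum_congr rfl fun a _ => ?_
        rw [mul_assoc])
    (fun j => 𝓜.res le_top (y j)) (fun j => 𝓜.res_mem _ (hy j))
  let ρ' : 𝓜.O U' := 𝓜.res le_top (𝓜.smooth ⊤ ρ)
  have hρ' : ρ' ∈ 𝓜.grading U' 0 := 𝓜.res_mem _ (smooth_mem _ _)
  have hz : ∀ (W : Opens M) (hW : W ≤ U') (_ : W ≤ K) (f : 𝓜.O U'), 𝓜.res hW (ρ' * f) = 0 := by
    intro W hW hK f
    rw [map_mul, 𝓜.res_res, res_smooth_eq_zero _ (fun y hy => h0 y (hK hy)), zero_mul]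
  -- The local field times the bump: it vanishes on `U'` inside `K`, hence glues with zero on `K`,
  -- and agrees with the local field where the bump is `1`.
  let L₁ : 𝓜.O ⊤ →ₗ[ℝ] 𝓜.O U' :=
    LinearMap.mulLeft ℝ ρ' ∘ₗ X.1 ∘ₗ (𝓜.res (le_top : U' ≤ ⊤)).toLinearMap
  have hL₁ : ∀ f, L₁ f = ρ' * X.1 (𝓜.res le_top f) := fun f => rfl
  let W : ULift.{v} Bool → Opens M := fun i => bif i.down then U' else K
  let L : ∀ i, 𝓜.O ⊤ →ₗ[ℝ] 𝓜.O (W i) := fun i => match i with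
    | ⟨true⟩ => L₁
    | ⟨false⟩ => 0
  obtain ⟨Y, hY⟩ := exists_VF_of_local W (fun y => by
      rcases hc y with h | h
      · exact ⟨⟨true⟩, h⟩
      · exact ⟨⟨false⟩, h⟩) (k := k) L (by
      rintro ⟨_ | _⟩ j f hf
      · exact zero_mem _
      · exact mem_degree (SetLike.mul_mem_graded hρ' (memVF X (𝓜.res_mem _ hf) rfl)) (zero_add _))
    (by
      rintro ⟨_ | _⟩ j l f hf g hg
      · change (0 : 𝓜.O K) = 0 * _ + koszul (k * j) • (_ * 0)
        rw [zero_mul, mul_zero, smul_zero, add_zero]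
      · change L₁ (f * g) = L₁ f * 𝓜.res (le_top : U' ≤ ⊤) g +
          koszul (k * j) • (𝓜.res (le_top : U' ≤ ⊤) f * L₁ g)
        rw [hL₁, hL₁, hL₁, map_mul, leibnizVF X (𝓜.res_mem _ hf), mul_add, mul_assoc,
          mul_smul_comm, ← mul_assoc, ← mul_assoc, mul_comm_of_degree_zero hρ'
          (𝓜.res (le_top : U' ≤ ⊤) f), mul_assoc (𝓜.res (le_top : U' ≤ ⊤) f)])
    (by
      rintro ⟨_ | _⟩ ⟨_ | _⟩ j f hf V' h1 h2
      · rfl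
      · exact (map_zero _).trans (hz V' h2 h1 _).symm
      · exact (hz V' h1 h2 _).trans (map_zero _).symm
      · rfl)
  have hYV : ∀ j, ∀ f ∈ 𝓜.grading ⊤ j,
      𝓜.res (le_top : V ≤ ⊤) (Y.1 f) = 𝓜.res hV (X.1 (𝓜.res le_top f)) := by
    intro j f hf
    have h2 := congrArg (𝓜.res hV) (hY ⟨true⟩ j f hf)
    refine (𝓜.res_res hV le_top _).symm.trans (h2.trans ?_)
    change 𝓜.res hV (ρ' * X.1 (𝓜.res le_top f)) = _
    rw [map_mul, 𝓜.res_res, res_smooth_eq_one _ (fun y hy => h1 y hy), one_mul]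
  refine ⟨Y, fun c => ?_, fun j G hG V' hV' hGξ => ?_⟩
  · rw [hYV 0 _ (smooth_mem _ _), 𝓜.res_smooth, hXs, LinearMap.coe_mk, AddHom.coe_mk, map_sum]
    refine Finset.sum_congr rfl fun a _ => ?_
    rw [map_mul, 𝓜.res_res, 𝓜.res_smooth]
    congr 2
    ext ⟨z, hz⟩
    refine (chartDeriv_eq_fderiv hU'c (b a) _ (f := (c.res le_top : Smooth I U).extend) (hV hz)
      ?_).trans rfl
    filter_upwards [U'.isOpen.mem_nhds (hV hz)] with z' hz'
    rw [Smooth.extend_of_mem _ (hU' hz'), Smooth.extend_of_mem _ hz']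
    rfl
  · rw [res_VF_congr Y hG (hF j) (by rw [hGξ, ← 𝓜.res_res (hV'.trans hV) le_top, hF', 𝓜.res_res]),
      ← 𝓜.res_res hV' le_top, hYV _ _ (hF j), hF', hXξ, 𝓜.res_res, 𝓜.res_res]

variable (𝓜) in
/-- Near every point, vector fields are combinations of finitely many of them. -/
theorem exists_frame (x : M) : ∃ (ι : Type) (_ : Fintype ι) (d : ι → ℤ)
    (f : ∀ i, 𝓜.grading ⊤ (d i)) (e : ∀ i, VF (𝓜.grading ⊤) (-d i))
    (ρ : 𝓜.grading ⊤ 0) (V : Opens M), x ∈ V ∧ 𝓜.res (le_top : V ≤ ⊤) ρ = 1 ∧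
    ∀ (k : ℤ) (Y : VF (𝓜.grading ⊤) k) (g : 𝓜.O ⊤),
      ρ * Y.1 g = ∑ i, Y.1 (f i).1 * (e i).1 g := by
  classical
  obtain ⟨U, ξ, hxU, hU, h⟩ := 𝓜.exists_isCoord x
  let b := Module.finBasis ℝ E
  obtain ⟨V₁, hV₁, c, F, hxV₁, hc, hF, hFξ⟩ := h.exists_global hU hxU
  obtain ⟨V₂, hV₂, hxV₂, hX⟩ := h.exists_global_VF hU hxU b
  let V := V₁ ⊓ V₂
  obtain ⟨ρ, V', K, hxV', hV', hK, h1, h0⟩ := exists_bump (I := I) x V ⟨hxV₁, hxV₂⟩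
  let l : Fin (Module.finrank ℝ E) → E →L[ℝ] ℝ := fun a => (b.coord a).toContinuousLinearMap
  choose e₁ he₁ he₁' using fun a => hX 0 (Pi.single a 1) (fun a' => by
    by_cases h : a' = a
    · subst h; rw [Pi.single_eq_same]; exact SetLike.one_mem_graded _
    · rw [Pi.single_eq_of_ne h]; exact zero_mem _) 0 (fun j => zero_mem _)
  choose e₂ he₂ he₂' using fun j => hX (-𝓜.deg j) 0 (fun a' => zero_mem _) (Pi.single j 1)
    (fun j' => by
      by_cases h : j' = j
      · subst h; rw [Pi.single_eq_same, add_neg_cancel]; exact SetLike.one_mem_graded _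
      · rw [Pi.single_eq_of_ne h]; exact zero_mem _)
  let ι := Fin (Module.finrank ℝ E) ⊕ Fin 𝓜.rank
  let d : ι → ℤ := Sum.elim (fun _ => 0) fun j => 𝓜.deg j
  let f : ∀ i, 𝓜.grading ⊤ (d i) := Sum.rec (fun a => ⟨𝓜.smooth ⊤ (c (l a)), smooth_mem _ _⟩)
    fun j => ⟨F j, hF j⟩
  let e : ∀ i, VF (𝓜.grading ⊤) (-d i) := Sum.rec (fun a => ⟨(e₁ a).1, by
    change (e₁ a).1 ∈ VF (𝓜.grading ⊤) (-0); rw [neg_zero]; exact (e₁ a).2⟩) fun j => e₂ j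
  let ρ' : 𝓜.grading ⊤ 0 := ⟨𝓜.smooth ⊤ ρ, smooth_mem _ _⟩
  -- Over `V` the fields `e` are dual to the coordinate functions `f`.
  have hef : ∀ i i', 𝓜.res (le_top : V ≤ ⊤) ((e i').1 (f i).1) = if i' = i then 1 else 0 := by
    have hVs : ∀ z : 𝓜.O ⊤, 𝓜.res (le_top : V ≤ ⊤) z =
        𝓜.res (inf_le_right : V ≤ V₂) (𝓜.res le_top z) := fun z => (𝓜.res_res _ _ _).symm
    have hVF : ∀ j, 𝓜.res (le_top : V ≤ ⊤) (F j) =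
        𝓜.res ((inf_le_right : V ≤ V₂).trans hV₂) (ξ j) := fun j => by
      rw [← 𝓜.res_res (inf_le_left : V ≤ V₁) le_top, hFξ, 𝓜.res_res]
    rintro (a | j) (a' | j')
    · change 𝓜.res _ ((e₁ a').1 (𝓜.smooth ⊤ (c (l a)))) = _
      have h3 : (chartDeriv x hU (b a') ((c (l a)).res le_top)).res (inf_le_right.trans hV₂) =
          (algebraMap ℝ (Smooth I V) (if a' = a then 1 else 0)) := by
        ext ⟨z, hz⟩
        refine (chartDeriv_of_eq hU (b a') _ (l a) (hV₁ hz.1) 0 ?_).trans ?_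
        · filter_upwards [V₁.isOpen.mem_nhds hz.1] with z' hz'
          rw [Smooth.extend_of_mem _ (hV₁ hz'), add_zero]
          exact hc _ _ hz'
        · change b.coord a (b a') = if a' = a then 1 else 0
          rw [Module.Basis.coord_apply, b.repr_self_apply]
      rw [hVs, he₁, Finset.sum_eq_single a', Pi.single_eq_same, map_one, one_mul, 𝓜.res_smooth]
      · refine (congrArg (𝓜.smooth V) h3).trans ?_
        rw [AlgHom.commutes]
        by_cases h : a' = a
        · simp [h]
        · rw [if_neg h, if_neg fun h' => h (Sum.inl_injective h'), map_zero]
      · intro a'' _ hne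
        rw [Pi.single_eq_of_ne hne, map_zero, zero_mul]
      · simp
    · change 𝓜.res _ ((e₂ j').1 (𝓜.smooth ⊤ (c (l a)))) = _
      rw [hVs, he₂, if_neg (by simp)]
      simp
    · change 𝓜.res _ ((e₁ a').1 (F j)) = _
      rw [he₁' a' j (F j) (hF j) V inf_le_right (hVF j), if_neg (by simp)]
      simp
    · change 𝓜.res _ ((e₂ j').1 (F j)) = _
      rw [he₂' j' j (F j) (hF j) V inf_le_right (hVF j)]
      by_cases h : j' = j
      · subst h; simp
      · rw [Pi.single_eq_of_ne (Ne.symm h), if_neg fun h' => h (Sum.inr_injective h'), map_zero]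
  refine ⟨ι, inferInstance, d, f, fun i => lmulVF ρ' (e i) (zero_add _), ρ', V', hxV',
    res_smooth_eq_one _ (fun y hy => h1 y hy), fun k Y g => ?_⟩
  -- By duality `Z` kills all coordinates over `V`, so it vanishes there; the factor `ρ` makes the
  -- resulting expansion of `Y` hold globally. One factor `ρ` is absorbed into the frame fields.
  let Z : VF (𝓜.grading ⊤) k := Y - ∑ i, lmulVF (⟨Y.1 (f i).1, memVF Y (f i).2 rfl⟩ :
    𝓜.grading ⊤ (d i + k)) (e i) (by ring)
  have hZ : ∀ g, Z.1 g = Y.1 g - ∑ i, Y.1 (f i).1 * (e i).1 g := by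
    intro g
    simp only [Z, Submodule.coe_sub, LinearMap.sub_apply, Submodule.coe_sum,
      LinearMap.sum_apply, lmulVF_apply]
  have hZf : ∀ i, 𝓜.res (le_top : V ≤ ⊤) (Z.1 (f i).1) = 0 := by
    intro i
    rw [hZ, map_sub, map_sum, Finset.sum_eq_single i, map_mul, hef, if_pos rfl, mul_one, sub_self]
    · intro i' _ hne
      rw [map_mul, hef, if_neg hne, mul_zero]
    · simp
  have hZ0 : ∀ j, ∀ g ∈ 𝓜.grading ⊤ j, 𝓜.res (le_top : V ≤ ⊤) (Z.1 g) = 0 := by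
    intro j g hg
    refine h.res_VF_eq_zero hU (inf_le_left.trans hV₁) Z (fun L => ?_) (fun j => ?_) hg
    · refine ⟨∑ a, L (b a) • c (l a), fun y hy => ?_, ?_⟩
      · rw [Smooth.sum_apply]
        change ∑ a, L (b a) * c (l a) ⟨y, trivial⟩ = _
        conv_rhs => rw [← b.sum_repr (extChartAt I x y), map_sum]
        refine Finset.sum_congr rfl fun a _ => ?_
        rw [hc _ _ hy.1, map_smul, smul_eq_mul, mul_comm]
        rfl
      · rw [map_sum, map_sum, map_sum]
        refine Finset.sum_eq_zero fun a _ => ?_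
        rw [map_smul, map_smul, map_smul]
        exact (congrArg _ (hZf (Sum.inl a))).trans (smul_zero _)
    · refine ⟨F j, hF j, ?_, hZf (Sum.inr j)⟩
      rw [← 𝓜.res_res (inf_le_left : V ≤ V₁) le_top, hFξ, 𝓜.res_res]
  suffices hs : (ρ' : 𝓜.O ⊤) * Z.1 g = 0 by
    rw [hZ, mul_sub, sub_eq_zero, Finset.mul_sum] at hs
    rw [hs]
    refine Finset.sum_congr rfl fun i _ => ?_
    rw [lmulVF_apply, ← mul_assoc, ← mul_assoc, mul_comm_of_degree_zero ρ'.2]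
  induction g using graded_induction (𝓜.grading ⊤) with
  | hom j g hg =>
    refine eq_zero_of_local (smooth_mul_mem ρ (memVF Z hg rfl)) fun y _ => ?_
    rcases hK y with hy | hy
    · exact ⟨V, le_top, hy, by rw [map_mul, hZ0 j g hg, mul_zero]⟩
    · exact ⟨K, le_top, hy, by rw [map_mul, res_smooth_eq_zero _ (fun y hy => h0 y hy), zero_mul]⟩
  | add g g' h h' => rw [map_add, mul_add, h, h', add_zero]

end GlobalFrames

end NManifold

end NGeom

namespace NGeom

namespace NManifold

/-! ### Functions and vector fields on `𝓜 × ℝ`, slice by slice -/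

section ProductWithLine

universe u v

variable {E : Type*} [NormedAddCommGroup E] [NormedSpace ℝ E] {H : Type*} [TopologicalSpace H]
  {I : ModelWithCorners ℝ E H} {M : Type v} [TopologicalSpace M] [ChartedSpace H M]
  {𝓜 : NManifold.{u} I M}

/-- Pullbacks of graded coordinates are graded coordinates. -/
theorem IsCoord.prod {U : Opens M} {ξ : Fin 𝓜.rank → 𝓜.O U} (h : 𝓜.IsCoord U ξ) :
    𝓜.prodReal.IsCoord (cylinder U) fun j =>
      (𝓜.pull (slice_cylinder_le U) (ξ j) : 𝓜.prodO (cylinder U)) := by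
  obtain ⟨hξ, hU⟩ := h
  refine ⟨fun j => pull_mem _ (hξ j), fun V hV k f hf => ?_⟩
  have hVU : ∀ t, slice V t ≤ U := fun t x hx => hV hx
  replace hU := fun (V : Opens M) (hV : V ≤ U) => hU V hV k
  simp only [finsum_eq_sum_of_fintype] at hU ⊢
  change ∃! c : Exponent 𝓜.deg k → Smooth (I.prod 𝓘(ℝ, ℝ)) V,
    f = ∑ e, 𝓜.prodSmooth V (c e) *
      𝓜.prodRes hV (monomial (fun j => 𝓜.pull (slice_cylinder_le U) (ξ j)) e.1)
  replace hf : f ∈ 𝓜.prodGrading V k := hf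
  have hev : ∀ (t : ℝ) (c : Exponent 𝓜.deg k → Smooth (I.prod 𝓘(ℝ, ℝ)) V),
      𝓜.ev t (∑ e, 𝓜.prodSmooth V (c e) *
        𝓜.prodRes hV (monomial (fun j => 𝓜.pull (slice_cylinder_le U) (ξ j)) e.1)) =
      ∑ e, 𝓜.smooth (slice V t) (sliceFun t (c e)) * 𝓜.res (hVU t) (monomial ξ e.1) := by
    intro t c
    rw [map_sum]
    refine Finset.sum_congr rfl fun e _ => ?_
    rw [map_mul]
    congr 1
    have h1 := map_monomial ((𝓜.ev t).comp (𝓜.prodRes hV)).toMonoidHom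
      (fun j => 𝓜.pull (slice_cylinder_le U) (ξ j)) e.1
    have h2 := map_monomial (𝓜.res (hVU t)).toMonoidHom ξ e.1
    refine h1.trans (Eq.trans ?_ h2.symm)
    congr 1
    funext j
    exact 𝓜.res_res _ _ _
  choose c hc hc' using fun t => hU (slice V t) (hVU t) (f.1 t) (hf.1 t)
  have hsm : ∀ e, ∃ G : Smooth (I.prod 𝓘(ℝ, ℝ)) V, ∀ t, sliceFun t G = c t e := by
    intro e
    refine exists_smooth_of_local (fun t => c t e) fun q hq => ?_
    obtain ⟨V', hV', U', hU', m, g, a, hq', ha, h⟩ := hf.2 q hq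
    have hVU' : ∀ t, slice V' t ≤ U ⊓ U' := fun t x hx => ⟨hV (hV' hx), hU' t hx⟩
    choose b hb _ using fun i => hU (U ⊓ U') inf_le_left (𝓜.res inf_le_right (a i))
      (𝓜.res_mem _ (ha i))
    refine ⟨V', hV', ∑ i, g i * (b i e).pull hVU', hq', fun t => ?_⟩
    -- Near `q` the section is a sum of terms `g i · a i`. Expanding each `a i` in the coordinates
    -- of `𝓜` and using uniqueness on slices exhibits the coefficients as jointly smooth functions.
    have key : (fun e => (c t e).res (slice_mono hV' t)) =
        fun e => sliceFun t (∑ i, g i * (b i e).pull hVU') := by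
      refine (hU (slice V' t) ((slice_mono hV' t).trans (hVU t))
        (𝓜.res (slice_mono hV' t) (f.1 t)) (𝓜.res_mem _ (hf.1 t))).unique ?_ ?_
      · change _ = ∑ e, 𝓜.smooth _ ((c t e).res _) * _
        have h1 := congrArg (𝓜.res (slice_mono hV' t)) (hc t)
        simp only [map_sum, map_mul, 𝓜.res_res, 𝓜.res_smooth] at h1
        exact h1
      · change _ = ∑ e, 𝓜.smooth _ (sliceFun t (∑ i, g i * (b i e).pull hVU')) * _
        simp only [map_sum, map_mul, Finset.sum_mul]
        refine (h t).trans ?_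
        rw [Finset.sum_comm]
        refine Finset.sum_congr rfl fun i _ => ?_
        have h2 := congrArg (𝓜.res (hVU' t)) (hb i)
        simp only [map_sum, map_mul, 𝓜.res_res, 𝓜.res_smooth] at h2
        rw [h2, Finset.mul_sum]
        refine Finset.sum_congr rfl fun e _ => ?_
        rw [← mul_assoc]
        rfl
    exact congrFun key e
  choose C hC using hsm
  refine ⟨C, Subtype.ext (funext fun t => ?_), fun C' hC' => ?_⟩
  · refine Eq.trans ?_ (hev t C).symm
    simp only [hC]
    exact hc t
  · funext e
    have h1 : ∀ t, sliceFun t (C' e) = sliceFun t (C e) := by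
      intro t
      rw [hC]
      refine congrFun (hc' t (fun e => sliceFun t (C' e)) ?_) e
      change 𝓜.ev t f = _
      rw [hC', hev]
    ext q
    exact DFunLike.congr_fun (h1 q.1.2) ⟨q.1.1, q.2⟩

theorem res_evalAt (W : Opens (M × ℝ)) (t : ℝ) (s : 𝓜.prodReal.O ⊤) :
    𝓜.res (le_top : slice W t ≤ ⊤) (𝓜.evalAt t s) =
      𝓜.ev t (𝓜.prodReal.res (le_top : W ≤ ⊤) s : 𝓜.prodO W) :=
  𝓜.res_res _ _ _

theorem prod_res_eq_iff {W : Opens (M × ℝ)} {s s' : 𝓜.prodReal.O ⊤} :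
    𝓜.prodReal.res (le_top : W ≤ ⊤) s = 𝓜.prodReal.res (le_top : W ≤ ⊤) s' ↔
      ∀ t, 𝓜.res (le_top : slice W t ≤ ⊤) (𝓜.evalAt t s) =
        𝓜.res (le_top : slice W t ≤ ⊤) (𝓜.evalAt t s') := by
  simp only [res_evalAt]
  exact ⟨fun h t => by rw [h], fun h => Subtype.ext (funext h)⟩

theorem prod_res_eq_zero_iff {W : Opens (M × ℝ)} {s : 𝓜.prodReal.O ⊤} :
    𝓜.prodReal.res (le_top : W ≤ ⊤) s = 0 ↔
      ∀ t, 𝓜.res (le_top : slice W t ≤ ⊤) (𝓜.evalAt t s) = 0 := by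
  simpa only [map_zero] using prod_res_eq_iff (W := W) (s := s) (s' := 0)

theorem prod_ext {s s' : 𝓜.prodReal.O ⊤} (h : ∀ t, 𝓜.evalAt t s = 𝓜.evalAt t s') : s = s' := by
  rw [← 𝓜.prodReal.res_self s, ← 𝓜.prodReal.res_self s']
  exact prod_res_eq_iff.2 fun t => by rw [h]

/-- A family of functions that is locally on `M` given by functions on `𝓜 × ℝ` is a function on
`𝓜 × ℝ`. -/
theorem exists_evalAt_eq {k : ℤ} (u : ℝ → 𝓜.O ⊤) (hu : ∀ t, u t ∈ 𝓜.grading ⊤ k)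
    (h : ∀ x : M, ∃ V : Opens M, x ∈ V ∧ ∃ s ∈ 𝓜.prodReal.grading ⊤ k, ∀ t,
      𝓜.res (le_top : V ≤ ⊤) (u t) = 𝓜.res le_top (𝓜.evalAt t s)) :
    ∃ s ∈ 𝓜.prodReal.grading ⊤ k, ∀ t, 𝓜.evalAt t s = u t := by
  choose V hxV s hs hsu using h
  -- The local models are valid for all `t`, so they are glued over cylinders.
  obtain ⟨S, ⟨hS, hS'⟩, -⟩ := 𝓜.prodReal.glue ⊤ (fun x : M × ℝ => cylinder (V x.1))
    (fun _ => le_top) (fun x _ => ⟨x, hxV x.1⟩) k (fun x => 𝓜.prodReal.res le_top (s x.1))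
    (fun x => 𝓜.prodReal.res_mem _ (hs _)) (fun x y W hx hy => by
      rw [𝓜.prodReal.res_res, 𝓜.prodReal.res_res]
      refine prod_res_eq_iff.2 fun t => ?_
      have h1 : slice W t ≤ V x.1 := slice_mono hx t
      have h2 : slice W t ≤ V y.1 := slice_mono hy t
      rw [← 𝓜.res_res h1 le_top, ← hsu, ← 𝓜.res_res h2 le_top (𝓜.evalAt t (s y.1)), ← hsu,
        𝓜.res_res, 𝓜.res_res])
  refine ⟨S, hS, fun t => eq_of_cover V (fun _ => le_top) (fun x _ => ⟨x, hxV x⟩)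
    (evalAt_mem t hS) (hu t) fun x => ?_⟩
  rw [hsu]
  exact prod_res_eq_iff.1 (hS' (x, t)) t

theorem evalAt_smooth (t : ℝ) (g : Smooth (I.prod 𝓘(ℝ, ℝ)) (⊤ : Opens (M × ℝ))) :
    𝓜.evalAt t (𝓜.prodReal.smooth ⊤ g) =
      𝓜.smooth ⊤ (Smooth.res (show (⊤ : Opens M) ≤ slice ⊤ t from fun _ _ => trivial)
        (sliceFun t g)) :=
  𝓜.res_smooth _ _

theorem evalAt_funOfT (t : ℝ) (g : ℝ → ℝ) (hg : ContDiff ℝ ∞ g) :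
    𝓜.evalAt t (𝓜.funOfT g hg) = algebraMap ℝ (𝓜.O ⊤) (g t) := by
  refine (evalAt_smooth t _).trans ?_
  rw [← AlgHom.commutes (𝓜.smooth ⊤)]
  rfl

theorem proj_smooth (c : Smooth I (⊤ : Opens M)) : 𝓜.proj (𝓜.smooth ⊤ c) =
    𝓜.prodReal.smooth ⊤ (c.pull (W := ⊤) fun _ => le_top) :=
  prod_ext fun t => by
    rw [evalAt_proj, evalAt_smooth]; rfl

theorem projVF_apply {k : ℤ} (X : VF (𝓜.prodReal.grading ⊤) k) (t : ℝ) (f : 𝓜.O ⊤) :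
    (projVF X t).1 f = 𝓜.evalAt t (X.1 (𝓜.proj f)) := rfl

variable [FiniteDimensional ℝ E] [T2Space M] [IsManifold I ∞ M] [I.Boundaryless]

theorem mem_prod_chart_source {x : M} {t : ℝ} {U : Opens M}
    (hU : ∀ y ∈ U, y ∈ (chartAt H x).source) :
    ∀ q ∈ cylinder U, q ∈ (chartAt (ModelProd H ℝ) (x, t)).source := fun q hq => by
  rw [prodChartedSpace_chartAt, OpenPartialHomeomorph.prod_source]
  exact ⟨hU q.1 hq, by rw [chartAt_self_eq]; trivial⟩

theorem prod_extChartAt_apply (x : M) (t : ℝ) (q : M × ℝ) :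
    extChartAt (I.prod 𝓘(ℝ, ℝ)) (x, t) q = (extChartAt I x q.1, q.2) := by
  rw [extChartAt_prod]; simp [chartAt_self_eq]

/-- A vector field on `𝓜 × ℝ` that kills pullbacks and `t` over an open set vanishes there. -/
theorem exists_prod_res_VF_eq_zero (p : M × ℝ) : ∃ V : Opens (M × ℝ), p ∈ V ∧
    ∀ W ≤ V, ∀ (k : ℤ) (Z : VF (𝓜.prodReal.grading ⊤) k),
      (∀ j, ∀ f ∈ 𝓜.grading ⊤ j, 𝓜.prodReal.res (le_top : W ≤ ⊤) (Z.1 (𝓜.proj f)) = 0) →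
      𝓜.prodReal.res (le_top : W ≤ ⊤) (Z.1 𝓜.coordT) = 0 →
      ∀ j, ∀ s ∈ 𝓜.prodReal.grading ⊤ j, 𝓜.prodReal.res (le_top : W ≤ ⊤) (Z.1 s) = 0 := by
  obtain ⟨x, t₀⟩ := p
  obtain ⟨U, ξ, hxU, hU, h⟩ := 𝓜.exists_isCoord x
  obtain ⟨V, hV, c, F, hxV, hc, hF, hFξ⟩ := h.exists_global hU hxU
  have hVU : cylinder V ≤ cylinder U := fun q hq => hV hq
  refine ⟨cylinder V, hxV, fun W hW k Z hZ hZt j s hs => ?_⟩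
  refine h.prod.res_VF_eq_zero (mem_prod_chart_source (t := t₀) hU) (hW.trans hVU) Z (fun l => ?_)
    (fun i => ?_) hs
  -- A linear form on `E × ℝ` splits into a form on `E`, whose coordinate function is a pullback,
  -- and a multiple of `t`.
  · let l₁ : E →L[ℝ] ℝ := l.comp (ContinuousLinearMap.inl ℝ E ℝ)
    let T : Smooth (I.prod 𝓘(ℝ, ℝ)) (⊤ : Opens (M × ℝ)) :=
      ⟨fun p => p.1.2, contMDiff_snd.comp contMDiff_subtype_val⟩
    refine ⟨(c l₁).pull (W := ⊤) (fun _ => le_top) + l (0, 1) • T, fun q hq => ?_, ?_⟩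
    · change c l₁ ⟨q.1, trivial⟩ + l (0, 1) * q.2 = _
      rw [hc l₁ q.1 (hW hq), prod_extChartAt_apply]
      have : (extChartAt I x q.1, q.2) =
          ContinuousLinearMap.inl ℝ E ℝ (extChartAt I x q.1) + q.2 • ((0, 1) : E × ℝ) := by simp
      rw [this, map_add, map_smul, smul_eq_mul, mul_comm q.2]
      rfl
    · rw [map_add, ← proj_smooth, map_smul, map_add, map_smul, map_add, map_smul,
        hZ 0 _ (smooth_mem _ _), zero_add]
      exact (congrArg _ hZt).trans (smul_zero _)
  · refine ⟨𝓜.proj (F i), proj_mem (hF i), Subtype.ext (funext fun t => ?_), hZ _ _ (hF i)⟩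
    have h1 : slice W t ≤ V := fun y hy => hW hy
    have h2 := congrArg (𝓜.res h1) (hFξ i)
    rw [𝓜.res_res, 𝓜.res_res] at h2
    exact (𝓜.res_res _ _ _).trans (h2.trans (𝓜.res_res _ _ _).symm)

/-- The uniqueness half of describing a vector field on the product by its slicewise projections and
its value on `t`; identities between such fields are checked in these two components. -/
theorem prod_VF_ext {k : ℤ} {X Y : VF (𝓜.prodReal.grading ⊤) k}
    (h : ∀ t, projVF X t = projVF Y t) (ht : X.1 𝓜.coordT = Y.1 𝓜.coordT) : X = Y := by
  rw [← sub_eq_zero]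
  refine VF.ext_of_graded fun j s hs => eq_zero_of_local (memVF _ hs rfl) fun p _ => ?_
  obtain ⟨V, hpV, hV⟩ := exists_prod_res_VF_eq_zero (𝓜 := 𝓜) p
  refine ⟨V, le_top, hpV, hV V le_rfl k (X - Y) (fun j f hf => ?_) ?_ j s hs⟩
  · have h1 : X.1 (𝓜.proj f) = Y.1 (𝓜.proj f) := prod_ext fun t =>
      congrArg (fun Z : VF (𝓜.grading ⊤) k => Z.1 f) (h t)
    rw [Submodule.coe_sub, LinearMap.sub_apply, h1, sub_self, map_zero]
  · rw [Submodule.coe_sub, LinearMap.sub_apply, ht, sub_self, map_zero]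

/-- Near `p` a field is prescribed by its values on product coordinates: the functions interpolating
`Y t` on the coordinates of `𝓜`, and `h` on `t`. On each slice it agrees with `Y t` because both
take the same values on coordinates. -/
theorem exists_prod_local_VF {k : ℤ} (Y : ℝ → VF (𝓜.grading ⊤) k)
    (hY : ∀ j, ∀ f ∈ 𝓜.grading ⊤ j, ∃ s ∈ 𝓜.prodReal.grading ⊤ (j + k),
      ∀ t, 𝓜.evalAt t s = (Y t).1 f) (h : 𝓜.prodReal.grading ⊤ k) (p : M × ℝ) :
    ∃ (V : Opens (M × ℝ)) (X : VF (𝓜.prodReal.grading ⊤) k), p ∈ V ∧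
      (∀ t, ∀ j, ∀ f ∈ 𝓜.grading ⊤ j, 𝓜.res (le_top : slice V t ≤ ⊤) ((projVF X t).1 f) =
        𝓜.res le_top ((Y t).1 f)) ∧
      𝓜.prodReal.res (le_top : V ≤ ⊤) (X.1 𝓜.coordT) = 𝓜.prodReal.res le_top (h : 𝓜.prodReal.O ⊤) := by
  classical
  obtain ⟨x, t₀⟩ := p
  obtain ⟨U, ξ, hxU, hU, hξ⟩ := 𝓜.exists_isCoord x
  obtain ⟨V, hV, c, F, hxV, hc, hF, hFξ⟩ := hξ.exists_global hU hxU
  let b := Module.finBasis ℝ E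
  let l : Fin (Module.finrank ℝ E) → E →L[ℝ] ℝ := fun a => (b.coord a).toContinuousLinearMap
  obtain ⟨V', hV', hpV', hX⟩ := hξ.prod.exists_global_VF (mem_prod_chart_source (t := t₀) hU) hxU
    (Sum.elim (fun a => (b a, 0)) (fun _ : Unit => (0, 1)))
  choose w hw hwY using fun a => hY 0 (𝓜.smooth ⊤ (c (l a))) (smooth_mem _ _)
  choose y hy hyY using fun j => hY _ (F j) (hF j)
  obtain ⟨X, hXs, hXξ⟩ := hX k (Sum.elim w fun _ => h) (by
    rintro (a | a)
    · exact mem_degree (hw a) (zero_add k)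
    · exact h.2) y hy
  let W := V' ⊓ cylinder V
  -- A function that is linear in the product chart has constant chart derivatives; with the basis
  -- of `E` and `(0, 1)` this picks out one prescribed value for each coordinate.
  have hder : ∀ (a : Fin (Module.finrank ℝ E) ⊕ Unit)
      (g : Smooth (I.prod 𝓘(ℝ, ℝ)) (⊤ : Opens (M × ℝ))) (L : E × ℝ →L[ℝ] ℝ),
      (∀ q ∈ W, g ⟨q, trivial⟩ = L (extChartAt I x q.1, q.2)) →
      𝓜.prodReal.res (inf_le_left : W ≤ V') (𝓜.prodReal.smooth V' ((chartDeriv (x, t₀)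
        (mem_prod_chart_source (t := t₀) hU) (Sum.elim (fun a => (b a, 0))
        (fun _ : Unit => (0, 1)) a) (g.res le_top)).res hV')) =
      algebraMap ℝ _ (L (Sum.elim (fun a => (b a, 0)) (fun _ : Unit => (0, 1)) a)) := by
    intro a g L hL
    rw [𝓜.prodReal.res_smooth, ← AlgHom.commutes (𝓜.prodReal.smooth W)]
    congr 1
    ext ⟨q, hq⟩
    refine (chartDeriv_of_eq (mem_prod_chart_source (t := t₀) hU) _ _ L (hV' hq.1) 0 ?_)
    filter_upwards [W.isOpen.mem_nhds hq] with z hz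
    rw [Smooth.extend_of_mem _ (hV' hz.1), add_zero, prod_extChartAt_apply]
    exact hL z hz
  have hWV : ∀ t, slice W t ≤ V := fun t y hy => hy.2
  have hres : ∀ z : 𝓜.prodReal.O ⊤, 𝓜.prodReal.res (le_top : W ≤ ⊤) z =
      𝓜.prodReal.res (inf_le_left : W ≤ V') (𝓜.prodReal.res le_top z) :=
    fun z => (𝓜.prodReal.res_res _ _ _).symm
  have hXc : ∀ a, 𝓜.prodReal.res (le_top : W ≤ ⊤) (X.1 (𝓜.proj (𝓜.smooth ⊤ (c (l a))))) =
      𝓜.prodReal.res le_top (w a) := by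
    intro a
    have hL := fun a' => hder a' ((c (l a)).pull (W := ⊤) fun _ => le_top)
      ((l a).comp (ContinuousLinearMap.fst ℝ E ℝ)) fun q hq => hc (l a) q.1 hq.2
    rw [proj_smooth, hres, hXs, map_sum, Fintype.sum_sum_type, Finset.sum_eq_single a]
    · simp only [map_mul, hL, 𝓜.prodReal.res_res]
      simp [l]
    · intro a' _ hne
      simp only [map_mul, hL, 𝓜.prodReal.res_res]
      simp [l, hne.symm]
    · simp
  refine ⟨W, X, ⟨hpV', hxV⟩, fun t j f hf => ?_, ?_⟩
  · rw [← sub_eq_zero, ← map_sub]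
    refine hξ.res_VF_eq_zero hU ((hWV t).trans hV) (projVF X t - Y t) (fun L => ?_) (fun i => ?_) hf
    · refine ⟨∑ a, L (b a) • c (l a), fun y hy => ?_, ?_⟩
      · rw [Smooth.sum_apply]
        change ∑ a, L (b a) * c (l a) ⟨y, trivial⟩ = _
        conv_rhs => rw [← b.sum_repr (extChartAt I x y), map_sum]
        refine Finset.sum_congr rfl fun a _ => ?_
        rw [hc (l a) y (hWV t hy), map_smul, smul_eq_mul, mul_comm]
        rfl
      · rw [map_sum, map_sum, map_sum]
        refine Finset.sum_eq_zero fun a _ => ?_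
        have h1 := prod_res_eq_iff.1 (hXc a) t
        rw [hwY, ← projVF_apply] at h1
        rw [map_smul, map_smul, map_smul, Submodule.coe_sub, LinearMap.sub_apply, map_sub, h1,
          sub_self, smul_zero]
    · refine ⟨F i, hF i, ?_, ?_⟩
      · rw [← 𝓜.res_res (hWV t) le_top, hFξ, 𝓜.res_res]
      · have h1 := hXξ i (𝓜.proj (F i)) (proj_mem (hF i)) W inf_le_left
          (Subtype.ext (funext fun t => by
            have h2 := congrArg (𝓜.res (hWV t)) (hFξ i)
            rw [𝓜.res_res, 𝓜.res_res] at h2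
            exact (𝓜.res_res _ _ _).trans (h2.trans (𝓜.res_res _ _ _).symm)))
        have h2 := prod_res_eq_iff.1 h1 t
        rw [hyY, ← projVF_apply] at h2
        rw [Submodule.coe_sub, LinearMap.sub_apply, map_sub, h2, sub_self]
  · have hL := fun a' => hder a' ⟨fun p => p.1.2, contMDiff_snd.comp contMDiff_subtype_val⟩
      (ContinuousLinearMap.snd ℝ E ℝ) fun q hq => rfl
    have h1 : 𝓜.prodReal.res (le_top : W ≤ ⊤) (X.1 𝓜.coordT) = _ :=
      (hres _).trans (congrArg _ (hXs ⟨fun p => p.1.2, contMDiff_snd.comp contMDiff_subtype_val⟩))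
    rw [h1, map_sum, Fintype.sum_sum_type]
    simp only [map_mul, hL, 𝓜.prodReal.res_res]
    simp

/-- Vector fields on `𝓜 × ℝ` from families of vector fields on `𝓜` and functions. -/
theorem exists_prod_VF {k : ℤ} (Y : ℝ → VF (𝓜.grading ⊤) k)
    (hY : ∀ j, ∀ f ∈ 𝓜.grading ⊤ j, ∃ s ∈ 𝓜.prodReal.grading ⊤ (j + k),
      ∀ t, 𝓜.evalAt t s = (Y t).1 f) (h : 𝓜.prodReal.grading ⊤ k) :
    ∃ X : VF (𝓜.prodReal.grading ⊤) k, (∀ t, projVF X t = Y t) ∧ X.1 𝓜.coordT = h := by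
  choose V X hpV hXY hXt using exists_prod_local_VF Y hY h
  choose V' hpV' hV' using exists_prod_res_VF_eq_zero (𝓜 := 𝓜)
  have hle : ∀ p, V p ⊓ V' p ≤ V p := fun p => inf_le_left
  -- The local fields agree on overlaps since there they have equal values on pullbacks and on `t`.
  obtain ⟨Z, hZ⟩ := exists_VF_of_local (𝓜 := 𝓜.prodReal) (fun p => V p ⊓ V' p)
    (fun p => ⟨p, hpV p, hpV' p⟩) (k := k)
    (fun p => (𝓜.prodReal.res (le_top : V p ⊓ V' p ≤ ⊤)).toLinearMap ∘ₗ (X p).1)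
    (fun p j f hf => 𝓜.prodReal.res_mem (le_top : V p ⊓ V' p ≤ ⊤) (memVF (X p) hf rfl))
    (fun p j l f hf g hg => by
      simp only [LinearMap.comp_apply, AlgHom.toLinearMap_apply, leibnizVF (X p) hf, map_add,
        map_smul, map_mul])
    (fun p q j f hf W hp hq => by
      simp only [LinearMap.comp_apply, AlgHom.toLinearMap_apply, 𝓜.prodReal.res_res]
      rw [← sub_eq_zero, ← map_sub]
      refine hV' p W (hp.trans inf_le_right) k (X p - X q) (fun i g hg => ?_) ?_ j f hf
      · refine prod_res_eq_zero_iff.2 fun t => ?_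
        have h1 : slice W t ≤ slice (V p) t := slice_mono (hp.trans inf_le_left) t
        have h2 : slice W t ≤ slice (V q) t := slice_mono (hq.trans inf_le_left) t
        have h3 := congrArg (𝓜.res h1) (hXY p t i g hg)
        have h4 := congrArg (𝓜.res h2) (hXY q t i g hg)
        rw [𝓜.res_res, 𝓜.res_res, projVF_apply] at h3 h4
        rw [Submodule.coe_sub, LinearMap.sub_apply, map_sub, map_sub, h3, h4, sub_self]
      · have h3 := congrArg (𝓜.prodReal.res (hp.trans inf_le_left)) (hXt p)
        have h4 := congrArg (𝓜.prodReal.res (hq.trans inf_le_left)) (hXt q)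
        rw [𝓜.prodReal.res_res, 𝓜.prodReal.res_res] at h3 h4
        rw [Submodule.coe_sub, LinearMap.sub_apply, map_sub, h3, h4, sub_self])
  refine ⟨Z, fun t => VF.ext_of_graded fun j f hf => ?_, ?_⟩
  · refine eq_of_local (memVF (projVF Z t) hf rfl) (memVF (Y t) hf rfl) fun y _ => ?_
    refine ⟨slice (V (y, t) ⊓ V' (y, t)) t, le_top, ⟨hpV _, hpV' _⟩, ?_⟩
    have h1 : slice (V (y, t) ⊓ V' (y, t)) t ≤ slice (V (y, t)) t := slice_mono inf_le_left t
    have h2 := prod_res_eq_iff.1 (hZ (y, t) j (𝓜.proj f) (proj_mem hf)) t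
    have h3 := congrArg (𝓜.res h1) (hXY (y, t) t j f hf)
    rw [𝓜.res_res, 𝓜.res_res, projVF_apply] at h3
    rw [projVF_apply, h2, h3]
  · refine eq_of_local (𝓜 := 𝓜.prodReal) (memVF Z 𝓜.coordT.2 (zero_add k)) h.2 fun p _ => ?_
    refine ⟨V p ⊓ V' p, le_top, ⟨hpV p, hpV' p⟩, ?_⟩
    have h3 := congrArg (𝓜.prodReal.res (hle p)) (hXt p)
    rw [𝓜.prodReal.res_res, 𝓜.prodReal.res_res] at h3
    exact (hZ p 0 _ 𝓜.coordT.2).trans h3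

end ProductWithLine

end NManifold

end NGeom

namespace NGeom

namespace NManifold

/-! ### Lifts, pullbacks and contractions of the symplectization -/

section FormsOnProduct

universe u v

variable {E : Type*} [NormedAddCommGroup E] [NormedSpace ℝ E] {H : Type*} [TopologicalSpace H]
  {I : ModelWithCorners ℝ E H} {M : Type v} [TopologicalSpace M] [ChartedSpace H M]
  {𝓜 : NManifold.{u} I M}

theorem projVF_lmulVF {j k m : ℤ} (f : 𝓜.prodReal.grading ⊤ j)
    (X : VF (𝓜.prodReal.grading ⊤) k) (h : j + k = m) (t : ℝ) :
    projVF (lmulVF f X h) t = lmulVF ⟨𝓜.evalAt t f, evalAt_mem t f.2⟩ (projVF X t) h :=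
  VF.ext_of_graded fun j g _ => by
    simp only [projVF_apply, lmulVF_apply, map_mul]

theorem projVF_add {k : ℤ} (X Y : VF (𝓜.prodReal.grading ⊤) k) (t : ℝ) :
    projVF (X + Y) t = projVF X t + projVF Y t :=
  VF.ext_of_graded fun j g _ => by
    simp only [projVF_apply, Submodule.coe_add, LinearMap.add_apply, map_add]

theorem projVF_smul {k : ℤ} (c : ℝ) (X : VF (𝓜.prodReal.grading ⊤) k) (t : ℝ) :
    projVF (c • X) t = c • projVF X t :=
  VF.ext_of_graded fun j g _ => by
    simp only [projVF_apply, SetLike.val_smul, LinearMap.smul_apply, map_smul]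

theorem projVF_sum {k : ℤ} {ι : Type*} (s : Finset ι) (X : ι → VF (𝓜.prodReal.grading ⊤) k)
    (t : ℝ) : projVF (∑ i ∈ s, X i) t = ∑ i ∈ s, projVF (X i) t :=
  VF.ext_of_graded fun j g _ => by
    simp only [projVF_apply, AddSubmonoidClass.coe_finsetSum, LinearMap.sum_apply, map_sum]

theorem isLift_iff {k : ℤ} {X : VF (𝓜.grading ⊤) k} {Y : VF (𝓜.prodReal.grading ⊤) k} :
    IsLift X Y ↔ (∀ t, projVF Y t = X) ∧ Y.1 𝓜.coordT = 0 := by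
  refine and_congr_left fun _ => ⟨fun h t => VF.ext_of_graded fun j f _ => ?_,
    fun h f => prod_ext fun t => ?_⟩
  · rw [projVF_apply, h, evalAt_proj]
  · rw [← projVF_apply, h, evalAt_proj]

theorem isPartialT_iff {T : VF (𝓜.prodReal.grading ⊤) 0} :
    𝓜.IsPartialT T ↔ (∀ t, projVF T t = 0) ∧ T.1 𝓜.coordT = 1 := by
  refine and_congr_left fun _ => ⟨fun h t => VF.ext_of_graded fun j f _ => ?_,
    fun h f => prod_ext fun t => ?_⟩
  · rw [projVF_apply, h, map_zero]; rfl
  · rw [← projVF_apply, h, map_zero]; rfl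

/-- A vector field acts on functions of `t` by the chain rule. -/
theorem map_expT {k : ℤ} (X : VF (𝓜.prodReal.grading ⊤) k) :
    X.1 𝓜.expT = X.1 𝓜.coordT * 𝓜.expT := by
  refine prod_ext fun t₀ => ?_
  -- Hadamard at `t₀` gives `e^t = e^{t₀} + (t - t₀) g(t)` with `g(t₀) = e^{t₀}`. After applying `X`
  -- and restricting to the slice at `t₀` only `X(t) g(t₀)` survives.
  obtain ⟨g, hg, hg', hg₀⟩ := exists_hadamard (Module.Basis.singleton Unit ℝ) Real.contDiff_exp t₀
  have h1 : (𝓜.expT : 𝓜.prodReal.O ⊤) = algebraMap ℝ _ (Real.exp t₀) +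
      (𝓜.coordT - algebraMap ℝ _ t₀) * 𝓜.funOfT (g ()) (hg ()) := by
    refine prod_ext fun t => ?_
    rw [map_add, map_mul, map_sub, expT, coordT, evalAt_funOfT, evalAt_funOfT, evalAt_funOfT,
      AlgHom.commutes, AlgHom.commutes, ← map_sub, ← map_mul, ← map_add, hg' t]
    simp
  have hT : 𝓜.coordT - algebraMap ℝ (𝓜.prodReal.O ⊤) t₀ ∈ 𝓜.prodReal.grading ⊤ 0 :=
    sub_mem 𝓜.coordT.2 (SetLike.algebraMap_mem_graded (𝓜.prodReal.grading ⊤) t₀)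
  have hc : ∀ c : ℝ, X.1 (algebraMap ℝ _ c) = 0 := fun c => by
    rw [Algebra.algebraMap_eq_smul_one, map_smul, VF_map_one, smul_zero]
  have hd : g () t₀ = Real.exp t₀ := by
    rw [hg₀, Module.Basis.singleton_apply]
    simp
  rw [h1, map_add, leibnizVF_zero X hT, hc, map_sub, hc, sub_zero, zero_add, map_add, map_mul,
    map_mul, map_sub, ← h1, map_mul, AlgHom.commutes, coordT, expT, evalAt_funOfT, evalAt_funOfT,
    evalAt_funOfT, sub_self, zero_mul, add_zero, hd]

variable [FiniteDimensional ℝ E] [T2Space M] [IsManifold I ∞ M] [I.Boundaryless]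

theorem exists_lift {k : ℤ} (X : VF (𝓜.grading ⊤) k) :
    ∃ Y : VF (𝓜.prodReal.grading ⊤) k, ∀ Z, IsLift X Z ↔ Z = Y := by
  obtain ⟨Y, hY, hYt⟩ := exists_prod_VF (fun _ => X) (fun j f hf => ⟨𝓜.proj (X.1 f),
    proj_mem (memVF X hf rfl), fun t => evalAt_proj t _⟩) 0
  have hY' : IsLift X Y := isLift_iff.2 ⟨hY, hYt⟩
  refine ⟨Y, fun Z => ⟨fun hZ => prod_VF_ext (fun t => ?_) (hZ.2.trans hY'.2.symm), ?_⟩⟩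
  · rw [(isLift_iff.1 hZ).1, hY]
  · rintro rfl; exact hY'

variable (𝓜) in
theorem exists_partialT :
    ∃ T : VF (𝓜.prodReal.grading ⊤) 0, ∀ Z, 𝓜.IsPartialT Z ↔ Z = T := by
  obtain ⟨T, hT, hTt⟩ := exists_prod_VF (𝓜 := 𝓜) (k := 0) (fun _ => 0)
    (fun j f hf => ⟨0, zero_mem _, fun t => map_zero _⟩)
    ⟨1, SetLike.one_mem_graded (𝓜.prodReal.grading ⊤)⟩
  have hT' : 𝓜.IsPartialT T := isPartialT_iff.2 ⟨hT, hTt⟩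
  refine ⟨T, fun Z => ⟨fun hZ => prod_VF_ext (fun t => ?_) (hZ.2.trans hT'.2.symm), ?_⟩⟩
  · rw [(isPartialT_iff.1 hZ).1, hT]
  · rintro rfl; exact hT'

/-- The lift to `𝓜 × ℝ` of a vector field on `𝓜`. -/
noncomputable def liftVF {k : ℤ} (X : VF (𝓜.grading ⊤) k) : VF (𝓜.prodReal.grading ⊤) k :=
  (exists_lift X).choose

variable (𝓜) in
/-- The coordinate vector field `∂_t`. -/
noncomputable def partialT : VF (𝓜.prodReal.grading ⊤) 0 := 𝓜.exists_partialT.choose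

theorem isLift_iff_eq {k : ℤ} {X : VF (𝓜.grading ⊤) k} {Y : VF (𝓜.prodReal.grading ⊤) k} :
    IsLift X Y ↔ Y = liftVF X := (exists_lift X).choose_spec Y

theorem isPartialT_iff_eq {T : VF (𝓜.prodReal.grading ⊤) 0} :
    𝓜.IsPartialT T ↔ T = 𝓜.partialT := 𝓜.exists_partialT.choose_spec T

theorem liftVF_proj {k : ℤ} (X : VF (𝓜.grading ⊤) k) (f : 𝓜.O ⊤) :
    (liftVF X).1 (𝓜.proj f) = 𝓜.proj (X.1 f) := (isLift_iff_eq.2 rfl).1 f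

theorem liftVF_coordT {k : ℤ} (X : VF (𝓜.grading ⊤) k) : (liftVF X).1 𝓜.coordT = 0 :=
  (isLift_iff_eq.2 rfl).2

theorem liftVF_expT {k : ℤ} (X : VF (𝓜.grading ⊤) k) : (liftVF X).1 𝓜.expT = 0 := by
  rw [map_expT, liftVF_coordT, zero_mul]

theorem projVF_liftVF {k : ℤ} (X : VF (𝓜.grading ⊤) k) (t : ℝ) : projVF (liftVF X) t = X :=
  (isLift_iff.1 (isLift_iff_eq.2 rfl)).1 t

theorem partialT_proj (f : 𝓜.O ⊤) : 𝓜.partialT.1 (𝓜.proj f) = 0 := (isPartialT_iff_eq.2 rfl).1 f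

theorem partialT_coordT : 𝓜.partialT.1 𝓜.coordT = 1 := (isPartialT_iff_eq.2 rfl).2

theorem partialT_expT : 𝓜.partialT.1 𝓜.expT = 𝓜.expT := by
  rw [map_expT, partialT_coordT, one_mul]

theorem projVF_partialT (t : ℝ) : projVF 𝓜.partialT t = 0 :=
  (isPartialT_iff.1 (isPartialT_iff_eq.2 rfl)).1 t

theorem liftVF_add {k : ℤ} (X Y : VF (𝓜.grading ⊤) k) :
    liftVF (X + Y) = liftVF X + liftVF Y :=
  (isLift_iff_eq.1 ⟨fun f => by
    simp only [Submodule.coe_add, LinearMap.add_apply, liftVF_proj, map_add], by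
    rw [Submodule.coe_add, LinearMap.add_apply, liftVF_coordT, liftVF_coordT, add_zero]⟩).symm

theorem liftVF_smul {k : ℤ} (c : ℝ) (X : VF (𝓜.grading ⊤) k) :
    liftVF (c • X) = c • liftVF X :=
  (isLift_iff_eq.1 ⟨fun f => by
    simp only [SetLike.val_smul, LinearMap.smul_apply, liftVF_proj, map_smul], by
    rw [SetLike.val_smul, LinearMap.smul_apply, liftVF_coordT, smul_zero]⟩).symm

theorem liftVF_lmulVF {j k m : ℤ} (f : 𝓜.grading ⊤ j) (X : VF (𝓜.grading ⊤) k) (h : j + k = m) :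
    liftVF (lmulVF f X h) = lmulVF (𝓜.projHom f) (liftVF X) h :=
  (isLift_iff_eq.1 ⟨fun g => by
    rw [lmulVF_apply, lmulVF_apply, liftVF_proj, map_mul]; rfl, by
    rw [lmulVF_apply, liftVF_coordT, mul_zero]⟩).symm

theorem liftVF_bracket {k l : ℤ} (X : VF (𝓜.grading ⊤) k) (Y : VF (𝓜.grading ⊤) l) :
    bracket (liftVF X) (liftVF Y) = liftVF (bracket X Y) :=
  isLift_iff_eq.1 ⟨fun f => by
    simp only [bracket_apply, liftVF_proj, map_sub, map_smul], by
    simp only [bracket_apply, liftVF_coordT, map_zero, smul_zero, sub_zero]⟩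

theorem bracket_partialT_liftVF {k : ℤ} (Y : VF (𝓜.grading ⊤) k) :
    bracket 𝓜.partialT (liftVF Y) = 0 := by
  refine prod_VF_ext (fun t => VF.ext_of_graded fun j f _ => ?_) ?_
  · rw [projVF_apply, projVF_apply, bracket_apply, liftVF_proj, partialT_proj, partialT_proj,
      map_zero, smul_zero, sub_zero]; rfl
  · rw [bracket_apply, liftVF_coordT, partialT_coordT, VF_map_one, map_zero, smul_zero, sub_zero]
    rfl

/-- A function on `𝓜 × ℝ` that is locally on `M` killed by a function equal to `1` vanishes. -/
theorem eq_zero_of_proj_mul {k : ℤ} {s : 𝓜.prodReal.O ⊤} (hs : s ∈ 𝓜.prodReal.grading ⊤ k)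
    (h : ∀ x : M, ∃ (ρ : 𝓜.O ⊤) (V : Opens M), x ∈ V ∧ 𝓜.res (le_top : V ≤ ⊤) ρ = 1 ∧
      𝓜.proj ρ * s = 0) : s = 0 := by
  refine prod_ext fun t => ?_
  rw [map_zero]
  refine eq_zero_of_local (evalAt_mem t hs) fun x _ => ?_
  obtain ⟨ρ, V, hx, hρ, hs⟩ := h x
  refine ⟨V, le_top, hx, ?_⟩
  have h1 := congrArg (fun z => 𝓜.res (le_top : V ≤ ⊤) (𝓜.evalAt t z)) hs
  simpa only [map_mul, evalAt_proj, hρ, one_mul, map_zero] using h1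

theorem lmulVF_eq_sum {ι : Type} [Fintype ι] {d : ι → ℤ}
    {f : ∀ i, 𝓜.grading ⊤ (d i)} {e : ∀ i, VF (𝓜.grading ⊤) (-d i)} {ρ : 𝓜.grading ⊤ 0}
    (h : ∀ (k : ℤ) (Y : VF (𝓜.grading ⊤) k) (g : 𝓜.O ⊤),
      ρ * Y.1 g = ∑ i, Y.1 (f i).1 * (e i).1 g) {k : ℤ} (X : VF (𝓜.grading ⊤) k) :
    lmulVF ρ X (zero_add k) = ∑ i, lmulVF (⟨X.1 (f i), memVF X (f i).2 rfl⟩ :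
      𝓜.grading ⊤ (d i + k)) (e i) (by ring) :=
  VF.ext_of_graded fun j g _ => by
    rw [lmulVF_apply, h]
    simp only [AddSubmonoidClass.coe_finsetSum, LinearMap.sum_apply, lmulVF_apply]

/-- Decomposition of vector fields on `𝓜 × ℝ` in the frame given by a frame of `𝓜` and `∂_t`. -/
theorem lmulVF_proj_eq_sum {ι : Type} [Fintype ι] {d : ι → ℤ}
    {f : ∀ i, 𝓜.grading ⊤ (d i)} {e : ∀ i, VF (𝓜.grading ⊤) (-d i)} {ρ : 𝓜.grading ⊤ 0}
    (h : ∀ (k : ℤ) (Y : VF (𝓜.grading ⊤) k) (g : 𝓜.O ⊤),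
      ρ * Y.1 g = ∑ i, Y.1 (f i).1 * (e i).1 g) {k : ℤ} (X : VF (𝓜.prodReal.grading ⊤) k) :
    lmulVF (𝓜.projHom ρ) X (zero_add k) =
      ∑ i, lmulVF (⟨X.1 (𝓜.projHom (f i)), memVF X (𝓜.projHom (f i)).2 rfl⟩ :
          𝓜.prodReal.grading ⊤ (d i + k)) (liftVF (e i)) (by ring) +
        lmulVF (⟨𝓜.projHom ρ * X.1 𝓜.coordT, mem_degree (SetLike.mul_mem_graded (𝓜.projHom ρ).2
          (memVF X 𝓜.coordT.2 rfl)) (by ring)⟩ : 𝓜.prodReal.grading ⊤ k) 𝓜.partialT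
          (add_zero k) := by
  refine prod_VF_ext (fun t => VF.ext_of_graded fun j g hg => ?_) ?_
  · rw [projVF_add, projVF_sum, projVF_lmulVF, projVF_lmulVF, projVF_partialT]
    simp only [projVF_lmulVF, projVF_liftVF, Submodule.coe_add, LinearMap.add_apply,
      AddSubmonoidClass.coe_finsetSum, LinearMap.sum_apply, lmulVF_apply]
    refine Eq.trans ?_ ((h k (projVF X t) g).trans ?_)
    · change 𝓜.evalAt t (𝓜.proj ρ) * _ = _
      rw [evalAt_proj]
    · simp only [ZeroMemClass.coe_zero, LinearMap.zero_apply, mul_zero, add_zero]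
      rfl
  · simp only [Submodule.coe_add, LinearMap.add_apply,
      AddSubmonoidClass.coe_finsetSum, LinearMap.sum_apply, lmulVF_apply, liftVF_coordT, mul_zero,
      Finset.sum_const_zero, zero_add, partialT_coordT, mul_one]

/-- A `1`-form on `𝓜 × ℝ` is determined by its contractions with lifts and `∂_t`. -/
theorem prod_oneForm_ext {m : ℤ} {γ γ' : OneForm (𝓜.prodReal.grading ⊤) m}
    (h : ∀ k (Y : VF (𝓜.grading ⊤) k),
      (app γ (liftVF Y) : 𝓜.prodReal.O ⊤) = app γ' (liftVF Y))
    (hT : (app γ 𝓜.partialT : 𝓜.prodReal.O ⊤) = app γ' 𝓜.partialT) : γ = γ' := by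
  ext k X
  rw [← sub_eq_zero]
  refine eq_zero_of_proj_mul (sub_mem (app γ X).2 (app γ' X).2) fun x => ?_
  obtain ⟨ι, _, d, f, e, ρ, V, hx, hρ, hf⟩ := exists_frame 𝓜 x
  refine ⟨ρ, V, hx, hρ, ?_⟩
  have h1 := app_lmul γ (𝓜.projHom ρ) X (zero_add k)
  have h2 := app_lmul γ' (𝓜.projHom ρ) X (zero_add k)
  rw [lmulVF_proj_eq_sum hf, app_add, app_sum, app_lmul] at h1 h2
  simp only [app_lmul, h, hT] at h1 h2
  rw [mul_sub, sub_eq_zero]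
  exact h1.symm.trans h2

/-- The family of functions `t ↦ u t` comes from a function on `𝓜 × ℝ` if it does so locally. -/
theorem exists_evalAt_eq_of_mul {k : ℤ} (u : ℝ → 𝓜.O ⊤) (hu : ∀ t, u t ∈ 𝓜.grading ⊤ k)
    (h : ∀ x : M, ∃ (ρ : 𝓜.O ⊤) (V : Opens M), x ∈ V ∧ 𝓜.res (le_top : V ≤ ⊤) ρ = 1 ∧
      ∃ s ∈ 𝓜.prodReal.grading ⊤ k, ∀ t, ρ * u t = 𝓜.evalAt t s) :
    ∃ s ∈ 𝓜.prodReal.grading ⊤ k, ∀ t, 𝓜.evalAt t s = u t := by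
  refine exists_evalAt_eq u hu fun x => ?_
  obtain ⟨ρ, V, hx, hρ, s, hs, h'⟩ := h x
  refine ⟨V, hx, s, hs, fun t => ?_⟩
  rw [← h', map_mul, hρ, one_mul]

/-- The pullback of a `1`-form to `𝓜 × ℝ`. -/
theorem exists_pullback {n : ℤ} (α : OneForm (𝓜.grading ⊤) n) :
    ∃ β : OneForm (𝓜.prodReal.grading ⊤) n, ∀ γ, IsPullback α γ ↔ γ = β := by
  -- The slicewise values depend smoothly on `t`, since in a frame they are sums of `X_t(f_i)
  -- α(e_i)`, where the second factor does not involve `t`.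
  have hex : ∀ k (X : VF (𝓜.prodReal.grading ⊤) k), ∃ s ∈ 𝓜.prodReal.grading ⊤ (k + n),
      ∀ t, 𝓜.evalAt t s = app α (projVF X t) := by
    intro k X
    refine exists_evalAt_eq_of_mul _ (fun t => (app α (projVF X t)).2) fun x => ?_
    obtain ⟨ι, _, d, f, e, ρ, V, hx, hρ, hf⟩ := exists_frame 𝓜 x
    refine ⟨ρ, V, hx, hρ, ∑ i, X.1 (𝓜.proj (f i)) * 𝓜.proj (app α (e i)),
      sum_mem fun i _ => mem_degree (SetLike.mul_mem_graded (memVF X (proj_mem (f i).2) rfl)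
        (proj_mem (app α (e i)).2)) (by ring), fun t => ?_⟩
    rw [← app_lmul α ρ (projVF X t) (zero_add k), lmulVF_eq_sum hf, app_sum, map_sum]
    refine Finset.sum_congr rfl fun i _ => ?_
    rw [app_lmul, map_mul, evalAt_proj]
    rfl
  choose s hs hst using hex
  let β : OneForm (𝓜.prodReal.grading ⊤) n := ⟨fun k =>
    { toFun := fun X => ⟨s k X, hs k X⟩
      map_add' := fun X Y => Subtype.ext (prod_ext fun t => by
        simp only [Submodule.coe_add, map_add, hst, projVF_add, app_add])
      map_smul' := fun c X => Subtype.ext (prod_ext fun t => by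
        simp only [SetLike.val_smul, RingHom.id_apply, map_smul, hst, projVF_smul, app_smul]) },
    fun j k f X => prod_ext fun t => by
      change 𝓜.evalAt t (s _ _) = 𝓜.evalAt t (f * s k X)
      rw [hst, map_mul, hst, projVF_lmulVF, app_lmul]⟩
  have hβ : IsPullback α β := fun k X t => hst k X t
  refine ⟨β, fun γ => ⟨fun h => ?_, ?_⟩⟩
  · ext k X
    exact prod_ext fun t => (h k X t).trans (hβ k X t).symm
  · rintro rfl; exact hβ

variable {n : ℤ} {α : OneForm (𝓜.grading ⊤) n} {β : OneForm (𝓜.prodReal.grading ⊤) n}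

theorem IsPullback.app_liftVF (h : IsPullback α β) {k : ℤ} (Y : VF (𝓜.grading ⊤) k) :
    (app β (liftVF Y) : 𝓜.prodReal.O ⊤) = 𝓜.proj (app α Y) :=
  prod_ext fun t => by rw [h, projVF_liftVF, evalAt_proj]

theorem IsPullback.app_partialT (h : IsPullback α β) :
    (app β 𝓜.partialT : 𝓜.prodReal.O ⊤) = 0 :=
  prod_ext fun t => by rw [h, projVF_partialT, app_zero, map_zero]

/-- The symplectization `d (e^t β)`. -/
noncomputable def symplectization (β : OneForm (𝓜.prodReal.grading ⊤) n) :
    TwoForm (𝓜.prodReal.grading ⊤) n := dOne (lmulForm 𝓜.expT β (zero_add n))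

theorem app_expT_lmulForm {k : ℤ} (X : VF (𝓜.prodReal.grading ⊤) k) :
    (app (lmulForm 𝓜.expT β (zero_add n)) X : 𝓜.prodReal.O ⊤) = 𝓜.expT * app β X := by
  rw [app_lmulForm, mul_zero, koszul_zero, one_smul]

theorem symplectization_liftVF_liftVF (h : IsPullback α β) {k l : ℤ} (Z : VF (𝓜.grading ⊤) k)
    (Y : VF (𝓜.grading ⊤) l) :
    (app ((symplectization β).contract (liftVF Z)) (liftVF Y) : 𝓜.prodReal.O ⊤) =
      𝓜.expT * 𝓜.proj (app ((dOne α).contract Z) Y) := by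
  rw [symplectization, app_dOne, app_dOne, dOneVal, dOneVal, app_expT_lmulForm, app_expT_lmulForm,
    app_expT_lmulForm, liftVF_bracket, h.app_liftVF, h.app_liftVF, h.app_liftVF,
    leibnizVF_zero _ 𝓜.expT.2, leibnizVF_zero _ 𝓜.expT.2, liftVF_expT, liftVF_expT, liftVF_proj,
    liftVF_proj, map_sub, map_smul, map_smul, map_sub, zero_mul, zero_mul, zero_add, zero_add,
    mul_sub (𝓜.expT : 𝓜.prodReal.O ⊤), mul_smul_comm, mul_smul_comm,
    mul_sub (𝓜.expT : 𝓜.prodReal.O ⊤)]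

theorem symplectization_partialT_liftVF (h : IsPullback α β) {l : ℤ} (Y : VF (𝓜.grading ⊤) l) :
    (app ((symplectization β).contract 𝓜.partialT) (liftVF Y) : 𝓜.prodReal.O ⊤) =
      𝓜.expT * 𝓜.proj (app α Y) := by
  rw [symplectization, app_dOne, dOneVal, app_expT_lmulForm, app_expT_lmulForm,
    app_expT_lmulForm, bracket_partialT_liftVF, h.app_liftVF, h.app_partialT, app_zero,
    leibnizVF_zero _ 𝓜.expT.2, partialT_expT, partialT_proj, zero_mul, koszul_zero]
  simp

theorem symplectization_liftVF_partialT (h : IsPullback α β) {k : ℤ} (Z : VF (𝓜.grading ⊤) k) :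
    (app ((symplectization β).contract (liftVF Z)) 𝓜.partialT : 𝓜.prodReal.O ⊤) =
      -koszul k • (𝓜.expT * 𝓜.proj (app α Z)) := by
  rw [(symplectization β).symm 𝓜.partialT, symplectization_partialT_liftVF h,
    koszul_congr_neg (b := k) (c := -k) (by ring)]

theorem symplectization_partialT_partialT (h : IsPullback α β) :
    (app ((symplectization β).contract 𝓜.partialT) 𝓜.partialT : 𝓜.prodReal.O ⊤) = 0 := by
  have hb : bracket 𝓜.partialT 𝓜.partialT = 0 :=
    Subtype.ext (LinearMap.ext fun g => by
      rw [bracket_apply, mul_zero, koszul_zero, one_smul, sub_self]; rfl)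
  rw [symplectization, app_dOne, dOneVal, app_expT_lmulForm, app_expT_lmulForm, hb,
    h.app_partialT, app_zero]
  simp

/-- After multiplication by `ρ` the field `X` is a combination of lifts of frame fields and `∂_t`,
for which the contractions are known. The `dt ∧ α` part of the form contributes `X(t) α` and the
`dα` part contributes `ι_{X_t} dα`. -/
theorem evalAt_symplectization_liftVF (h : IsPullback α β) {k l : ℤ}
    (X : VF (𝓜.prodReal.grading ⊤) k) (Y : VF (𝓜.grading ⊤) l) (t : ℝ) :
    𝓜.evalAt t (app ((symplectization β).contract X) (liftVF Y)) = Real.exp t •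
      (koszul ((l - 1) * k) • (𝓜.evalAt t (X.1 𝓜.coordT) * app α Y) +
        app ((dOne α).contract (projVF X t)) Y) := by
  rw [← sub_eq_zero]
  refine eq_zero_of_local (k := k + l + n) (sub_mem (evalAt_mem t (mem_degree (app _ _).2 (by ring)))
    (Submodule.smul_mem _ _ (add_mem (Submodule.smul_mem _ _ (mem_degree (SetLike.mul_mem_graded
      (evalAt_mem t (memVF X 𝓜.coordT.2 rfl)) (app α Y).2) (by ring)))
      (mem_degree (app _ _).2 (by ring))))) fun x _ => ?_
  obtain ⟨ι, _, d, f, e, ρ, V, hx, hρ, hf⟩ := exists_frame 𝓜 x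
  refine ⟨V, le_top, hx, ?_⟩
  have h1 := app_contract_lmul (symplectization β) (𝓜.projHom ρ) X (zero_add k) (liftVF Y)
  have h2 := app_contract_lmul (dOne α) ρ (projVF X t) (zero_add k) Y
  rw [mul_zero, koszul_zero, one_smul] at h1 h2
  rw [lmulVF_proj_eq_sum hf, app_contract_add, app_contract_sum] at h1
  rw [lmulVF_eq_sum hf, app_contract_sum] at h2
  simp only [app_contract_lmul, symplectization_liftVF_liftVF h,
    symplectization_partialT_liftVF h] at h1 h2
  have h3 := congrArg (𝓜.evalAt t) h1
  have he : ∀ z : 𝓜.O ⊤, algebraMap ℝ (𝓜.O ⊤) (Real.exp t) * z = Real.exp t • z :=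
    fun z => (Algebra.smul_def _ _).symm
  have hρ' : 𝓜.evalAt t (𝓜.projHom ρ) = ρ := evalAt_proj t _
  simp only [map_add, map_sum, map_smul, map_mul, expT, evalAt_funOfT, evalAt_proj, he, hρ',
    mul_smul_comm] at h3
  have h4 : ∀ i, 𝓜.evalAt t (X.1 (𝓜.projHom (f i))) = (projVF X t).1 (f i) := fun i => rfl
  simp only [h4, smul_comm _ (Real.exp t), ← Finset.smul_sum, h2] at h3
  have h5 : (ρ : 𝓜.O ⊤) * (𝓜.evalAt t (app ((symplectization β).contract X) (liftVF Y)) -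
      Real.exp t • (koszul ((l - 1) * k) • (𝓜.evalAt t (X.1 𝓜.coordT) * app α Y) +
        app ((dOne α).contract (projVF X t)) Y)) = 0 := by
    rw [mul_sub, ← h3, mul_smul_comm, mul_add, mul_smul_comm, ← mul_assoc, smul_add]
    abel
  simpa only [map_mul, hρ, one_mul, map_zero] using congrArg (𝓜.res (le_top : V ≤ ⊤)) h5

/-- Same frame expansion; only the `dt ∧ α` part pairs with `∂_t`. With
`evalAt_symplectization_liftVF` this turns `ι_X σ = γ` into a contact system on every slice. -/
theorem evalAt_symplectization_partialT (h : IsPullback α β) {k : ℤ}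
    (X : VF (𝓜.prodReal.grading ⊤) k) (t : ℝ) :
    𝓜.evalAt t (app ((symplectization β).contract X) 𝓜.partialT) =
      -(Real.exp t • koszul k • (app α (projVF X t) : 𝓜.O ⊤)) := by
  rw [← add_eq_zero_iff_eq_neg]
  refine eq_zero_of_local (k := k + n) (add_mem (evalAt_mem t (mem_degree (app _ _).2 (by ring)))
    (Submodule.smul_mem _ _ (Submodule.smul_mem _ _ (app α _).2))) fun x _ => ?_
  obtain ⟨ι, _, d, f, e, ρ, V, hx, hρ, hf⟩ := exists_frame 𝓜 x
  refine ⟨V, le_top, hx, ?_⟩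
  have h1 := app_contract_lmul (symplectization β) (𝓜.projHom ρ) X (zero_add k) 𝓜.partialT
  have h2 := app_lmul α ρ (projVF X t) (zero_add k)
  rw [mul_zero, koszul_zero, one_smul] at h1
  rw [lmulVF_proj_eq_sum hf, app_contract_add, app_contract_sum] at h1
  rw [lmulVF_eq_sum hf, app_sum] at h2
  simp only [app_contract_lmul, app_lmul, symplectization_liftVF_partialT h, zero_sub,
    symplectization_partialT_partialT h, mul_zero, smul_zero, add_zero] at h1 h2
  have h3 := congrArg (𝓜.evalAt t) h1
  have he : ∀ z : 𝓜.O ⊤, algebraMap ℝ (𝓜.O ⊤) (Real.exp t) * z = Real.exp t • z :=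
    fun z => (Algebra.smul_def _ _).symm
  have hρ' : 𝓜.evalAt t (𝓜.projHom ρ) = ρ := evalAt_proj t _
  have hk : ∀ i, koszul (-1 * (d i + k)) * -koszul (-d i) = -koszul k := fun i => by
    rw [mul_neg, ← koszul_add, koszul_congr (b := k) (c := - d i - k) (by ring)]
  simp only [map_sum, map_smul, map_mul, expT, evalAt_funOfT, evalAt_proj, he, hρ',
    mul_smul_comm, smul_smul, hk] at h3
  have h4 : ∀ i, 𝓜.evalAt t (X.1 (𝓜.projHom (f i))) = (projVF X t).1 (f i) := fun i => rfl
  simp only [h4, ← Finset.smul_sum, h2] at h3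
  have h5 : (ρ : 𝓜.O ⊤) * (𝓜.evalAt t (app ((symplectization β).contract X) 𝓜.partialT) +
      Real.exp t • koszul k • (app α (projVF X t) : 𝓜.O ⊤)) = 0 := by
    rw [mul_add, ← h3, mul_smul_comm, mul_smul_comm]
    module
  simpa only [map_mul, hρ, one_mul, map_zero] using congrArg (𝓜.res (le_top : V ≤ ⊤)) h5

end FormsOnProduct

end NManifold

end NGeom

namespace NGeom

/-! ### The contact system is linear over functions -/

section ContactSolutions

variable {A : Type*} [Ring A] [Algebra ℝ A] {𝒜 : ℤ → Submodule ℝ A} [GradedComm 𝒜]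

/-- The pair `(X, h)` solves the equations `ι_X α = a` and `h α + ι_X dα = γ`. -/
def IsContactSolution {n k : ℤ} (α : OneForm 𝒜 n) (a : A) (γ : ∀ l, VF 𝒜 l → A) (X : VF 𝒜 k)
    (h : 𝒜 k) : Prop :=
  (app α X : A) = a ∧ ∀ l (Y : VF 𝒜 l), koszul ((l - 1) * k) • ((h : A) * app α Y) +
    app ((dOne α).contract X) Y = γ l Y

variable {n : ℤ} {α : OneForm 𝒜 n} {R : VF 𝒜 (-n)}

/-- Solutions may be multiplied by functions, with the right-hand sides scaled accordingly. Together
with `IsContactSolution.sum` and uniqueness, this transfers smooth dependence on `t` from the data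
to the solution. -/
theorem IsContactSolution.lmul {j k m : ℤ} {a : A} {γ : ∀ l, VF 𝒜 l → A} {X : VF 𝒜 k} {h : 𝒜 k}
    (hX : IsContactSolution α a γ X h) (f : 𝒜 j) (hm : j + k = m) :
    IsContactSolution α (f * a) (fun l Y => koszul ((l - 1) * j) • ((f : A) * γ l Y))
      (lmulVF f X hm) ⟨f * h, mem_degree (SetLike.mul_mem_graded f.2 h.2) hm⟩ := by
  subst hm
  refine ⟨by rw [app_lmul, hX.1], fun l Y => ?_⟩
  beta_reduce
  rw [← hX.2 l Y, app_contract_lmul, mul_add (l - 1), koszul_add, mul_add (f : A), mul_smul_comm,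
    smul_add, smul_smul, ← mul_assoc]

theorem IsContactSolution.add {k : ℤ} {a a' : A} {γ γ' : ∀ l, VF 𝒜 l → A} {X X' : VF 𝒜 k}
    {h h' : 𝒜 k} (hX : IsContactSolution α a γ X h) (hX' : IsContactSolution α a' γ' X' h') :
    IsContactSolution α (a + a') (fun l Y => γ l Y + γ' l Y) (X + X') (h + h') := by
  refine ⟨by rw [app_add, hX.1, hX'.1], fun l Y => ?_⟩
  beta_reduce
  rw [← hX.2 l Y, ← hX'.2 l Y, app_contract_add, Submodule.coe_add, add_mul, smul_add]
  abel

theorem IsContactSolution.sum {ι : Type*} {s : Finset ι} {k : ℤ} {a : ι → A}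
    {γ : ι → ∀ l, VF 𝒜 l → A} {X : ι → VF 𝒜 k} {h : ι → 𝒜 k}
    (hX : ∀ i ∈ s, IsContactSolution α (a i) (γ i) (X i) (h i)) :
    IsContactSolution α (∑ i ∈ s, a i) (fun l Y => ∑ i ∈ s, γ i l Y) (∑ i ∈ s, X i)
      (∑ i ∈ s, h i) := by
  refine ⟨by rw [app_sum]; exact Finset.sum_congr rfl fun i hi => (hX i hi).1, fun l Y => ?_⟩
  rw [app_contract_sum, AddSubmonoidClass.coe_finsetSum, Finset.sum_mul, Finset.smul_sum,
    ← Finset.sum_add_distrib]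
  exact Finset.sum_congr rfl fun i hi => (hX i hi).2 l Y

theorem IsContactSolution.unique (hα : IsNondegenerateOnKer α) (hR : (app α R : A) = 1) {k : ℤ}
    {a a' : A} {γ γ' : ∀ l, VF 𝒜 l → A} {X X' : VF 𝒜 k} {h h' : 𝒜 k}
    (hX : IsContactSolution α a γ X h) (hX' : IsContactSolution α a' γ' X' h') (ha : a = a')
    (hγ : ∀ l Y, γ l Y = γ' l Y) :
    X = X' ∧ h = h' := by
  have h1 := contact_solve_unique hα hR (X := X - X') (h := h - h')
    (by rw [app_sub, hX.1, hX'.1, ha, sub_self]) (fun l Y => by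
      rw [app_contract_sub, Submodule.coe_sub, sub_mul (h : A), smul_sub (koszul _), sub_add_sub_comm,
        hX.2, hX'.2, hγ, sub_self])
  exact ⟨sub_eq_zero.1 h1.1, sub_eq_zero.1 h1.2⟩

theorem exists_isContactSolution (hα : IsNondegenerateOnKer α) (hR : (app α R : A) = 1) {k m : ℤ}
    (hm : k + n = m) (a : 𝒜 m) (γ : OneForm 𝒜 m) :
    ∃ (X : VF 𝒜 k) (h : 𝒜 k), IsContactSolution α (a : A) (fun _ Y => (app γ Y : A)) X h := by
  subst hm
  exact exists_contact_solve hα hR a γ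

end ContactSolutions

namespace NManifold

/-! ### The Reeb field, nondegeneracy and the Hamiltonian field -/

section Symplectization

universe u v

variable {E : Type*} [NormedAddCommGroup E] [NormedSpace ℝ E] {H : Type*} [TopologicalSpace H]
  {I : ModelWithCorners ℝ E H} {M : Type v} [TopologicalSpace M] [ChartedSpace H M]
  {𝓜 : NManifold.{u} I M} [FiniteDimensional ℝ E] [T2Space M] [IsManifold I ∞ M]
  [I.Boundaryless] {n : ℤ} {α : OneForm (𝓜.grading ⊤) n}

/-- Rescaling by a cut-off inverse of `g` gives `ι_R α = 1` near `x`. Adding a field in the kernel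
does not change this value, and by nondegeneracy it can be chosen to make `ι_R dα` vanish on the
kernel. -/
theorem IsContactForm.exists_local (hα : IsContactForm α) (x : M) :
    ∃ (R : VF (𝓜.grading ⊤) (-n)) (V : Opens M), x ∈ V ∧
      𝓜.res (le_top : V ≤ ⊤) (app α R : 𝓜.O ⊤) = 1 ∧
      ∀ l, ∀ Y ∈ ker α l, (app ((dOne α).contract R) Y : 𝓜.O ⊤) = 0 := by
  obtain ⟨X, g, hg, hgx⟩ := hα.nowhere_vanishing x
  let U : Opens M := ⟨{y | g ⟨y, trivial⟩ ≠ 0}, isOpen_ne_fun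
    (g.contMDiff.continuous.comp (by fun_prop)) continuous_const⟩
  have hgU : ∀ y : U, g.res (le_top : U ≤ ⊤) y ≠ 0 := fun y => y.2
  let g' : Smooth I U := ⟨fun y => (g.res (le_top : U ≤ ⊤) y)⁻¹,
    (g.res (le_top : U ≤ ⊤)).contMDiff.inv₀ hgU⟩
  obtain ⟨V, hV, hxV, hext⟩ := exists_extension (𝓜 := 𝓜) (x := x) (U := U) hgx
  obtain ⟨F, hF, hF'⟩ := hext 0 _ (smooth_mem U g')
  let R' : VF (𝓜.grading ⊤) (-n) := lmulVF ⟨F, hF⟩ X (zero_add _)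
  obtain ⟨Z, hZ⟩ := (hα.nondegenerate (-n)).2 (restrictKer α (-(dOne α).contract R'))
  have hZα : (app α Z.1 : 𝓜.O ⊤) = 0 := congrArg Subtype.val Z.2
  refine ⟨Z.1 + R', V, hxV, ?_, fun l Y hY => ?_⟩
  · rw [app_add, hZα, zero_add, app_lmul, map_mul, hF', ← hg, 𝓜.res_smooth, 𝓜.res_smooth,
      ← map_mul, ← map_one (𝓜.smooth V)]
    congr 1
    ext y
    exact inv_mul_cancel₀ (hgU ⟨y.1, hV y.2⟩)
  · have h1 : (app ((dOne α).contract Z.1) Y : 𝓜.O ⊤) = app (-(dOne α).contract R') Y :=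
      congrArg (fun β : KerDual α (-n + n) => ((β.1 l ⟨Y, hY⟩ : 𝓜.grading ⊤ _) : 𝓜.O ⊤)) hZ
    rw [app_contract_add, h1, app_neg_form, neg_add_cancel]

/-- The normalization on the kernel determines the field: the cut-off difference `D` lies in the
kernel of `α` and `ι_D dα` vanishes on that kernel, so `D = 0`. -/
theorem IsContactForm.res_eq (hα : IsContactForm α) {R R' : VF (𝓜.grading ⊤) (-n)} {W : Opens M}
    (h : 𝓜.res (le_top : W ≤ ⊤) (app α R : 𝓜.O ⊤) = 𝓜.res le_top (app α R' : 𝓜.O ⊤))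
    (hR : ∀ l, ∀ Y ∈ ker α l, (app ((dOne α).contract R) Y : 𝓜.O ⊤) = 0)
    (hR' : ∀ l, ∀ Y ∈ ker α l, (app ((dOne α).contract R') Y : 𝓜.O ⊤) = 0) {j : ℤ} {f : 𝓜.O ⊤}
    (hf : f ∈ 𝓜.grading ⊤ j) :
    𝓜.res (le_top : W ≤ ⊤) (R.1 f) = 𝓜.res le_top (R'.1 f) := by
  refine eq_of_local (𝓜.res_mem _ (memVF R hf rfl)) (𝓜.res_mem _ (memVF R' hf rfl)) fun x hx => ?_
  obtain ⟨ρ, V, K, hxV, hV, hc, h1, h0⟩ := exists_bump (I := I) x W hx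
  refine ⟨V, hV, hxV, ?_⟩
  let ρ' : 𝓜.grading ⊤ 0 := ⟨𝓜.smooth ⊤ ρ, smooth_mem ⊤ ρ⟩
  let D : VF (𝓜.grading ⊤) (-n) := lmulVF ρ' (R - R') (zero_add _)
  have hD : D ∈ ker α (-n) := by
    refine Subtype.ext (eq_zero_of_local (app α D).2 fun y _ => ?_)
    change ∃ (V : Opens M) (hV : V ≤ ⊤), y ∈ V ∧ 𝓜.res hV (app α D : 𝓜.O ⊤) = 0
    rw [app_lmul, app_sub]
    rcases hc y with hy | hy
    · exact ⟨W, le_top, hy, by rw [map_mul, map_sub, h, sub_self, mul_zero]⟩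
    · exact ⟨K, le_top, hy, by rw [map_mul, res_smooth_eq_zero _ (fun y hy => h0 y hy), zero_mul]⟩
  have hD0 : D = 0 := by
    have := (hα.nondegenerate (-n)).1 (a₁ := ⟨D, hD⟩) (a₂ := 0) (Subtype.ext (funext fun l =>
      LinearMap.ext fun Y => Subtype.ext ?_))
    · exact congrArg Subtype.val this
    · change (app ((dOne α).contract D) Y.1 : 𝓜.O ⊤) =
        app ((dOne α).contract (0 : VF (𝓜.grading ⊤) (-n))) Y.1
      rw [app_contract_lmul, app_contract_sub, hR l Y.1 Y.2, hR' l Y.1 Y.2,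
        ← zero_smul ℝ (0 : VF (𝓜.grading ⊤) (-n)), app_contract_smul, zero_smul, sub_zero]
      simp
  have h2 : 𝓜.smooth ⊤ ρ * (R.1 f - R'.1 f) = 0 :=
    congrArg (fun X : VF (𝓜.grading ⊤) (-n) => X.1 f) hD0
  have h3 := congrArg (𝓜.res (le_top : V ≤ ⊤)) h2
  rw [map_mul, res_smooth_eq_one _ (fun y hy => h1 y hy), one_mul, map_zero, map_sub,
    sub_eq_zero] at h3
  rw [𝓜.res_res, 𝓜.res_res, h3]

/-- The Reeb vector field of a contact form. -/
theorem IsContactForm.exists_reeb (hα : IsContactForm α) :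
    ∃ R : VF (𝓜.grading ⊤) (-n), (app α R : 𝓜.O ⊤) = 1 := by
  choose X V hxV hX hXD using hα.exists_local
  obtain ⟨R, hR⟩ := exists_VF_of_local (𝓜 := 𝓜) V (fun x => ⟨x, hxV x⟩) (k := -n)
    (fun x => (𝓜.res (le_top : V x ≤ ⊤)).toLinearMap ∘ₗ (X x).1)
    (fun x j f hf => 𝓜.res_mem (le_top : V x ≤ ⊤) (memVF (X x) hf rfl))
    (fun x j l f hf g hg => by
      simp only [LinearMap.comp_apply, AlgHom.toLinearMap_apply, leibnizVF (X x) hf, map_add,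
        map_smul, map_mul])
    (fun x y j f hf W hx hy => by
      simp only [LinearMap.comp_apply, AlgHom.toLinearMap_apply, 𝓜.res_res]
      refine hα.res_eq ?_ (hXD x) (hXD y) hf
      rw [← 𝓜.res_res hx le_top, ← 𝓜.res_res hy le_top (app α (X y) : 𝓜.O ⊤), hX, hX, map_one,
        map_one])
  -- `R` agrees with `X x` over `V x`, and `1`-forms are local, so `ι_R α = 1` can be read off
  -- there.
  refine ⟨R, eq_of_local (k := -n + n) (app α R).2 (mem_degree
    (SetLike.one_mem_graded (𝓜.grading ⊤)) (by ring)) fun x _ => ⟨V x, le_top, hxV x, ?_⟩⟩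
  have h1 := res_app_eq_zero α (R - X x) (V := V x) fun j f hf => by
    rw [Submodule.coe_sub, LinearMap.sub_apply, map_sub, hR x j f hf]
    exact sub_self _
  rw [app_sub, map_sub, sub_eq_zero] at h1
  rw [h1, hX, map_one]

variable {β : OneForm (𝓜.prodReal.grading ⊤) n}

/-- `ι_X σ = γ` becomes, for every `t`, the contact system for the pair `(X_t, X(t))`. Uniqueness
slice by slice gives injectivity; existence together with smooth dependence on `t` gives
surjectivity. -/
theorem isSymplectic_symplectization (hα : IsContactForm α) (h : IsPullback α β) :
    IsSymplectic (symplectization β) := by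
  obtain ⟨R, hR⟩ := hα.exists_reeb
  refine ⟨fun X Y Z => dTwoVal_dOne _ X Y Z, fun k => ⟨fun X X' hXX' => ?_, fun γ => ?_⟩⟩
  · have hc : ∀ l (Y : VF (𝓜.prodReal.grading ⊤) l),
        (app ((symplectization β).contract X) Y : 𝓜.prodReal.O ⊤) =
          app ((symplectization β).contract X') Y := fun l Y =>
      congrArg (fun γ : OneForm (𝓜.prodReal.grading ⊤) (k + n) =>
        (app γ Y : 𝓜.prodReal.O ⊤)) hXX'
    have hs : ∀ (Z : VF (𝓜.prodReal.grading ⊤) k) t, IsContactSolution α (app α (projVF Z t) : 𝓜.O ⊤)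
        (fun l Y => koszul ((l - 1) * k) • (𝓜.evalAt t (Z.1 𝓜.coordT) * app α Y) +
          app ((dOne α).contract (projVF Z t)) Y) (projVF Z t)
        ⟨𝓜.evalAt t (Z.1 𝓜.coordT), evalAt_mem t (memVF Z 𝓜.coordT.2 (zero_add k))⟩ :=
      fun Z t => ⟨rfl, fun l Y => rfl⟩
    have h1 := fun t => (hs X t).unique hα.nondegenerate hR (hs X' t) (by
      have h2 := congrArg (𝓜.evalAt t) (hc 0 𝓜.partialT)
      rw [evalAt_symplectization_partialT h, evalAt_symplectization_partialT h, neg_inj] at h2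
      exact smul_right_injective _ (koszul_ne_zero k)
        (smul_right_injective _ (Real.exp_ne_zero t) h2)) (fun l Y => by
      have h2 := congrArg (𝓜.evalAt t) (hc l (liftVF Y))
      rw [evalAt_symplectization_liftVF h, evalAt_symplectization_liftVF h] at h2
      exact smul_right_injective _ (Real.exp_ne_zero t) h2)
    exact prod_VF_ext (fun t => (h1 t).1) (prod_ext fun t => congrArg Subtype.val (h1 t).2)
  -- `γt` and `a` are the right-hand sides obtained by solving the two slice formulas for `h α +
  -- ι_{X_t} dα` and `ι_{X_t} α`; hence the factors `e^{-t}` and `-(-1)^k`.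
  · let γt : ℝ → OneForm (𝓜.grading ⊤) (k + n) := fun t => ⟨fun l =>
      { toFun := fun Y => ⟨Real.exp (-t) • 𝓜.evalAt t (app γ (liftVF Y)),
          Submodule.smul_mem _ _ (evalAt_mem t (app γ (liftVF Y)).2)⟩
        map_add' := fun Y Z => Subtype.ext (by
          simp only [liftVF_add, app_add, map_add, smul_add, Submodule.coe_add])
        map_smul' := fun c Y => Subtype.ext (by
          simp only [liftVF_smul, app_smul, map_smul, SetLike.val_smul, RingHom.id_apply]
          rw [smul_comm]) }, fun j l f Y => by
        change Real.exp (-t) • 𝓜.evalAt t (app γ (liftVF (lmulVF f Y rfl))) =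
          f * Real.exp (-t) • 𝓜.evalAt t (app γ (liftVF Y))
        rw [liftVF_lmulVF, app_lmul, map_mul, mul_smul_comm]
        congr 2
        exact evalAt_proj t _⟩
    have hγt : ∀ t l (Y : VF (𝓜.grading ⊤) l), (app (γt t) Y : 𝓜.O ⊤) =
        Real.exp (-t) • 𝓜.evalAt t (app γ (liftVF Y)) := fun t l Y => rfl
    let a : ℝ → 𝓜.grading ⊤ (k + n) := fun t =>
      ⟨-(koszul k * Real.exp (-t)) • 𝓜.evalAt t (app γ 𝓜.partialT), Submodule.smul_mem _ _
        (evalAt_mem t (mem_degree (app γ 𝓜.partialT).2 (zero_add _)))⟩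
    choose X h' hX using fun t =>
      exists_isContactSolution hα.nondegenerate hR (k := k) rfl (a t) (γt t)
    let ε : 𝓜.prodReal.grading ⊤ 0 :=
      𝓜.funOfT (fun t => Real.exp (-t)) (Real.contDiff_exp.comp contDiff_neg)
    have hε : ∀ t (z : 𝓜.O ⊤), 𝓜.evalAt t ε * z = Real.exp (-t) • z := fun t z => by
      rw [evalAt_funOfT, Algebra.smul_def]
    have key : ∀ x : M, ∃ (ρ : 𝓜.O ⊤) (V : Opens M), x ∈ V ∧ 𝓜.res (le_top : V ≤ ⊤) ρ = 1 ∧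
        (∀ j, ∀ f ∈ 𝓜.grading ⊤ j, ∃ s ∈ 𝓜.prodReal.grading ⊤ (j + k),
          ∀ t, ρ * (X t).1 f = 𝓜.evalAt t s) ∧
        ∃ s ∈ 𝓜.prodReal.grading ⊤ k, ∀ t, ρ * h' t = 𝓜.evalAt t s := by
      intro x
      obtain ⟨ι, _, d, f, e, ρ, V, hx, hρ, hf⟩ := exists_frame 𝓜 x
      refine ⟨ρ, V, hx, hρ, ?_⟩
      -- Elementary solutions independent of `t`: for each `df_i` with `a = 0`, and for `a = 1` with
      -- zero form.
      choose Z z hZ using fun i => exists_isContactSolution hα.nondegenerate hR (k := d i - n)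
        (by ring) 0 (dFun (f i))
      obtain ⟨Z', z', hZ'⟩ := exists_isContactSolution hα.nondegenerate hR (k := -n)
        (neg_add_cancel n) ⟨1, SetLike.one_mem_graded (𝓜.grading ⊤)⟩ 0
      -- The sign exponent `d i + 1` is the difference of `l + d i`, from moving `γ_t(e_i)` past
      -- `Y(f_i)`, and `l - 1`, from multiplying a solution by a function.
      let g : ∀ i, ℝ → 𝓜.grading ⊤ (-d i + (k + n)) := fun i t =>
        koszul ((d i + 1) * (-d i + (k + n))) • app (γt t) (e i)
      let c : ∀ i, 𝓜.prodReal.O ⊤ := fun i =>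
        koszul ((d i + 1) * (-d i + (k + n))) • (ε * app γ (liftVF (e i)))
      have hc : ∀ i, c i ∈ 𝓜.prodReal.grading ⊤ (-d i + (k + n)) := fun i =>
        Submodule.smul_mem _ _ (mem_degree (SetLike.mul_mem_graded ε.2
          (app γ (liftVF (e i))).2) (zero_add _))
      have hgc : ∀ i t, 𝓜.evalAt t (c i) = g i t := fun i t => by
        rw [map_smul, map_mul, hε]; rfl
      let c' : 𝓜.prodReal.O ⊤ := -koszul k • (𝓜.proj ρ * (ε * app γ 𝓜.partialT))
      have hc' : c' ∈ 𝓜.prodReal.grading ⊤ (k + n) := Submodule.smul_mem _ _ (mem_degree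
        (SetLike.mul_mem_graded (proj_mem ρ.2) (SetLike.mul_mem_graded ε.2 (app γ 𝓜.partialT).2))
        (by ring))
      have hac : ∀ t, 𝓜.evalAt t c' = ρ * a t := fun t => by
        rw [map_smul, map_mul, map_mul, hε, evalAt_proj, ← mul_smul_comm, smul_smul, neg_mul]
      -- By uniqueness, `ρ` times the solution at time `t` is the combination of the elementary
      -- solutions with coefficients `g i t` and `ρ a(t)`, which come from functions on `𝓜 × ℝ`.
      have hu := fun t => ((hX t).lmul ρ (zero_add k)).unique hα.nondegenerate hR
        ((IsContactSolution.sum (s := Finset.univ) (fun i _ => (hZ i).lmul (g i t)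
          (by ring : -d i + (k + n) + (d i - n) = k))).add (hZ'.lmul
          (⟨𝓜.evalAt t c', evalAt_mem t hc'⟩ : 𝓜.grading ⊤ (k + n)) (by ring)))
        (by
          simp only [hac, mul_one, ZeroMemClass.coe_zero, mul_zero, Finset.sum_const_zero,
            zero_add])
        (fun l Y => by
          have h1 := app_lmul (γt t) ρ Y (zero_add l)
          rw [lmulVF_eq_sum hf, app_sum] at h1
          have h0 : (app (0 : OneForm (𝓜.grading ⊤) 0) Y : 𝓜.O ⊤) = 0 := rfl
          rw [mul_zero, koszul_zero, one_smul, ← h1, h0, mul_zero, smul_zero]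
          refine Eq.trans (Finset.sum_congr rfl fun i _ => ?_) (add_zero _).symm
          rw [app_lmul, app_dFun, GradedComm.comm (𝒜 := 𝓜.grading ⊤) (memVF Y (f i).2 rfl)
            (app (γt t) (e i)).2, SetLike.val_smul, smul_mul_assoc, smul_smul, ← koszul_add]
          congr 2
          ring)
      refine ⟨fun j F hF => ⟨∑ i, c i * 𝓜.proj ((Z i).1 F) + c' * 𝓜.proj (Z'.1 F),
        add_mem (sum_mem fun i _ => mem_degree (SetLike.mul_mem_graded (hc i)
          (proj_mem (memVF (Z i) hF rfl))) (by ring)) (mem_degree (SetLike.mul_mem_graded hc'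
          (proj_mem (memVF Z' hF rfl))) (by ring)), fun t => ?_⟩,
        ⟨∑ i, c i * 𝓜.proj (z i) + c' * 𝓜.proj z',
        add_mem (sum_mem fun i _ => mem_degree (SetLike.mul_mem_graded (hc i)
          (proj_mem (z i).2)) (by ring)) (mem_degree (SetLike.mul_mem_graded hc'
          (proj_mem z'.2)) (by ring)), fun t => ?_⟩⟩
      · have h1 := congrArg (fun W : VF (𝓜.grading ⊤) k => W.1 F) (hu t).1
        simp only [lmulVF_apply, Submodule.coe_add, LinearMap.add_apply,
          AddSubmonoidClass.coe_finsetSum, LinearMap.sum_apply] at h1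
        rw [h1]
        simp only [map_add, map_sum, map_mul, evalAt_proj, hgc]
      · have h1 := congrArg Subtype.val (hu t).2
        simp only [Submodule.coe_add, AddSubmonoidClass.coe_finsetSum] at h1
        rw [h1]
        simp only [map_add, map_sum, map_mul, evalAt_proj, hgc]
    obtain ⟨s, hs, hst⟩ := exists_evalAt_eq_of_mul (fun t => (h' t : 𝓜.O ⊤)) (fun t => (h' t).2)
      fun x => by
        obtain ⟨ρ, V, hx, hρ, -, h1⟩ := key x
        exact ⟨ρ, V, hx, hρ, h1⟩
    obtain ⟨Y, hY, hYt⟩ := exists_prod_VF X (fun j f hf => exists_evalAt_eq_of_mul _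
      (fun t => memVF (X t) hf rfl) fun x => by
        obtain ⟨ρ, V, hx, hρ, h1, -⟩ := key x
        exact ⟨ρ, V, hx, hρ, h1 j f hf⟩) ⟨s, hs⟩
    refine ⟨Y, prod_oneForm_ext (fun l Z => prod_ext fun t => ?_) (prod_ext fun t => ?_)⟩
    · rw [evalAt_symplectization_liftVF h, hYt, hY, hst, (hX t).2 l Z]
      beta_reduce
      rw [hγt, smul_smul, ← Real.exp_add, add_neg_cancel, Real.exp_zero, one_smul]
    · rw [evalAt_symplectization_partialT h, hY, (hX t).1]
      change -(Real.exp t • koszul k • -(koszul k * Real.exp (-t)) • _) = _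
      rw [smul_smul, smul_smul, ← neg_smul, ← one_smul ℝ (𝓜.evalAt t (app γ 𝓜.partialT))]
      rw [smul_smul]
      congr 1
      have h2 := koszul_mul_self k
      have h3 : Real.exp t * Real.exp (-t) = 1 := by
        rw [← Real.exp_add, add_neg_cancel, Real.exp_zero]
      linear_combination h2 * (Real.exp t * Real.exp (-t)) + h3

/-- Cartan's formula reads `d(ι_Q α) = ι_Q dα + φ α`, and multiplied by `e^t` this is the claim on
lifts. On `∂_t` both sides equal `e^t ι_Q α`. -/
theorem symplectization_contract_eq_dFun (h : IsPullback α β) {Q : VF (𝓜.grading ⊤) 1}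
    {φ : 𝓜.grading ⊤ 1} (hφ : lieOne Q α = -lmulForm φ α rfl)
    (hH : 𝓜.expT * 𝓜.proj (app α Q) ∈ 𝓜.prodReal.grading ⊤ (1 + n)) :
    dFun (⟨𝓜.expT * 𝓜.proj (app α Q), hH⟩ : 𝓜.prodReal.grading ⊤ (1 + n)) =
      (symplectization β).contract
        (liftVF Q + lmulVF (𝓜.projHom φ) 𝓜.partialT (add_zero 1)) := by
  refine prod_oneForm_ext (fun k Y => ?_) ?_
  · have h1 : (app (lieOne Q α) Y : 𝓜.O ⊤) = app (-lmulForm φ α rfl) Y := by rw [hφ]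
    rw [lieOne, app_add_form, app_neg_form, app_lmulForm, koszul_odd odd_one, 
      show (app ((-1 : ℝ) • dFun (app α Q)) Y : 𝓜.O ⊤) = (-1 : ℝ) • Y.1 (app α Q) from rfl] at h1
    have h2 : Y.1 (app α Q) = (app ((dOne α).contract Q) Y : 𝓜.O ⊤) +
        koszul ((k - 1) * 1) • ((φ : 𝓜.O ⊤) * app α Y) := by
      rw [neg_one_smul, ← sub_eq_add_neg, sub_eq_iff_eq_add] at h1
      rw [h1]; abel
    rw [app_dFun, app_contract_add, app_contract_lmul, symplectization_liftVF_liftVF h,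
      symplectization_partialT_liftVF h, leibnizVF_zero _ 𝓜.expT.2, liftVF_expT, zero_mul, zero_add,
      liftVF_proj, h2, map_add, map_smul, map_mul, mul_add, mul_smul_comm, ← mul_assoc,
      ← mul_assoc, mul_comm_of_degree_zero 𝓜.expT.2 (𝓜.proj φ)]
    rfl
  · rw [app_dFun, app_contract_add, app_contract_lmul, symplectization_liftVF_partialT h,
      symplectization_partialT_partialT h, leibnizVF_zero _ 𝓜.expT.2, partialT_expT, partialT_proj,
      koszul_odd odd_one]
    simp

/-- The field sends `p^* f` to `p^* (Q f)` and `t` to `φ`, so its square kills pullbacks and `t`. -/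
theorem isHomological_lift_add {Q : VF (𝓜.grading ⊤) 1} (hQ : IsHomological Q)
    {φ : 𝓜.grading ⊤ 1} (hφ : Q.1 φ = 0) :
    IsHomological (liftVF Q + lmulVF (𝓜.projHom φ) 𝓜.partialT (add_zero 1)) := by
  let X := liftVF Q + lmulVF (𝓜.projHom φ) 𝓜.partialT (add_zero 1)
  have hp : ∀ f, X.1 (𝓜.proj f) = 𝓜.proj (Q.1 f) := fun f => by
    simp only [X, Submodule.coe_add, LinearMap.add_apply, lmulVF_apply, partialT_proj, mul_zero,
      add_zero, liftVF_proj]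
  have ht : X.1 𝓜.coordT = 𝓜.proj φ := by
    simp only [X, Submodule.coe_add, LinearMap.add_apply, lmulVF_apply, partialT_coordT, mul_one,
      liftVF_coordT, zero_add]
    rfl
  -- The square is handled through `[X, X] = 2X²`, which is a vector field and hence determined by
  -- its action on pullbacks and `t`.
  have hb : bracket X X = 0 := by
    refine prod_VF_ext (fun t => VF.ext_of_graded fun j f _ => ?_) ?_
    · rw [projVF_apply, projVF_apply, bracket_apply, hp, hp, hQ, map_zero, smul_zero, sub_zero]
      rfl
    · rw [bracket_apply, ht, hp, hφ, map_zero, smul_zero, sub_zero]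
      rfl
  intro f
  have h1 : X.1 (X.1 f) - koszul (1 * 1) • X.1 (X.1 f) = 0 :=
    congrArg (fun Z : VF (𝓜.prodReal.grading ⊤) (1 + 1) => Z.1 f) hb
  rw [one_mul, koszul_odd odd_one, neg_one_smul, sub_neg_eq_add, ← two_smul ℝ] at h1
  exact (smul_eq_zero.1 h1).resolve_left two_ne_zero

end Symplectization

end NManifold

/-- In `L_X σ = ι_X dσ + (-1)^{|X|} d ι_X σ` the first term vanishes by closedness and the second
because `ι_X σ` is exact. -/
theorem isSymplecticVF_of_contract_eq_dFun {A : Type*} [Ring A] [Algebra ℝ A]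
    {𝒜 : ℤ → Submodule ℝ A} [GradedComm 𝒜] {n k : ℤ} {σ : TwoForm 𝒜 n}
    (hσ : ∀ {k l m : ℤ} (X : VF 𝒜 k) (Y : VF 𝒜 l) (Z : VF 𝒜 m), dTwoVal σ X Y Z = 0)
    {X : VF 𝒜 k} {f : 𝒜 (k + n)} (h : dFun f = σ.contract X) : IsSymplecticVF σ X := by
  intro l m Y Z
  have h1 := hσ X Y Z
  rwa [dTwoVal, ← h, app_dOne_dFun, smul_zero, sub_zero] at h1

theorem isHamiltonian_of_contract_eq_dFun {A : Type*} [Ring A] [Algebra ℝ A]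
    {𝒜 : ℤ → Submodule ℝ A} [GradedComm 𝒜] {n : ℤ} {σ : TwoForm 𝒜 n} {X : VF 𝒜 1} {f : A}
    {hf : f ∈ 𝒜 (1 + n)} (h : dFun ⟨f, hf⟩ = σ.contract X) : IsHamiltonian σ X f :=
  ⟨hf, by rw [h, sub_self, koszul_zero, one_smul]⟩

end NGeom

/-! ### Assembly of the theorem -/

theorem mainTheorem6 {E : Type*} [NormedAddCommGroup E] [NormedSpace ℝ E]
    [FiniteDimensional ℝ E] {H : Type*} [TopologicalSpace H] (I : ModelWithCorners ℝ E H)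
    [I.Boundaryless] {M : Type*} [TopologicalSpace M] [ChartedSpace H M] [IsManifold I ∞ M]
    [T2Space M] [SecondCountableTopology M] (𝓜 : NManifold I M) (n : ℕ)
    (α : OneForm (𝓜.grading ⊤) n) (hα : NManifold.IsContactForm α)
    (Q : VF (𝓜.grading ⊤) 1) (hQ : IsHomological Q) (hQα : IsContactVF α Q) :
    -- the function `φ` of degree `1` with `L_Q α = -φ α`
    ∃ φ : 𝓜.grading ⊤ 1, (∀ ψ : 𝓜.grading ⊤ 1, lieOne Q α = -lmulForm ψ α rfl ↔ ψ = φ) ∧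
    -- the pullback `β` of `α` to `𝓜 × ℝ`
    ∃ β : OneForm (𝓜.prodReal.grading ⊤) n, (∀ γ, NManifold.IsPullback α γ ↔ γ = β) ∧
    -- the lift `Q'` of `Q` to `𝓜 × ℝ`
    ∃ Q' : VF (𝓜.prodReal.grading ⊤) 1, (∀ X, NManifold.IsLift Q X ↔ X = Q') ∧
    -- the coordinate vector field `T = ∂_t` on `𝓜 × ℝ`
    ∃ T : VF (𝓜.prodReal.grading ⊤) 0, (∀ X, 𝓜.IsPartialT X ↔ X = T) ∧
    -- the symplectic form `σ = d (e^t α)` and the vector field `X = Q + φ ∂_t`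
    ∃ (σ : TwoForm (𝓜.prodReal.grading ⊤) n) (X : VF (𝓜.prodReal.grading ⊤) 1),
      σ = dOne (lmulForm 𝓜.expT β (zero_add _)) ∧
      X = Q' + lmulVF (𝓜.projHom φ) T (add_zero 1) ∧
      IsSymplectic σ ∧ IsHomological X ∧ IsSymplecticVF σ X ∧
      IsHamiltonian σ X (𝓜.expT * 𝓜.proj (app α Q)) := by
  obtain ⟨R, hR⟩ := hα.exists_reeb
  have hex := exists_unique_lieOne hR hQα
  obtain ⟨φ, hφ⟩ := hex
  have hpull := NManifold.exists_pullback α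
  obtain ⟨β, hβ⟩ := hpull
  have hφ' := (hφ φ).2 rfl
  have hβ' := (hβ β).2 rfl
  have hs := NManifold.isSymplectic_symplectization hα hβ'
  have hdeg : 𝓜.expT * 𝓜.proj (app α Q) ∈ 𝓜.prodReal.grading ⊤ (1 + (n : ℤ)) :=
    mem_degree (SetLike.mul_mem_graded 𝓜.expT.2 (NManifold.proj_mem (app α Q).2)) (by ring)
  have hH := NManifold.symplectization_contract_eq_dFun hβ' hφ' hdeg
  have hQ' := NManifold.isHomological_lift_add hQ (map_eq_zero_of_lieOne hR hQ hφ')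
  refine ⟨φ, hφ, β, hβ, NManifold.liftVF Q, fun X => NManifold.isLift_iff_eq, 𝓜.partialT,
    fun X => NManifold.isPartialT_iff_eq, NManifold.symplectization β,
    NManifold.liftVF Q + lmulVF (𝓜.projHom φ) 𝓜.partialT (add_zero 1), rfl, rfl, hs, hQ',
    isSymplecticVF_of_contract_eq_dFun hs.closed hH, isHamiltonian_of_contract_eq_dFun hH⟩
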